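/- **Setting.** Let $\kappa$ be an inaccessible cardinal, $S^{\kappa^+}_\kappa=\{\lambda<\kappa^+:\mathrm{cf}(\lambda)=\kappa\}$, and let $\langle D_\lambda:\lambda<\kappa^+\rangle$ be a $\Diamond_{\kappa^+}(S^{\kappa^+}_\kappa)$-sequence, i.e. $D_\lambda\subseteq\lambda$ for $\lambda \in S^{\kappa^+}_\kappa$, and for every $X\subseteq\kappa^+$ the set $\{\lambda\in S^{\kappa^+}_\kappa: X\cap\lambda=D_\lambda\}$ is stationary in $\kappa^+$. **Trees.** For $T\subseteq 2^{<\kappa}$ closed under initial segments, $\mathrm{Split}(T)$ is the set of $t\in T$ with $t^\frown 0,t^\frown 1\in T$; $\mathrm{Split}_\beta(T)$ is the set of $t\in\mathrm{Split}(T)$ for which $\{\alpha<|t|:t{\upharpoonright}\alpha\in\mathrm{Split}(T)\}$ has order type $\beta$; $T_t$ is the set of nodes of $T$ compatible with $t$. $\mathbb S^{\mathrm{club}}$ is the set of nonempty trees $T\subseteq 2^{<\kappa}$ (closed under initial segments) which are closed under unions of increasing sequences of nodes of length $<\kappa$, in which every node extends to a splitting node, and for which there is a club $C\subseteq\kappa$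 such that the splitting nodes of $T$ are exactly the nodes of $T$ with length in $C$. Trees are ordered by inclusion, $T\le T'$ iff $T\subseteq T'$; and $T\le_\gamma T'$ means $T\subseteq T'$ and $\mathrm{Split}_\gamma(T)=\mathrm{Split}_\gamma(T')$. For $T\in\mathbb S^{\mathrm{club}}$ let $\sigma_T:T\to2^{<\kappa}$ send $t$ to the sequence of values of $t$ at the $\alpha<|t|$ with $t{\upharpoonright}\alpha\in\mathrm{Split}(T)$, and put $\sigma_T^{-1}[S]=\{t\in T:\sigma_T(t)\in S\}$. "Closing a family" means taking the smallest family containing it that is closed under intersections of nonempty descending sequences of length $<\kappa$. **Coding.** Fix an injection $c$ of $\mathcal P(2^{<\kappa})\sqcup(\mathcal P(2^{<\kappa})\times\kappa\times\kappa)$ into $\kappa^+$. A set of ordinals codes a set $A$ of trees if it equals $\{c(S):S\in A\}$, and codes a matrix $\langle A_{i,j}:i,j<\kappa\rangle$ of sets of trees if it equals $\{c(S,i,j): i,j<\kappa,\ S\in A_{i,j}\}$. **The recursion.** Write $\mathbb F_{<\lambda}=\bigcup_{\alpha<\lambda}\mathbb F_\alpha$ and let $\mathrm{Rank}(T)$ be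 the least $\alpha$ with $T\in\mathbb F_{\alpha+1}$. A sequence $\langle\mathbb F_\lambda:\lambda<\kappa^+\rangle$ of families of trees *is produced by the recursion* (from $D$ and $c$) if: 1. $\mathbb F_0=\{(2^{<\kappa})_t:t\in2^{<\kappa}\}$. 2. $\mathbb F_{\lambda+1}$ is obtained as follows. For every $T\in\mathbb F_\lambda\setminus\mathbb F_{<\lambda}$ and $\gamma<\kappa$ some $T'\in\mathbb S^{\mathrm{club}}$ is chosen with $T'\le_\gamma T$ that contains no element of $\mathbb F_\lambda$ as a subset. Let $H$ consist of the elements of $\mathbb F_\lambda$ and of all $T'_t$, $t\in T'$, for all these $T'$. Then $\mathbb F_{\lambda+1}$ is the closure of $H\cup\{\sigma_T^{-1}[S]:T\in H\setminus\mathbb F_\lambda,\ S\in H\}$. 3. If $\lambda$ is a limit with $\mathrm{cf}(\lambda)<\kappa$, then $\mathbb F_\lambda$ is the closure of $\mathbb F_{<\lambda}$. 4. If $\mathrm{cf}(\lambda)=\kappa$, then for some increasing cofinal sequence $\langle\lambda_i:i<\kappa\rangle$ in $\lambda$ there is, for every $T\in\mathbb F_{<\lambda}$ and $\gamma<\kappa$,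 a chosen sequence $\langle T^i:i<\kappa\rangle$ in $\mathbb S^{\mathrm{club}}$ with $T^0=T$ and $T^i\le_{\gamma+j}T^j$ for $j<i$, such that for all $i<\kappa$ and $t\in\mathrm{Split}_{\gamma+i}(T^i)$ the tree $T^i_t$ is in $\mathbb F_{<\lambda}$ and has rank at least $\lambda_i$, and moreover: (a) if $D_\lambda$ codes a maximal antichain $A$ of $\mathbb F_{<\lambda}$, then for every $t\in\mathrm{Split}_{\gamma+1}(T^1)$ the tree $T^1_t$ is a subset of some element of $A$; (b) if $D_\lambda$ codes $\langle A_{i,j}:i,j<\kappa\rangle$ where for each $i$ the $A_{i,j}$ ($j<\kappa$) are pairwise disjoint with union a maximal antichain of $\mathbb F_{<\lambda}$, then for every $i<\kappa$ and $t\in\mathrm{Split}_{\gamma+i+1}(T^{i+1})$ the tree $T^{i+1}_t$ is a subset of some element of $\bigcup_{j<\kappa}A_{i,j}$. With $T^*=\bigcap_{i<\kappa}T^i$, $\mathbb F_\lambda$ is the closure of the union of $\mathbb F_{<\lambda}$ and the set of all $T^*_t$, $t\in T^*$, for all these $T^*$. **Proposition.** Codings $c$ as above exist. For every such $c$, the recursion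 can be carried out, that is, some sequence is produced by it; and whenever $\langle\mathbb F_\lambda:\lambda<\kappa^+\rangle$ is produced by it, the forcing $\mathbb F=\bigcup_{\lambda<\kappa^+}\mathbb F_\lambda$, ordered by inclusion, has the following three properties. - $\mathbb F$ is $<\kappa$-closed: every descending sequence of length $<\kappa$ has a lower bound. - $\mathbb F$ has the $\kappa^+$-chain condition: every antichain has size at most $\kappa$. - $\mathbb F$ is $\kappa^\kappa$-bounding: for every $\mathbb F$-name $\dot x$ and every $p \in \mathbb F$ with $p\Vdash\dot x\in\kappa^\kappa$ there are $q\le p$ and $z\in\kappa^\kappa$ in the ground model with $q\Vdash\forall\alpha<\kappa\ (\dot x(\alpha)<z(\alpha))$. -/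

import Mathlib

open Set Order

universe u v

namespace TreeForcing

/-! ### General notions: diamond sequences and properties of forcing notions -/

/-- `D` is a `◇_{κ⁺}(S)`-sequence for `S = {lam < κ⁺ : cf lam = κ}`: every `D lam` with `lam ∈ S` is
a subset of `lam`, and every `X ⊆ κ⁺` is guessed at stationarily many `lam ∈ S`. -/
def IsDiamondSeq (κ : Cardinal.{u}) (D : Ordinal.{u} → Set Ordinal.{u}) : Prop :=
  (∀ lam < (succ κ).ord, lam.cof = κ → D lam ⊆ Iio lam) ∧
  ∀ X : Set Ordinal.{u}, X ⊆ Iio (succ κ).ord →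
    IsStationary {lam : Iio (succ κ).ord | lam.1.cof = κ ∧ X ∩ Iio lam.1 = D lam.1}

/-- `<κ`-closure: descending sequences of length `< κ` have lower bounds. -/
def IsLtClosed (κ : Cardinal.{u}) (P : Type v) [Preorder P] : Prop :=
  ∀ δ < κ.ord, ∀ f : Iio δ → P, Antitone f → ∃ p, ∀ i, p ≤ f i

/-- Two conditions are compatible if they have a common extension. -/
def Compatible {P : Type v} [Preorder P] (p q : P) : Prop :=
  ∃ r, r ≤ p ∧ r ≤ q

/-- The `μ`-chain condition: every antichain (set of pairwise incompatible conditions) has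
cardinality less than `μ`. -/
def HasChainCondition (μ : Cardinal.{u}) (P : Type v) [Preorder P] : Prop :=
  ∀ A : Set P, A.Pairwise (fun p q => ¬ Compatible p q) →
    Cardinal.lift.{u} (Cardinal.mk A) < Cardinal.lift.{v} μ

/-- A (nice) `P`-name for a subset of `κ × κ`: a set of triples `(p, α, β)`, where `(p, α, β)`
says that `p` puts the pair `(α, β)` into the named set. -/
abbrev Name (κ : Cardinal.{u}) (P : Type v) : Type (max v (u + 1)) :=
  Set (P × Iio κ.ord × Iio κ.ord)

/-- `p ⊩ (α, β) ∈ N`. -/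
def ForcesMem {κ : Cardinal.{u}} {P : Type v} [Preorder P] (N : Name κ P) (p : P)
    (α β : Iio κ.ord) : Prop :=
  ∀ q ≤ p, ∃ r ≤ q, ∃ s, (s, α, β) ∈ N ∧ r ≤ s

/-- `p ⊩ N is a function from κ to κ`. -/
def ForcesFunction {κ : Cardinal.{u}} {P : Type v} [Preorder P] (N : Name κ P) (p : P) : Prop :=
  (∀ α, ∀ q ≤ p, ∃ r ≤ q, ∃ β, ForcesMem N r α β) ∧
  ∀ α β β', ∀ q ≤ p, ForcesMem N q α β → ForcesMem N q α β' → β = β'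

/-- `p ⊩ ∀ α < κ, N(α) < z(α)`, for a ground model function `z`. -/
def ForcesBounded {κ : Cardinal.{u}} {P : Type v} [Preorder P] (N : Name κ P) (p : P)
    (z : Iio κ.ord → Iio κ.ord) : Prop :=
  ∀ α, ∀ q ≤ p, ∃ r ≤ q, ∃ β < z α, ForcesMem N r α β

/-- `P` is `κ^κ`-bounding: every function `κ → κ` in the generic extension is bounded everywhere
by a function `κ → κ` of the ground model, that is, for every name `N` and every condition `p`
forcing `N` to be such a function, some `q ≤ p` forces `N` to be bounded by some ground model
function. -/
def IsBounding (κ : Cardinal.{u}) (P : Type v) [Preorder P] : Prop :=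
  ∀ (N : Name κ P) (p : P), ForcesFunction N p →
    ∃ q ≤ p, ∃ z : Iio κ.ord → Iio κ.ord, ForcesBounded N q z

/-! ### Trees -/

/-- The elements of `2^{<κ}`: a length `len < κ` together with a function `len → 2`, which is
represented by its extension by `false` to all ordinals. -/
@[ext]
structure Node (κ : Cardinal.{u}) : Type (u + 1) where
  len : Ordinal.{u}
  val : Ordinal.{u} → Bool
  len_lt : len < κ.ord
  val_eq_false : ∀ ξ, len ≤ ξ → val ξ = false

variable {κ : Cardinal.{u}}

/-- `s ≤ t` if `t` extends `s`. -/
instance : PartialOrder (Node κ) where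
  le s t := s.len ≤ t.len ∧ ∀ ξ < s.len, s.val ξ = t.val ξ
  le_refl s := ⟨le_rfl, fun _ _ => rfl⟩
  le_trans s t r h₁ h₂ :=
    ⟨h₁.1.trans h₂.1, fun ξ hξ => (h₁.2 ξ hξ).trans (h₂.2 ξ (hξ.trans_le h₁.1))⟩
  le_antisymm s t h₁ h₂ := by
    have hl : s.len = t.len := le_antisymm h₁.1 h₂.1
    refine Node.ext hl (funext fun ξ => ?_)
    rcases lt_or_ge ξ s.len with h | h
    · exact h₁.2 ξ h
    · rw [s.val_eq_false ξ h, t.val_eq_false ξ (hl ▸ h)]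

/-- `s` is `t` followed by the bit `b`. -/
def IsAppend (t : Node κ) (b : Bool) (s : Node κ) : Prop :=
  t ≤ s ∧ s.len = t.len + 1 ∧ s.val t.len = b

/-- `T_t`: the nodes of `T` that are compatible with `t`. -/
def cone (T : Set (Node κ)) (t : Node κ) : Set (Node κ) :=
  {s ∈ T | s ≤ t ∨ t ≤ s}

/-- `Split(T)`. -/
def Split (T : Set (Node κ)) : Set (Node κ) :=
  {t ∈ T | ∀ b, ∃ s ∈ T, IsAppend t b s}

/-- The set of `α < |t|` such that the restriction of `t` to `α` is in `Split(T)`. -/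
def splitLevelsBelow (T : Set (Node κ)) (t : Node κ) : Set Ordinal.{u} :=
  {α | ∃ s ∈ Split T, s < t ∧ s.len = α}

/-- `Split_β(T)`: the splitting nodes of `T` of rank `β`, where the rank of `t` is the order type
of `splitLevelsBelow T t`. -/
def SplitRank (β : Ordinal.{u}) (T : Set (Node κ)) : Set (Node κ) :=
  {t ∈ Split T | Nonempty (splitLevelsBelow T t ≃o Iio β)}

/-- The forcing `𝕊^club`: nonempty trees `T ⊆ 2^{<κ}` closed under increasing unions of length
less than `κ`, in which every node can be extended to a splitting node, and such that for some
club `C` in `κ` the splitting nodes of `T` are exactly the nodes of `T` with length in `C`. -/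
structure IsClubTree (T : Set (Node κ)) : Prop where
  nonempty : T.Nonempty
  isLowerSet : IsLowerSet T
  limit_mem : ∀ t : Node κ, IsSuccLimit t.len → (∀ s < t, s ∈ T) → t ∈ T
  exists_split : ∀ t ∈ T, ∃ s ∈ Split T, t ≤ s
  exists_club : ∃ C : Set (Iio κ.ord), IsClub C ∧
    ∀ t ∈ T, t ∈ Split T ↔ (⟨t.len, t.len_lt⟩ : Iio κ.ord) ∈ C

/-- `T ≤_γ T'`. -/
def LeRank (γ : Ordinal.{u}) (T T' : Set (Node κ)) : Prop :=
  T ⊆ T' ∧ SplitRank γ T = SplitRank γ T'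

/-- `σ⁻¹[S]`, where `σ : T → 2^{<κ}` is the canonical isomorphism collapsing `T` onto the full
binary tree. It sends `t` to the sequence of the values that `t` takes at the elements of
`splitLevelsBelow T t`, enumerated in increasing order. -/
def collapsePreimage (T S : Set (Node κ)) : Set (Node κ) :=
  {t ∈ T | ∃ s ∈ S, ∃ e : splitLevelsBelow T t ≃o Iio s.len,
    ∀ α, t.val α.1 = s.val (e α).1}

/-- The closure of a family `G` of trees under intersections of (nonempty) descending sequences of
length less than `κ`. -/
inductive InterClosure (G : Set (Set (Node κ))) : Set (Node κ) → Prop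
  | base (T : Set (Node κ)) : T ∈ G → InterClosure G T
  | inter (δ : Ordinal.{u}) (T : Ordinal.{u} → Set (Node κ)) :
      0 < δ → δ < κ.ord → (∀ i < δ, InterClosure G (T i)) → (∀ i < δ, ∀ j < i, T i ⊆ T j) →
      InterClosure G {t | ∀ i < δ, t ∈ T i}

/-! ### The recursive construction -/

/-- `F_{<lam}`. -/
def below (F : Ordinal.{u} → Set (Set (Node κ))) (lam : Ordinal.{u}) : Set (Set (Node κ)) :=
  {T | ∃ α < lam, T ∈ F α}

/-- `Rank(T)`: the least `α` such that `T ∈ F_{α+1}`. -/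
noncomputable def treeRank (F : Ordinal.{u} → Set (Set (Node κ))) (T : Set (Node κ)) :
    Ordinal.{u} :=
  sInf {α | T ∈ F (α + 1)}

/-- `A` is a maximal antichain in the family `G` of trees, which is ordered by inclusion. -/
def IsMaxAntichain (G A : Set (Set (Node κ))) : Prop :=
  A ⊆ G ∧ (∀ S ∈ A, ∀ T ∈ A, S ≠ T → ¬ ∃ R ∈ G, R ⊆ S ∧ R ⊆ T) ∧
  ∀ T ∈ G, ∃ S ∈ A, ∃ R ∈ G, R ⊆ S ∧ R ⊆ T

/-- `A i j` (`i, j < κ`) is a matrix of sets of trees in which the entries of each row are pairwise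
disjoint and their union is a maximal antichain in `G`. -/
def IsAntichainMatrix (G : Set (Set (Node κ)))
    (A : Iio κ.ord → Iio κ.ord → Set (Set (Node κ))) : Prop :=
  ∀ i, IsMaxAntichain G (⋃ j, A i j) ∧ ∀ j₀ j₁, j₀ ≠ j₁ → A i j₀ ∩ A i j₁ = ∅

/-- A coding of single trees, and of trees together with two indices below `κ`, by ordinals
below `κ⁺`. -/
abbrev Coding (κ : Cardinal.{u}) : Type (u + 1) :=
  (Set (Node κ) ⊕ (Set (Node κ) × Iio κ.ord × Iio κ.ord)) ↪ Iio (succ κ).ord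

/-- The set of ordinals coding a set `A` of trees. -/
def codeSet (c : Coding κ) (A : Set (Set (Node κ))) : Set Ordinal.{u} :=
  {ξ | ∃ S ∈ A, ξ = (c (Sum.inl S)).1}

/-- The set of ordinals coding a matrix of sets of trees. -/
def codeMatrix (c : Coding κ) (A : Iio κ.ord → Iio κ.ord → Set (Set (Node κ))) :
    Set Ordinal.{u} :=
  {ξ | ∃ i j, ∃ S ∈ A i j, ξ = (c (Sum.inr (S, i, j))).1}

/-- The first part of the successor step: the trees of `G = F_lam` and the trees `T'_t`, where `T'`
is the tree chosen for some `T ∈ F_lam ∖ F_{<lam}` and `γ < κ`. -/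
def succPicks (G Glt : Set (Set (Node κ))) (pick : Set (Node κ) → Ordinal.{u} → Set (Node κ)) :
    Set (Set (Node κ)) :=
  G ∪ {R | ∃ T ∈ G \ Glt, ∃ γ < κ.ord, ∃ t ∈ pick T γ, R = cone (pick T γ) t}

/-- The second part of the successor step: add `σ⁻¹[S]` for the canonical isomorphisms `σ` of the
new trees `T`. -/
def succCopies (G H : Set (Set (Node κ))) : Set (Set (Node κ)) :=
  H ∪ {R | ∃ T ∈ H \ G, ∃ S ∈ H, R = collapsePreimage T S}

/-- `G' = F_{lam+1}` arises from `G = F_lam` and `Glt = F_{<lam}` by the successor step. -/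
def IsSuccStage (Glt G G' : Set (Set (Node κ))) : Prop :=
  ∃ pick : Set (Node κ) → Ordinal.{u} → Set (Node κ),
    (∀ T ∈ G \ Glt, ∀ γ < κ.ord,
      IsClubTree (pick T γ) ∧ LeRank γ (pick T γ) T ∧ ∀ S ∈ G, ¬ S ⊆ pick T γ) ∧
    G' = {R | InterClosure (succCopies G (succPicks G Glt pick)) R}

/-- `ladder` is an increasing cofinal sequence of length `κ` in `lam`. -/
def IsLadder (κ : Cardinal.{u}) (lam : Ordinal.{u}) (ladder : Ordinal.{u} → Ordinal.{u}) : Prop :=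
  StrictMonoOn ladder (Iio κ.ord) ∧ (∀ i < κ.ord, ladder i < lam) ∧
  ∀ β < lam, ∃ i < κ.ord, β ≤ ladder i

/-- `s` is a `κ`-fusion sequence below `T`, starting from rank `γ`, with ranks along `ladder`. -/
structure IsFusion (F : Ordinal.{u} → Set (Set (Node κ))) (lam : Ordinal.{u})
    (ladder : Ordinal.{u} → Ordinal.{u}) (T : Set (Node κ)) (γ : Ordinal.{u})
    (s : Ordinal.{u} → Set (Node κ)) : Prop where
  isClubTree : ∀ i < κ.ord, IsClubTree (s i)
  zero : s 0 = T
  leRank : ∀ i < κ.ord, ∀ j < i, LeRank (γ + j) (s i) (s j)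
  cone_mem : ∀ i < κ.ord, ∀ t ∈ SplitRank (γ + i) (s i),
    cone (s i) t ∈ below F lam ∧ ladder i ≤ treeRank F (cone (s i) t)

/-- In passing from `s i` to `s (i + 1)`, the antichain `A` is hit: `s (i + 1)` is the union of
trees each of which is a subtree of an element of `A`. -/
def HitsAt (A : Set (Set (Node κ))) (γ : Ordinal.{u}) (s : Ordinal.{u} → Set (Node κ))
    (i : Ordinal.{u}) : Prop :=
  ∀ t ∈ SplitRank (γ + (i + 1)) (s (i + 1)), ∃ S ∈ A, cone (s (i + 1)) t ⊆ S

/-- The intersection of a fusion sequence. -/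
def fusionLimit (s : Ordinal.{u} → Set (Node κ)) : Set (Node κ) :=
  {t | ∀ i < κ.ord, t ∈ s i}

/-- The step at `lam` with `cf lam = κ`. -/
def IsFusionStage (D : Ordinal.{u} → Set Ordinal.{u}) (c : Coding κ)
    (F : Ordinal.{u} → Set (Set (Node κ))) (lam : Ordinal.{u}) : Prop :=
  ∃ ladder : Ordinal.{u} → Ordinal.{u}, IsLadder κ lam ladder ∧
  ∃ s : Set (Node κ) → Ordinal.{u} → Ordinal.{u} → Set (Node κ),
    (∀ T ∈ below F lam, ∀ γ < κ.ord,
      IsFusion F lam ladder T γ (s T γ) ∧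
      (∀ A, IsMaxAntichain (below F lam) A → D lam = codeSet c A → HitsAt A γ (s T γ) 0) ∧
      (∀ A, IsAntichainMatrix (below F lam) A → D lam = codeMatrix c A →
        ∀ i : Iio κ.ord, HitsAt (⋃ j, A i j) γ (s T γ) i.1)) ∧
    F lam = {R | InterClosure (below F lam ∪ {R | ∃ T ∈ below F lam, ∃ γ < κ.ord,
      ∃ t ∈ fusionLimit (s T γ), R = cone (fusionLimit (s T γ)) t}) R}

/-- `F` is a sequence `⟨F_lam : lam < κ⁺⟩` produced by the recursive construction from the sequence
`D` and the coding `c`. -/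
structure IsConstruction (D : Ordinal.{u} → Set Ordinal.{u}) (c : Coding κ)
    (F : Ordinal.{u} → Set (Set (Node κ))) : Prop where
  base : F 0 = {R | ∃ t : Node κ, R = cone univ t}
  step : ∀ lam < (succ κ).ord, IsSuccStage (below F lam) (F lam) (F (lam + 1))
  limit_small : ∀ lam < (succ κ).ord, IsSuccLimit lam → lam.cof < κ →
    F lam = {R | InterClosure (below F lam) R}
  limit_big : ∀ lam < (succ κ).ord, lam.cof = κ → IsFusionStage D c F lam

/-- The forcing `F = ⋃_{lam < κ⁺} F_lam`, as a set of trees. As a type it is ordered by inclusion,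
so that smaller trees are stronger conditions. -/
def total (F : Ordinal.{u} → Set (Set (Node κ))) : Set (Set (Node κ)) :=
  below F (succ κ).ord

end TreeForcing

/-!
# A `κ^κ`-bounding forcing with the `κ⁺`-chain condition

All families of trees that occur consist of trees `T` in `𝕊^club`, and these are handled through
the closed unbounded set `lev T` of their splitting levels and its enumeration `levEnum T`. For such
trees, `T' ≤_γ T` says that `T'` is a subtree of `T` with the same nodes up to the `γ`-th splitting
level (`leRank_of_agree`). Intersections of descending sequences of length less than `κ`, or of
fusion sequences of length `κ`, are again in `𝕊^club`.

*The stages.* The stages increase, have size at most `κ`, and are closed under cones. The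
basic fact is `IsPartial.mem_or_not_subset`: a tree that first appears after stage `α` contains no tree
from stage `α`. So passing to a subtree never decreases the rank.

*Carrying out the recursion.* The difficulty lies in the fusion step at `lam` of cofinality `κ`. To
pass from `T^i` to `T^{i+1}`, one shrinks the fewer than `κ` cones of `T^i` above a splitting level,
into trees of high rank below a given antichain, and glues the results together. The union is in
`𝕊^club` only if all these trees have the same splitting levels. This is ensured by a choice
at the successor stages: as `F_β` has at most `κ` elements, there is a closed unbounded
pseudointersection `E` of the limits of their splitting levels, and all trees chosen at
stage `β + 1` are taken to have splitting levels that eventually are those in `E`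
(`exists_pick`, `SyncStep`). That a chosen tree contains no member of `F_β` is achieved by a
diagonalization at splitting levels that are dropped. Given fewer than `κ` trees in `F_{<lam}`, one
shrinks them below the antichain, moves them to a common stage `β`
(`IsPartial.exists_subset_notMem_below`), applies the synchronization there, and passes to cones
(`IsPartial.syncDense`). With this, `exists_fusionSeq` constructs the fusion sequences.

*The properties.* The closure under short descending sequences holds since stages are closed under
intersections and `κ⁺` is regular. For the chain condition, a maximal antichain `A` is guessed at some
`lam` at which `A ∩ F_{<lam}` is maximal in `F_{<lam}`. By induction, every tree from a stage `β ≥ lam`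
is either in `F_{<lam}` or is covered by `A ∩ F_{<lam}`: its cones at the nodes of some level are
contained in members of that set (`IsPartial.mem_or_isCovered`). So `A` is contained in `F_lam`, which
has size at most `κ`. For bounding, the same reflection is applied to a matrix of `κ` antichains that
decide the values of the name, and the fusion limit at `lam` leaves fewer than `κ` possibilities for
each value.
-/

set_option linter.unusedSectionVars false

namespace TreeForcing

/-! ### Ordinals: bounds, recursion, closed unbounded sets and their enumerations -/

/-- Fewer than `cf Λ` ordinals below `Λ` are bounded below `Λ`. -/
theorem exists_bound {Λ : Ordinal.{u}} {X : Type (u + 1)}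
    (hX : Cardinal.mk X < Cardinal.lift.{u + 1} Λ.cof) (f : X → Ordinal.{u}) (hf : ∀ x, f x < Λ) :
    ∃ β < Λ, ∀ x, f x ≤ β := by
  have hsm : Small.{u} X := by
    rw [Cardinal.small_iff_lift_mk_lt_univ]
    simpa using hX.trans (Cardinal.lift_lt_univ' _)
  refine ⟨sSup (range f), ?_, fun x => le_csSup (Ordinal.bddAbove_of_small) (mem_range_self x)⟩
  apply Ordinal.sSup_lt_of_lt_cof
  · rw [← Ordinal.lift_cof]
    exact Cardinal.mk_range_le.trans_lt hX
  · rintro _ ⟨x, rfl⟩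
    exact hf x

theorem mk_Iio_lt {c : Cardinal.{u}} {δ : Ordinal.{u}} (hδ : δ < c.ord) :
    Cardinal.mk (Iio δ) < Cardinal.lift.{u + 1} c := by
  rw [Cardinal.mk_Iio_ordinal, Cardinal.lift_lt]
  exact Cardinal.lt_ord.1 hδ

/-- The version of `exists_bound` for families indexed by an ordinal. -/
theorem exists_bound_Iio {Λ δ : Ordinal.{u}} (hδ : δ < Λ.cof.ord) (f : Ordinal.{u} → Ordinal.{u})
    (hf : ∀ i < δ, f i < Λ) : ∃ β < Λ, ∀ i < δ, f i ≤ β := by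
  obtain ⟨β, hβ, h⟩ := exists_bound (Λ := Λ) (X := Iio δ) (mk_Iio_lt hδ) (fun i => f i.1)
    (fun i => hf i.1 i.2)
  exact ⟨β, hβ, fun i hi => h ⟨i, hi⟩⟩

/-- Closing off under a relation in `ω` steps. -/
theorem exists_iterate_sup {o : Ordinal.{u}} (ho : Cardinal.aleph0 < o.cof)
    {R : Ordinal.{u} → Ordinal.{u} → Prop} (step : ∀ a < o, ∃ b < o, a < b ∧ R a b)
    {α : Ordinal.{u}} (hα : α < o) :
    ∃ (a : ℕ → Ordinal.{u}) (σ : Ordinal.{u}), StrictMono a ∧ a 0 = α ∧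
      (∀ n, R (a n) (a (n + 1))) ∧ σ < o ∧ (∀ n, a n < σ) ∧ ∀ β < σ, ∃ n, β < a n := by
  choose! b hb hlt hR using step
  let a : ℕ → Ordinal.{u} := fun n => b^[n] α
  have hsucc : ∀ n, a (n + 1) = b (a n) := fun n => Function.iterate_succ_apply' b n _
  have ha : ∀ n, a n < o := by
    intro n
    induction n with
    | zero => exact hα
    | succ n ih =>
      rw [hsucc]
      exact hb _ ih
  have hmono : StrictMono a := strictMono_nat_of_lt_succ fun n => by
    rw [hsucc]
    exact hlt _ (ha n)
  refine ⟨a, sSup (range a), hmono, rfl, fun n => ?_, ?_, fun n => ?_, fun β hβ => ?_⟩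
  · rw [hsucc]
    exact hR _ (ha n)
  · apply Ordinal.sSup_lt_of_lt_cof
    · rw [← Ordinal.lift_cof]
      refine lt_of_le_of_lt ?_ (Cardinal.aleph0_lt_lift.2 ho)
      exact Cardinal.mk_le_aleph0_iff.2 (countable_range a)
    · rintro _ ⟨n, rfl⟩
      exact ha n
  · exact (hmono (Nat.lt_succ_self n)).trans_le
      (le_csSup (Ordinal.bddAbove_of_small) ⟨n + 1, rfl⟩)
  · obtain ⟨_, ⟨n, rfl⟩, h⟩ := exists_lt_of_lt_csSup (range_nonempty a) hβ
    exact ⟨n, h⟩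

/-- Transfinite recursion with choices: if `Q α F` depends only on the restriction of `F` to the
ordinals up to `α`, and a sequence that satisfies `Q` so far can always be continued, then there is
a sequence that satisfies `Q` throughout. -/
theorem exists_rec {X : Type v} (Λ : Ordinal.{u}) (Q : Ordinal.{u} → (Ordinal.{u} → X) → Prop)
    (x₀ : X)
    (hcongr : ∀ α < Λ, ∀ F F', (∀ β ≤ α, F β = F' β) → (∀ β < α, Q β F') → Q α F → Q α F')
    (hstep : ∀ α < Λ, ∀ F, (∀ β < α, Q β F) → ∃ y, Q α (Function.update F α y)) :
    ∃ F, ∀ α < Λ, Q α F := by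
  classical
  let tr : (α : Ordinal.{u}) → ((β : Ordinal.{u}) → β < α → X) → Ordinal.{u} → X :=
    fun α f β => if h : β < α then f β h else x₀
  let F : Ordinal.{u} → X := WellFounded.fix (C := fun _ => X) Ordinal.lt_wf fun α f =>
    if h : ∃ y, Q α (Function.update (tr α f) α y) then h.choose else x₀
  have hF : ∀ α, F α = if h : ∃ y, Q α (Function.update (tr α fun β _ => F β) α y)
      then h.choose else x₀ := fun α => WellFounded.fix_eq _ _ _
  refine ⟨F, fun α => ?_⟩
  induction α using WellFoundedLT.induction with
  | ind α ih =>
    intro hα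
    have agree : ∀ y, ∀ β < α, F β = Function.update (tr α fun β _ => F β) α y β := by
      intro y β hβ
      rw [Function.update_of_ne hβ.ne]
      simp [tr, hβ]
    have agree' : ∀ β < α, F β = tr α (fun β _ => F β) β := by
      intro β hβ
      simp [tr, hβ]
    have hlt : ∀ β < α, Q β (tr α fun β _ => F β) := by
      intro β
      induction β using WellFoundedLT.induction with
      | ind β ihβ =>
        intro hβ
        exact hcongr β (hβ.trans hα) F _ (fun γ hγ => agree' γ (hγ.trans_lt hβ))
          (fun γ hγ => ihβ γ hγ (hγ.trans hβ)) (ih β hβ (hβ.trans hα))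
    have hex := hstep α hα _ hlt
    have hFα : F α = hex.choose := by rw [hF α, dif_pos hex]
    refine hcongr α hα _ F (fun β hβ => ?_) (fun β hβ => ih β hβ (hβ.trans hα)) hex.choose_spec
    rcases hβ.lt_or_eq with h | rfl
    · exact (agree _ β h).symm
    · rw [hFα, Function.update_self]

/-- `C` is a closed unbounded subset of the ordinal `o`, where closedness is expressed by limit
points. -/
structure IsClubIn (o : Ordinal.{u}) (C : Set Ordinal.{u}) : Prop where
  lt : ∀ α ∈ C, α < o
  unbounded : ∀ α < o, ∃ β ∈ C, α < β
  closed : ∀ α < o, α ≠ 0 → (∀ β < α, ∃ γ ∈ C, β < γ ∧ γ < α) → α ∈ C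

theorem isClubIn_of_isClub {o : Ordinal.{u}} (ho : IsSuccLimit o) {C : Set (Iio o)}
    (hC : IsClub C) : IsClubIn o (Subtype.val '' C) := by
  refine ⟨?_, ?_, ?_⟩
  · rintro _ ⟨α, _, rfl⟩
    exact α.2
  · intro α hα
    obtain ⟨β, hβ, h⟩ := hC.isCofinal ⟨succ α, ho.succ_lt hα⟩
    exact ⟨β, ⟨β, hβ, rfl⟩, (lt_succ α).trans_le h⟩
  · intro α hα h0 h
    refine ⟨⟨α, hα⟩, hC.isLUB_mem (t := {x ∈ C | x.1 < α}) (fun x hx => hx.1) ?_ ?_, rfl⟩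
    · obtain ⟨γ, ⟨γ', hγ, rfl⟩, _, h2⟩ := h 0 (pos_iff_ne_zero.2 h0)
      exact ⟨γ', hγ, h2⟩
    · refine ⟨fun x hx => hx.2.le, fun b hb => ?_⟩
      by_contra hlt
      obtain ⟨γ, ⟨γ', hγ, rfl⟩, h1, h2⟩ := h b.1 (not_le.1 hlt)
      exact absurd (hb ⟨hγ, h2⟩) (not_le.2 h1)

theorem IsClubIn.isClub {o : Ordinal.{u}} {C : Set Ordinal.{u}} (hC : IsClubIn o C) :
    IsClub {x : Iio o | x.1 ∈ C} := by
  refine ⟨?_, fun x => ?_⟩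
  · intro d hd hne _ a ha
    by_cases had : a ∈ d
    · exact hd had
    · have key : ∀ β < a.1, ∃ γ ∈ C, β < γ ∧ γ < a.1 := by
        intro β hβ
        by_contra hcon
        have : a ≤ (⟨β, hβ.trans a.2⟩ : Iio o) := ha.2 fun x hx => by
          by_contra hx'
          refine hcon ⟨x.1, hd hx, not_le.1 hx', lt_of_le_of_ne (ha.1 hx) ?_⟩
          intro e
          exact had (Subtype.ext e ▸ hx)
        exact absurd this (not_le.2 hβ)
      refine hC.closed a.1 a.2 ?_ key
      obtain ⟨x, hx⟩ := hne
      have : x < a := lt_of_le_of_ne (ha.1 hx) fun e => had (e ▸ hx)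
      exact (bot_le.trans_lt (show x.1 < a.1 from this)).ne'
  · obtain ⟨β, hβ, h⟩ := hC.unbounded x.1 x.2
    exact ⟨⟨β, hC.lt β hβ⟩, hβ, h.le⟩

theorem IsClubIn.exists_ge {o : Ordinal.{u}} {C : Set Ordinal.{u}} (hC : IsClubIn o C)
    {α : Ordinal.{u}} (hα : α < o) : ∃ β ∈ C, α ≤ β := by
  obtain ⟨β, hβ, h⟩ := hC.unbounded α hα
  exact ⟨β, hβ, h.le⟩

/-- The increasing enumeration of a subset of `o`. Its values at ordinals that exceed the order
type of `C` are irrelevant. -/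
noncomputable def enumBelow (o : Ordinal.{u}) (C : Set Ordinal.{u}) : Ordinal.{u} → Ordinal.{u} :=
  Ordinal.enumOrd (C ∪ Ici o)

theorem not_bddAbove_union_Ici (o : Ordinal.{u}) (C : Set Ordinal.{u}) :
    ¬ BddAbove (C ∪ Ici o) := by
  rw [not_bddAbove_iff]
  intro x
  exact ⟨max o (succ x), Or.inr (mem_Ici.2 (le_max_left _ _)), (lt_succ x).trans_le (le_max_right _ _)⟩

theorem enumBelow_strictMono (o : Ordinal.{u}) (C : Set Ordinal.{u}) :
    StrictMono (enumBelow o C) :=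
  Ordinal.enumOrd_strictMono (not_bddAbove_union_Ici o C)

theorem enumBelow_lt {c : Cardinal.{u}} (hc : c.IsRegular) {C : Set Ordinal.{u}}
    (hC : IsClubIn c.ord C) {β : Ordinal.{u}} (hβ : β < c.ord) : enumBelow c.ord C β < c.ord := by
  induction β using WellFoundedLT.induction with
  | ind β ih =>
    obtain ⟨ε, hε, h⟩ := exists_bound_Iio (Λ := c.ord) (δ := β) (by rwa [hc.cof_ord])
      (enumBelow c.ord C) (fun i hi => ih i hi (hi.trans hβ))
    obtain ⟨α, hα, h'⟩ := hC.unbounded ε hε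
    exact (Ordinal.enumOrd_le_of_forall_lt (Or.inl hα)
      (fun i hi => (h i hi).trans_lt h')).trans_lt (hC.lt α hα)

theorem enumBelow_mem {c : Cardinal.{u}} (hc : c.IsRegular) {C : Set Ordinal.{u}}
    (hC : IsClubIn c.ord C) {β : Ordinal.{u}} (hβ : β < c.ord) : enumBelow c.ord C β ∈ C := by
  rcases Ordinal.enumOrd_mem (not_bddAbove_union_Ici c.ord C) β with h | h
  · exact h
  · exact absurd (enumBelow_lt hc hC hβ) (not_lt.2 h)

theorem IsClubIn.exists_enumBelow {o : Ordinal.{u}} {C : Set Ordinal.{u}}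
    (hC : IsClubIn o C) {α : Ordinal.{u}} (hα : α ∈ C) : ∃ β < o, enumBelow o C β = α := by
  obtain ⟨β, hβ⟩ := Ordinal.enumOrd_surjective (not_bddAbove_union_Ici o C) (Or.inl hα)
  refine ⟨β, lt_of_le_of_lt ?_ (hC.lt α hα), hβ⟩
  rw [← hβ]
  exact (enumBelow_strictMono o C).le_apply

/-- The order type of the part of `C` below `δ`. -/
noncomputable def countBelow (o : Ordinal.{u}) (C : Set Ordinal.{u}) (δ : Ordinal.{u}) :
    Ordinal.{u} :=
  sInf {β | δ ≤ enumBelow o C β}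

theorem lt_countBelow {o : Ordinal.{u}} {C : Set Ordinal.{u}} {δ β : Ordinal.{u}} :
    β < countBelow o C δ ↔ enumBelow o C β < δ := by
  constructor
  · intro h
    by_contra h'
    exact absurd h (not_lt.2 (csInf_le' (not_lt.1 h')))
  · intro h
    by_contra h'
    have : δ ≤ enumBelow o C (countBelow o C δ) :=
      csInf_mem (s := {β | δ ≤ enumBelow o C β}) ⟨δ, (enumBelow_strictMono o C).le_apply⟩
    exact absurd h (not_lt.2 (this.trans ((enumBelow_strictMono o C).monotone (not_lt.1 h'))))

theorem countBelow_enumBelow (o : Ordinal.{u}) (C : Set Ordinal.{u}) (β : Ordinal.{u}) :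
    countBelow o C (enumBelow o C β) = β :=
  eq_of_forall_lt_iff fun γ => by
    rw [lt_countBelow, (enumBelow_strictMono o C).lt_iff_lt]

theorem countBelow_mono (o : Ordinal.{u}) (C : Set Ordinal.{u}) : Monotone (countBelow o C) := by
  intro a b hab
  refine le_of_forall_lt fun γ hγ => ?_
  rw [lt_countBelow] at hγ ⊢
  exact hγ.trans_le hab

theorem countBelow_le (o : Ordinal.{u}) (C : Set Ordinal.{u}) (δ : Ordinal.{u}) :
    countBelow o C δ ≤ δ :=
  csInf_le' (enumBelow_strictMono o C).le_apply

theorem countBelow_succ {o : Ordinal.{u}} {C : Set Ordinal.{u}} {δ : Ordinal.{u}}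
    (hδ : δ < o) (h : δ ∉ C) :
    countBelow o C (δ + 1) = countBelow o C δ :=
  eq_of_forall_lt_iff fun γ => by
    rw [lt_countBelow, lt_countBelow, Order.lt_add_one_iff]
    refine ⟨fun h' => lt_of_le_of_ne h' ?_, le_of_lt⟩
    rintro rfl
    rcases Ordinal.enumOrd_mem (not_bddAbove_union_Ici o C) γ with h1 | h1
    · exact h h1
    · exact absurd hδ (not_lt.2 h1)

/-- An order isomorphism between two ordinals is the identity. -/
theorem Iio_orderIso_apply {a b : Ordinal.{u}} (f : Iio a ≃o Iio b) (x : Iio a) :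
    (f x).1 = x.1 := by
  obtain ⟨x, hx⟩ := x
  induction x using WellFoundedLT.induction with
  | ind x ih =>
    rcases lt_trichotomy (f ⟨x, hx⟩).1 x with h | h | h
    · have h1 := ih _ h (h.trans hx)
      have h2 : f ⟨(f ⟨x, hx⟩).1, h.trans hx⟩ = f ⟨x, hx⟩ := Subtype.ext h1
      have h3 := congrArg Subtype.val (f.injective h2)
      exact absurd h3 h.ne
    · exact h
    · have hb : x < b := h.trans (f ⟨x, hx⟩).2
      have hz : f.symm ⟨x, hb⟩ < ⟨x, hx⟩ := by
        rw [← f.lt_iff_lt, f.apply_symm_apply]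
        exact h
      have h1 := ih (f.symm ⟨x, hb⟩).1 hz (f.symm ⟨x, hb⟩).2
      have h2 : f ⟨(f.symm ⟨x, hb⟩).1, (f.symm ⟨x, hb⟩).2⟩ = ⟨x, hb⟩ := f.apply_symm_apply _
      rw [h2] at h1
      exact absurd h1 (ne_of_gt hz)

theorem eq_of_Iio_orderIso {a b : Ordinal.{u}} (f : Iio a ≃o Iio b) : a = b :=
  eq_of_forall_lt_iff fun x =>
    ⟨fun h => by simpa [Iio_orderIso_apply] using (f ⟨x, h⟩).2,
      fun h => by simpa [Iio_orderIso_apply] using (f.symm ⟨x, h⟩).2⟩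

/-- The isomorphism between the ordinal `countBelow o C δ` and the part of `C` below `δ`. -/
noncomputable def countIso {o : Ordinal.{u}} {C : Set Ordinal.{u}} {δ : Ordinal.{u}}
    (hδ : δ ≤ o) : Iio (countBelow o C δ) ≃o ↥(C ∩ Iio δ) :=
  StrictMono.orderIsoOfSurjective
    (fun β => ⟨enumBelow o C β.1, by
      have h := lt_countBelow.1 β.2
      refine ⟨?_, h⟩
      rcases Ordinal.enumOrd_mem (not_bddAbove_union_Ici o C) β.1 with h1 | h1
      · exact h1
      · exact absurd (h.trans_le hδ) (not_lt.2 h1)⟩)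
    (fun a b hab => enumBelow_strictMono o C hab)
    (fun α => by
      obtain ⟨β, hβ⟩ := Ordinal.enumOrd_surjective (not_bddAbove_union_Ici o C) (Or.inl α.2.1)
      have hβ' : enumBelow o C β = α.1 := hβ
      exact ⟨⟨β, lt_countBelow.2 (hβ'.trans_lt α.2.2)⟩, Subtype.ext hβ⟩)

theorem nonempty_orderIso_iff {o : Ordinal.{u}} {C : Set Ordinal.{u}} {δ β : Ordinal.{u}}
    (hδ : δ ≤ o) : Nonempty (↥(C ∩ Iio δ) ≃o Iio β) ↔ countBelow o C δ = β :=
  ⟨fun ⟨e⟩ => eq_of_Iio_orderIso ((countIso hδ).trans e),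
    fun h => ⟨h ▸ (countIso hδ).symm⟩⟩

section
variable {κ : Cardinal.{u}}

/-! ### Nodes -/

theorem isRegular_of_fact [h : Fact κ.IsInaccessible] : κ.IsRegular := h.out.isRegular

theorem isSuccLimit_ord [h : Fact κ.IsInaccessible] : IsSuccLimit κ.ord :=
  Cardinal.isSuccLimit_ord h.out.aleph0_lt.le

theorem zero_lt_ord [Fact κ.IsInaccessible] : 0 < κ.ord := (isSuccLimit_ord (κ := κ)).bot_lt

theorem add_one_lt_ord [Fact κ.IsInaccessible] {α : Ordinal.{u}} (h : α < κ.ord) :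
    α + 1 < κ.ord := (isSuccLimit_ord (κ := κ)).succ_lt h

namespace Node

theorem le_def {s t : Node κ} : s ≤ t ↔ s.len ≤ t.len ∧ ∀ ξ < s.len, s.val ξ = t.val ξ := Iff.rfl

/-- The restriction of a node to `α`. -/
noncomputable def res (t : Node κ) (α : Ordinal.{u}) : Node κ where
  len := min α t.len
  val ξ := by classical exact if ξ < α then t.val ξ else false
  len_lt := (min_le_right _ _).trans_lt t.len_lt
  val_eq_false ξ hξ := by
    split_ifs with h
    · exact t.val_eq_false ξ ((min_le_iff.1 hξ).resolve_left (not_le.2 h))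
    · rfl

theorem res_len (t : Node κ) (α : Ordinal.{u}) : (t.res α).len = min α t.len := rfl

theorem res_len_of_le {t : Node κ} {α : Ordinal.{u}} (h : α ≤ t.len) : (t.res α).len = α :=
  min_eq_left h

theorem res_val {t : Node κ} {α ξ : Ordinal.{u}} (h : ξ < α) : (t.res α).val ξ = t.val ξ :=
  if_pos h

theorem res_le (t : Node κ) (α : Ordinal.{u}) : t.res α ≤ t :=
  ⟨min_le_right _ _, fun _ hξ => res_val (hξ.trans_le (min_le_left _ _))⟩

theorem le_of_le_of_len_le {s t u : Node κ} (hs : s ≤ u) (ht : t ≤ u) (h : s.len ≤ t.len) :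
    s ≤ t :=
  ⟨h, fun ξ hξ => (hs.2 ξ hξ).trans (ht.2 ξ (hξ.trans_le h)).symm⟩

theorem eq_of_le_of_len_eq {s t u : Node κ} (hs : s ≤ u) (ht : t ≤ u) (h : s.len = t.len) :
    s = t :=
  le_antisymm (le_of_le_of_len_le hs ht h.le) (le_of_le_of_len_le ht hs h.ge)

theorem eq_of_le_of_len_le {s t : Node κ} (hs : s ≤ t) (h : t.len ≤ s.len) : s = t :=
  eq_of_le_of_len_eq hs le_rfl (le_antisymm hs.1 h)

theorem ext_of_lt {s t : Node κ} (hl : s.len = t.len) (h : ∀ ξ < s.len, s.val ξ = t.val ξ) :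
    s = t :=
  le_antisymm (le_def.2 ⟨hl.le, h⟩)
    (le_def.2 ⟨hl.ge, fun ξ hξ => (h ξ (hl ▸ hξ)).symm⟩)

theorem res_eq_of_le {s t : Node κ} (h : s ≤ t) : t.res s.len = s :=
  eq_of_le_of_len_eq (res_le _ _) h (min_eq_left h.1)

theorem res_of_len_le {t : Node κ} {α : Ordinal.{u}} (h : t.len ≤ α) : t.res α = t :=
  eq_of_le_of_len_eq (res_le _ _) le_rfl (min_eq_right h)

theorem le_res {s t : Node κ} {α : Ordinal.{u}} (h : s ≤ t) (hα : s.len ≤ α) : s ≤ t.res α :=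
  le_of_le_of_len_le h (res_le _ _) (le_min hα h.1)

theorem res_mono (t : Node κ) {α β : Ordinal.{u}} (h : α ≤ β) : t.res α ≤ t.res β :=
  le_res (res_le _ _) ((min_le_left _ _).trans h)

theorem res_eq_res_of_le {s t : Node κ} (h : s ≤ t) {α : Ordinal.{u}} (hα : α ≤ s.len) :
    s.res α = t.res α :=
  eq_of_le_of_len_eq ((res_le _ _).trans h) (res_le _ _)
    ((min_eq_left hα).trans (min_eq_left (hα.trans h.1)).symm)

theorem len_lt_of_lt {s t : Node κ} (h : s < t) : s.len < t.len :=
  lt_of_not_ge fun h' => h.ne (eq_of_le_of_len_le h.le h')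

theorem lt_of_le_of_len_lt {s t : Node κ} (h : s ≤ t) (h' : s.len < t.len) : s < t :=
  lt_of_le_of_ne h fun e => h'.ne (e ▸ rfl)

theorem res_lt {t : Node κ} {α : Ordinal.{u}} (h : α < t.len) : t.res α < t :=
  lt_of_le_of_len_lt (res_le _ _) (by rwa [res_len_of_le h.le])

/-- A node followed by one more bit. -/
noncomputable def snoc [Fact κ.IsInaccessible] (t : Node κ) (b : Bool) : Node κ where
  len := t.len + 1
  val ξ := by classical exact if ξ = t.len then b else t.val ξ
  len_lt := add_one_lt_ord t.len_lt
  val_eq_false ξ hξ := by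
    have h : t.len < ξ := (lt_add_one t.len).trans_le hξ
    rw [if_neg h.ne']
    exact t.val_eq_false ξ h.le

section
variable [Fact κ.IsInaccessible]

theorem snoc_len (t : Node κ) (b : Bool) : (t.snoc b).len = t.len + 1 := rfl

theorem snoc_val_self (t : Node κ) (b : Bool) : (t.snoc b).val t.len = b := if_pos rfl

theorem snoc_val {t : Node κ} {b : Bool} {ξ : Ordinal.{u}} (h : ξ < t.len) :
    (t.snoc b).val ξ = t.val ξ := if_neg h.ne

theorem le_snoc (t : Node κ) (b : Bool) : t ≤ t.snoc b :=
  ⟨(lt_add_one t.len).le, fun _ hξ => (snoc_val hξ).symm⟩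

theorem isAppend_iff {s t : Node κ} {b : Bool} : IsAppend t b s ↔ s = t.snoc b := by
  constructor
  · rintro ⟨h1, h2, h3⟩
    refine le_antisymm (le_def.2 ⟨h2.le, fun ξ hξ => ?_⟩) (le_def.2 ⟨h2.ge, fun ξ hξ => ?_⟩)
    · rw [h2, Order.lt_add_one_iff] at hξ
      rcases hξ.lt_or_eq with h | rfl
      · rw [snoc_val h, h1.2 ξ h]
      · rw [h3, snoc_val_self]
    · rw [snoc_len, Order.lt_add_one_iff] at hξ
      rcases hξ.lt_or_eq with h | rfl
      · rw [snoc_val h, h1.2 ξ h]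
      · rw [h3, snoc_val_self]
  · rintro rfl
    exact ⟨le_snoc t b, rfl, snoc_val_self t b⟩

theorem snoc_le {s t : Node κ} (h : t ≤ s) (hl : t.len < s.len) : t.snoc (s.val t.len) ≤ s := by
  refine ⟨Order.add_one_le_of_lt hl, fun ξ hξ => ?_⟩
  rw [snoc_len, Order.lt_add_one_iff] at hξ
  rcases hξ.lt_or_eq with h' | rfl
  · rw [snoc_val h', h.2 ξ h']
  · rw [snoc_val_self]

theorem snoc_res_le {t : Node κ} {α : Ordinal.{u}} (h : α < t.len) :
    (t.res α).snoc (t.val α) ≤ t := by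
  have h1 := snoc_le (res_le t α) (by rwa [res_len_of_le h.le])
  rwa [res_len_of_le h.le] at h1

theorem lt_snoc (t : Node κ) (b : Bool) : t < t.snoc b :=
  lt_of_le_of_len_lt (le_snoc t b) (lt_add_one t.len)

end

/-- Two incompatible nodes branch at some position. -/
theorem comparable_or_branch (s t : Node κ) :
    (s ≤ t ∨ t ≤ s) ∨ ∃ ξ, ξ < s.len ∧ ξ < t.len ∧ s.res ξ = t.res ξ ∧ s.val ξ ≠ t.val ξ := by
  by_cases h : ∃ ξ, ξ < s.len ∧ ξ < t.len ∧ s.val ξ ≠ t.val ξ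
  · right
    obtain ⟨ξ, ⟨h1, h2, h3⟩, hmin⟩ := WellFounded.has_min (Ordinal.lt_wf)
      {ξ | ξ < s.len ∧ ξ < t.len ∧ s.val ξ ≠ t.val ξ} h
    refine ⟨ξ, h1, h2, ?_, h3⟩
    have key : ∀ η < ξ, s.val η = t.val η := fun η hη => by
      by_contra hne
      exact hmin η ⟨hη.trans h1, hη.trans h2, hne⟩ hη
    refine Node.ext ((res_len_of_le h1.le).trans (res_len_of_le h2.le).symm) (funext fun η => ?_)
    rcases lt_or_ge η ξ with h | h
    · rw [res_val h, res_val h, key η h]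
    · rw [val_eq_false _ _ ((min_le_left _ _).trans h),
        val_eq_false _ _ ((min_le_left _ _).trans h)]
  · left
    push Not at h
    rcases le_total s.len t.len with hl | hl
    · exact Or.inl ⟨hl, fun ξ hξ => h ξ hξ (hξ.trans_le hl)⟩
    · exact Or.inr ⟨hl, fun ξ hξ => (h ξ (hξ.trans_le hl) hξ).symm⟩

theorem not_comparable_of_branch {s t : Node κ} {ξ : Ordinal.{u}} (h1 : ξ < s.len)
    (h2 : ξ < t.len) (h3 : s.val ξ ≠ t.val ξ) : ¬ (s ≤ t ∨ t ≤ s) := by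
  rintro (h | h)
  · exact h3 (h.2 ξ h1)
  · exact h3 (h.2 ξ h2).symm

/-- A chain of nodes of bounded length has a union. -/
theorem exists_union (c : Set (Node κ)) (hc : ∀ s ∈ c, ∀ t ∈ c, s ≤ t ∨ t ≤ s) {α : Ordinal.{u}}
    (hα : α < κ.ord) (hl : ∀ s ∈ c, s.len ≤ α) :
    ∃ w : Node κ, (∀ s ∈ c, s ≤ w) ∧ ∀ ξ < w.len, ∃ s ∈ c, ξ < s.len := by
  classical
  have hb : BddAbove (len '' c) := ⟨α, by rintro _ ⟨s, hs, rfl⟩; exact hl s hs⟩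
  have hlen : sSup (len '' c) ≤ α := csSup_le' (by rintro _ ⟨s, hs, rfl⟩; exact hl s hs)
  refine ⟨⟨sSup (len '' c), fun ξ => decide (∃ s ∈ c, ξ < s.len ∧ s.val ξ = true),
    hlen.trans_lt hα, fun ξ hξ => ?_⟩, fun s hs => ⟨le_csSup hb ⟨s, hs, rfl⟩, fun ξ hξ => ?_⟩,
    fun ξ hξ => ?_⟩
  · rw [decide_eq_false_iff_not]
    rintro ⟨s, hs, h1, _⟩
    exact absurd (h1.trans_le (le_csSup hb ⟨s, hs, rfl⟩)) (not_lt.2 hξ)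
  · have : (∃ r ∈ c, ξ < r.len ∧ r.val ξ = true) ↔ s.val ξ = true := by
      constructor
      · rintro ⟨r, hr, h1, h2⟩
        rcases hc r hr s hs with h | h
        · rw [← h.2 ξ h1, h2]
        · rw [h.2 ξ hξ, h2]
      · intro h
        exact ⟨s, hs, hξ, h⟩
    cases hv : s.val ξ
    · symm
      simpa [hv] using this
    · symm
      simpa [hv] using this
  · have hξ' : ξ < sSup (len '' c) := hξ
    by_contra hcon
    push Not at hcon
    exact absurd hξ' (not_lt.2 (csSup_le' (by rintro _ ⟨s, hs, rfl⟩; exact hcon s hs)))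

end Node

/-! ### Pruned trees and splitting levels -/

/-- The set of lengths of the splitting nodes of `T`. -/
def lev (T : Set (Node κ)) : Set Ordinal.{u} := {α | ∃ t ∈ Split T, t.len = α}

/-- The `β`-th splitting level of `T`. -/
noncomputable def levEnum (T : Set (Node κ)) : Ordinal.{u} → Ordinal.{u} := enumBelow κ.ord (lev T)

theorem levEnum_strictMono (T : Set (Node κ)) : StrictMono (levEnum T) := enumBelow_strictMono _ _

/-- A nonempty tree that is closed under increasing unions and has no maximal nodes. -/
structure IsPruned (T : Set (Node κ)) [Fact κ.IsInaccessible] : Prop where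
  nonempty : T.Nonempty
  isLowerSet : IsLowerSet T
  limit_mem : ∀ t : Node κ, IsSuccLimit t.len → (∀ s < t, s ∈ T) → t ∈ T
  exists_snoc : ∀ t ∈ T, ∃ b, t.snoc b ∈ T

variable [Fact κ.IsInaccessible]

/-- A node `t` belongs to a pruned tree if its proper initial segments are properly extended by
nodes of the tree that are initial segments of `t`. The node `s` is needed if `t` is the root. -/
theorem IsPruned.mem_of_forall_lt {T : Set (Node κ)} (hT : IsPruned T) {t s : Node κ} (hs : s ∈ T)
    (h : ∀ r < t, ∃ u ∈ T, r < u ∧ u ≤ t) (h0 : s ≤ t) : t ∈ T := by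
  by_cases hl : IsSuccLimit t.len
  · refine hT.limit_mem t hl fun r hr => ?_
    obtain ⟨u, hu, hru, _⟩ := h r hr
    exact hT.isLowerSet hru.le hu
  · by_cases hz : t.len = 0
    · rwa [← Node.eq_of_le_of_len_le h0 (by simp [hz])]
    · obtain ⟨α, hα⟩ : ∃ α, α + 1 = t.len := by
        rcases Ordinal.zero_or_succ_or_isSuccLimit t.len with h1 | ⟨α, h1⟩ | h1
        · exact absurd h1 hz
        · exact ⟨α, by rw [← h1, Order.succ_eq_add_one]⟩
        · exact absurd h1 hl
      have hα' : α < t.len := hα ▸ lt_add_one α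
      obtain ⟨u, hu, hru, hut⟩ := h (t.res α) (Node.res_lt hα')
      have := Node.len_lt_of_lt hru
      rw [Node.res_len_of_le hα'.le] at this
      rwa [← Node.eq_of_le_of_len_le hut (hα ▸ Order.add_one_le_of_lt this)]

/-- A node of a pruned tree extends to every larger length: a maximal extension of length at most
`α` has length `α`. -/
theorem IsPruned.exists_extend {T : Set (Node κ)} (hT : IsPruned T) {t : Node κ} (ht : t ∈ T)
    {α : Ordinal.{u}} (hα : α < κ.ord) (htα : t.len ≤ α) : ∃ w ∈ T, t ≤ w ∧ w.len = α := by
  obtain ⟨m, htm, hm⟩ := zorn_le_nonempty₀ {w | w ∈ T ∧ t ≤ w ∧ w.len ≤ α} (fun c hc hch y hy => by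
    have hcomp : ∀ s ∈ c, ∀ r ∈ c, s ≤ r ∨ r ≤ s := fun s hs r hr => hch.total hs hr
    obtain ⟨w, hw, hw'⟩ := Node.exists_union c hcomp hα (fun s hs => (hc hs).2.2)
    have hwα : w.len ≤ α := le_of_forall_lt fun ξ hξ => by
      obtain ⟨s, hs, h⟩ := hw' ξ hξ
      exact h.trans_le (hc hs).2.2
    refine ⟨w, ⟨?_, (hc hy).2.1.trans (hw y hy), hwα⟩, hw⟩
    refine hT.mem_of_forall_lt (hc hy).1 (fun r hr => ?_) (hw y hy)
    obtain ⟨s, hs, h⟩ := hw' r.len (Node.len_lt_of_lt hr)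
    exact ⟨s, (hc hs).1, Node.lt_of_le_of_len_lt
      (Node.le_of_le_of_len_le hr.le (hw s hs) h.le) h, hw s hs⟩) t ⟨ht, le_rfl, htα⟩
  refine ⟨m, hm.prop.1, htm, ?_⟩
  by_contra hne
  have hlt : m.len < α := lt_of_le_of_ne hm.prop.2.2 hne
  obtain ⟨b, hb⟩ := hT.exists_snoc m hm.prop.1
  have := hm.le_of_ge (y := m.snoc b)
    ⟨hb, htm.trans (Node.le_snoc _ _), Order.add_one_le_of_lt hlt⟩ (Node.le_snoc _ _)
  exact absurd this (Node.lt_snoc m b).not_ge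

theorem IsPruned.root_mem {T : Set (Node κ)} (hT : IsPruned T) (t : Node κ) : t.res 0 ∈ T := by
  obtain ⟨s, hs⟩ := hT.nonempty
  have : t.res 0 = s.res 0 := Node.ext (by simp [Node.res_len]) (funext fun ξ => by
    rw [Node.val_eq_false _ _ (by simp [Node.res_len]),
      Node.val_eq_false _ _ (by simp [Node.res_len])])
  rw [this]
  exact hT.isLowerSet (Node.res_le _ _) hs

theorem IsPruned.exists_len {T : Set (Node κ)} (hT : IsPruned T) {α : Ordinal.{u}}
    (hα : α < κ.ord) : ∃ w ∈ T, w.len = α := by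
  obtain ⟨t, ht⟩ := hT.nonempty
  obtain ⟨w, hw, -, h⟩ := hT.exists_extend (hT.root_mem t) hα (by simp [Node.res_len])
  exact ⟨w, hw, h⟩

theorem mem_split {T : Set (Node κ)} {t : Node κ} :
    t ∈ Split T ↔ t ∈ T ∧ ∀ b, t.snoc b ∈ T := by
  simp only [Split, Node.isAppend_iff, exists_eq_right, mem_ofPred_eq]

theorem split_mono {T T' : Set (Node κ)} (h : T ⊆ T') : Split T ⊆ Split T' := by
  intro t ht
  rw [mem_split] at ht ⊢
  exact ⟨h ht.1, fun b => h (ht.2 b)⟩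

theorem IsClubTree.isPruned {T : Set (Node κ)} (hT : IsClubTree T) : IsPruned T where
  nonempty := hT.nonempty
  isLowerSet := hT.isLowerSet
  limit_mem := hT.limit_mem
  exists_snoc t ht := by
    obtain ⟨s, hs, h⟩ := hT.exists_split t ht
    rcases h.lt_or_eq with h | rfl
    · exact ⟨_, hT.isLowerSet (Node.snoc_le h.le (Node.len_lt_of_lt h)) hs.1⟩
    · exact ⟨true, (mem_split.1 hs).2 true⟩

/-- A pruned tree has nodes of every length below `κ`, so a set that describes its splitting nodes
by their lengths is the set of its splitting levels. -/
theorem IsPruned.lev_eq {T : Set (Node κ)} (hT : IsPruned T) {C : Set Ordinal.{u}}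
    (hC : ∀ α ∈ C, α < κ.ord) (h : ∀ t ∈ T, t ∈ Split T ↔ t.len ∈ C) : lev T = C := by
  ext α
  constructor
  · rintro ⟨t, ht, rfl⟩
    exact (h t ht.1).1 ht
  · intro hα
    obtain ⟨w, hw, rfl⟩ := hT.exists_len (hC α hα)
    exact ⟨w, (h w hw).2 hα, rfl⟩

/-- Pruned trees whose splitting nodes are the nodes with length in a closed unbounded set are
elements of `𝕊^club`. -/
theorem IsPruned.isClubTree {T : Set (Node κ)} (hT : IsPruned T) {C : Set Ordinal.{u}}
    (hC : IsClubIn κ.ord C) (h : ∀ t ∈ T, t ∈ Split T ↔ t.len ∈ C) : IsClubTree T where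
  nonempty := hT.nonempty
  isLowerSet := hT.isLowerSet
  limit_mem := hT.limit_mem
  exists_split t ht := by
    obtain ⟨α, hα, hα'⟩ := hC.exists_ge t.len_lt
    obtain ⟨w, hw, h1, rfl⟩ := hT.exists_extend ht (hC.lt α hα) hα'
    exact ⟨w, (h w hw).2 hα, h1⟩
  exists_club := ⟨_, hC.isClub, h⟩

/-- The set of splitting levels is the closed unbounded set that witnesses membership in
`𝕊^club`. -/
theorem IsClubTree.exists_isClubIn {T : Set (Node κ)} (hT : IsClubTree T) :
    IsClubIn κ.ord (lev T) ∧ ∀ t ∈ T, t ∈ Split T ↔ t.len ∈ lev T := by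
  obtain ⟨C, hC, h⟩ := hT.exists_club
  have h' : ∀ t ∈ T, t ∈ Split T ↔ t.len ∈ Subtype.val '' C := fun t ht => by
    rw [h t ht]
    constructor
    · intro hm
      exact ⟨_, hm, rfl⟩
    · rintro ⟨x, hx, hxt⟩
      have : x = ⟨t.len, t.len_lt⟩ := Subtype.ext hxt
      rwa [← this]
  have hc := isClubIn_of_isClub isSuccLimit_ord hC
  rw [hT.isPruned.lev_eq hc.lt h']
  exact ⟨hc, h'⟩

theorem IsClubTree.isClubIn_lev {T : Set (Node κ)} (hT : IsClubTree T) :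
    IsClubIn κ.ord (lev T) := hT.exists_isClubIn.1

theorem IsClubTree.mem_split_iff {T : Set (Node κ)} (hT : IsClubTree T) {t : Node κ}
    (ht : t ∈ T) : t ∈ Split T ↔ t.len ∈ lev T := hT.exists_isClubIn.2 t ht

theorem IsClubTree.snoc_mem {T : Set (Node κ)} (hT : IsClubTree T) {t : Node κ}
    (ht : t ∈ T) (hl : t.len ∈ lev T) (b : Bool) : t.snoc b ∈ T :=
  (mem_split.1 ((hT.mem_split_iff ht).2 hl)).2 b

theorem IsClubTree.splitLevelsBelow_eq {T : Set (Node κ)} (hT : IsClubTree T) {t : Node κ}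
    (ht : t ∈ T) : splitLevelsBelow T t = lev T ∩ Iio t.len := by
  ext α
  constructor
  · rintro ⟨s, hs, h, rfl⟩
    exact ⟨⟨s, hs, rfl⟩, Node.len_lt_of_lt h⟩
  · rintro ⟨hα, h⟩
    have hl : (t.res α).len = α := Node.res_len_of_le (le_of_lt h)
    exact ⟨t.res α, (hT.mem_split_iff (hT.isLowerSet (Node.res_le _ _) ht)).2 (hl.symm ▸ hα),
      Node.res_lt h, hl⟩

theorem lev_mono {T T' : Set (Node κ)} (h : T ⊆ T') : lev T ⊆ lev T' := by
  rintro _ ⟨t, ht, rfl⟩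
  exact ⟨t, split_mono h ht, rfl⟩

theorem IsClubTree.levEnum_mem {T : Set (Node κ)} (hT : IsClubTree T) {β : Ordinal.{u}}
    (hβ : β < κ.ord) : levEnum T β ∈ lev T := enumBelow_mem isRegular_of_fact hT.isClubIn_lev hβ

theorem IsClubTree.levEnum_lt {T : Set (Node κ)} (hT : IsClubTree T) {β : Ordinal.{u}}
    (hβ : β < κ.ord) : levEnum T β < κ.ord := enumBelow_lt isRegular_of_fact hT.isClubIn_lev hβ

theorem IsClubTree.exists_levEnum {T : Set (Node κ)} (hT : IsClubTree T) {α : Ordinal.{u}}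
    (hα : α ∈ lev T) : ∃ β < κ.ord, levEnum T β = α := hT.isClubIn_lev.exists_enumBelow hα

/-- The elements of `Split_β(T)` are the nodes on the `β`-th splitting level. -/
theorem IsClubTree.mem_splitRank {T : Set (Node κ)} (hT : IsClubTree T) {β : Ordinal.{u}}
    (hβ : β < κ.ord) {t : Node κ} : t ∈ SplitRank β T ↔ t ∈ T ∧ t.len = levEnum T β := by
  constructor
  · rintro ⟨h1, h2⟩
    rw [hT.splitLevelsBelow_eq h1.1, nonempty_orderIso_iff t.len_lt.le] at h2
    refine ⟨h1.1, ?_⟩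
    obtain ⟨γ, -, hγ⟩ := hT.exists_levEnum ((hT.mem_split_iff h1.1).1 h1)
    have : γ = β := by
      rw [← h2, ← hγ]
      exact (countBelow_enumBelow _ _ _).symm
    rw [← hγ, this]
  · rintro ⟨h1, h2⟩
    refine ⟨(hT.mem_split_iff h1).2 (h2 ▸ hT.levEnum_mem hβ), ?_⟩
    rw [hT.splitLevelsBelow_eq h1, nonempty_orderIso_iff t.len_lt.le, h2]
    exact countBelow_enumBelow _ _ _

end

section
variable {κ : Cardinal.{u}}

/-! ### Cones -/

theorem cone_subset (T : Set (Node κ)) (t : Node κ) : cone T t ⊆ T := fun _ h => h.1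

theorem cone_mono {T T' : Set (Node κ)} (h : T ⊆ T') (t : Node κ) : cone T t ⊆ cone T' t :=
  fun _ hs => ⟨h hs.1, hs.2⟩

theorem mem_cone_self {T : Set (Node κ)} {t : Node κ} (ht : t ∈ T) : t ∈ cone T t :=
  ⟨ht, Or.inl le_rfl⟩

theorem cone_anti (T : Set (Node κ)) {s t : Node κ} (h : s ≤ t) : cone T t ⊆ cone T s := by
  rintro r ⟨hr, h1 | h1⟩
  · exact ⟨hr, (le_total r.len s.len).imp (Node.le_of_le_of_len_le h1 h)
      (Node.le_of_le_of_len_le h h1)⟩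
  · exact ⟨hr, Or.inr (h.trans h1)⟩

theorem cone_cone_of_le (T : Set (Node κ)) {s t : Node κ} (h : s ≤ t) :
    cone (cone T s) t = cone T t :=
  subset_antisymm (cone_mono (cone_subset _ _) _) fun _ hr => ⟨cone_anti T h hr, hr.2⟩

theorem cone_cone_of_ge (T : Set (Node κ)) {s t : Node κ} (h : t ≤ s) :
    cone (cone T s) t = cone T s :=
  subset_antisymm (cone_subset _ _) fun _ hr => ⟨hr, (cone_anti T h hr).2⟩

theorem cone_eq_self_of_forall {T : Set (Node κ)} {t : Node κ} (h : ∀ s ∈ T, s ≤ t ∨ t ≤ s) :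
    cone T t = T :=
  subset_antisymm (cone_subset _ _) fun s hs => ⟨hs, h s hs⟩

section
variable [Fact κ.IsInaccessible]

theorem IsPruned.cone {T : Set (Node κ)} (hT : IsPruned T) {t : Node κ} (ht : t ∈ T) :
    IsPruned (cone T t) where
  nonempty := ⟨t, mem_cone_self ht⟩
  isLowerSet s r hrs hs := by
    refine ⟨hT.isLowerSet hrs hs.1, ?_⟩
    rcases hs.2 with h | h
    · exact Or.inl (hrs.trans h)
    · exact (le_total r.len t.len).imp (Node.le_of_le_of_len_le hrs h)
        (Node.le_of_le_of_len_le h hrs)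
  limit_mem s hs h := by
    refine ⟨hT.limit_mem s hs fun r hr => (h r hr).1, ?_⟩
    rcases Node.comparable_or_branch s t with hc | ⟨ξ, h1, h2, -, h4⟩
    · exact hc
    · have h5 : ξ + 1 < s.len := hs.succ_lt h1
      refine absurd (h (s.res (ξ + 1)) (Node.res_lt h5)).2 (Node.not_comparable_of_branch
        (ξ := ξ) (by rw [Node.res_len_of_le h5.le]; exact lt_add_one ξ) h2 ?_)
      rwa [Node.res_val (lt_add_one ξ)]
  exists_snoc s hs := by
    by_cases hts : t ≤ s
    · obtain ⟨b, hb⟩ := hT.exists_snoc s hs.1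
      exact ⟨b, hb, Or.inr (hts.trans (Node.le_snoc _ _))⟩
    · have hst : s < t := lt_of_le_not_ge (hs.2.resolve_right hts) hts
      have h1 := Node.snoc_le hst.le (Node.len_lt_of_lt hst)
      exact ⟨_, hT.isLowerSet h1 ht, Or.inl h1⟩

theorem IsClubTree.split_cone {T : Set (Node κ)} (hT : IsClubTree T) {t : Node κ}
    {s : Node κ} (hs : s ∈ cone T t) : s ∈ Split (cone T t) ↔ s.len ∈ lev T ∩ Ici t.len := by
  constructor
  · intro h
    refine ⟨⟨s, split_mono (cone_subset _ _) h, rfl⟩, ?_⟩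
    by_contra hlt
    have hlt : s.len < t.len := not_le.1 hlt
    have hst : s ≤ t := hs.2.elim id fun h' => absurd h'.1 (not_le.2 hlt)
    have h1 := ((mem_split.1 h).2 (! t.val s.len)).2
    refine Node.not_comparable_of_branch (ξ := s.len) (lt_add_one s.len) hlt ?_ h1
    rw [Node.snoc_val_self]
    simp
  · rintro ⟨h1, h2⟩
    have hts : t ≤ s := hs.2.elim
      (fun h' => (Node.eq_of_le_of_len_le h' h2).ge) id
    refine mem_split.2 ⟨hs, fun b => ⟨hT.snoc_mem hs.1 h1 b, Or.inr (hts.trans (Node.le_snoc _ _))⟩⟩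

theorem IsClubIn.inter_Ici {o : Ordinal.{u}} {C : Set Ordinal.{u}} (hC : IsClubIn o C)
    {δ : Ordinal.{u}} (hδ : δ < o) : IsClubIn o (C ∩ Ici δ) where
  lt α hα := hC.lt α hα.1
  unbounded α hα := by
    obtain ⟨β, hβ, h⟩ := hC.unbounded (max α δ) (max_lt hα hδ)
    exact ⟨β, ⟨hβ, (le_max_right _ _).trans h.le⟩, (le_max_left _ _).trans_lt h⟩
  closed α hα h0 h := by
    refine ⟨hC.closed α hα h0 fun β hβ => ?_, ?_⟩
    · obtain ⟨γ, hγ, h'⟩ := h β hβ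
      exact ⟨γ, hγ.1, h'⟩
    · obtain ⟨γ, hγ, h'⟩ := h 0 (pos_iff_ne_zero.2 h0)
      exact hγ.2.trans h'.2.le

theorem IsClubTree.cone {T : Set (Node κ)} (hT : IsClubTree T) {t : Node κ} (ht : t ∈ T) :
    IsClubTree (cone T t) :=
  (hT.isPruned.cone ht).isClubTree (hT.isClubIn_lev.inter_Ici t.len_lt)
    fun _ hs => hT.split_cone hs

theorem IsClubTree.lev_cone {T : Set (Node κ)} (hT : IsClubTree T) {t : Node κ} (ht : t ∈ T) :
    lev (TreeForcing.cone T t) = lev T ∩ Ici t.len :=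
  (hT.isPruned.cone ht).lev_eq (fun α hα => hT.isClubIn_lev.lt α hα.1)
    fun _ hs => hT.split_cone hs

theorem isPruned_univ : IsPruned (univ : Set (Node κ)) where
  nonempty := ⟨⟨0, fun _ => false, zero_lt_ord, fun _ _ => rfl⟩, mem_univ _⟩
  isLowerSet := isLowerSet_univ
  limit_mem _ _ _ := mem_univ _
  exists_snoc _ _ := ⟨true, mem_univ _⟩

theorem isClubTree_univ : IsClubTree (univ : Set (Node κ)) := by
  refine isPruned_univ.isClubTree (C := Iio κ.ord) ⟨fun _ h => h, fun α hα => ?_, fun _ h _ _ => h⟩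
    fun t _ => ⟨fun _ => t.len_lt, fun _ => mem_split.2 ⟨mem_univ _, fun _ => mem_univ _⟩⟩
  exact ⟨α + 1, add_one_lt_ord hα, lt_add_one α⟩

/-! ### Intersections of descending sequences -/

/-- The intersection of a descending sequence of trees in `𝕊^club` is pruned, and its splitting
nodes are those on the common splitting levels of the terms. -/
theorem isPruned_inter {δ : Ordinal.{u}} (hδ : 0 < δ) {T : Ordinal.{u} → Set (Node κ)}
    (hT : ∀ i < δ, IsClubTree (T i)) (hdesc : ∀ i < δ, ∀ j < i, T i ⊆ T j) :
    IsPruned {t | ∀ i < δ, t ∈ T i} ∧ ∀ t ∈ {t | ∀ i < δ, t ∈ T i},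
      (t ∈ Split {t | ∀ i < δ, t ∈ T i} ↔ t.len ∈ {β | ∀ i < δ, β ∈ lev (T i)}) := by
  have hle : ∀ i < δ, ∀ j ≤ i, T i ⊆ T j := fun i hi j hj =>
    hj.lt_or_eq.elim (hdesc i hi j) (fun e => e ▸ subset_rfl)
  refine ⟨⟨?_, ?_, ?_, ?_⟩, ?_⟩
  · obtain ⟨t, ht⟩ := (hT 0 hδ).nonempty
    exact ⟨t.res 0, fun i hi => (hT i hi).isPruned.root_mem t⟩
  · exact fun s r hrs hs i hi => (hT i hi).isLowerSet hrs (hs i hi)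
  · exact fun t ht h i hi => (hT i hi).limit_mem t ht fun s hs => h s hs i hi
  · intro t ht
    by_cases hs : ∀ i < δ, t ∈ Split (T i)
    · exact ⟨true, fun i hi => (mem_split.1 (hs i hi)).2 true⟩
    · -- from the first term on that does not split at `t`, there is only one direction left
      push Not at hs
      obtain ⟨i₀, hi₀, hns⟩ := hs
      obtain ⟨b, hb⟩ := (hT i₀ hi₀).isPruned.exists_snoc t (ht i₀ hi₀)
      refine ⟨b, fun i hi => ?_⟩
      rcases le_total i i₀ with h | h
      · exact hle i₀ hi₀ i h hb
      · obtain ⟨b', hb'⟩ := (hT i hi).isPruned.exists_snoc t (ht i hi)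
        by_cases hbb : b' = b
        · rwa [← hbb]
        · exfalso
          apply hns
          refine mem_split.2 ⟨ht i₀ hi₀, fun b'' => ?_⟩
          have := hle i hi i₀ h hb'
          revert hb this hbb
          cases b <;> cases b' <;> cases b'' <;> simp +contextual
  · intro t ht
    constructor
    · intro h i hi
      have hsub : {t | ∀ i < δ, t ∈ T i} ⊆ T i := fun s hs => hs i hi
      exact ⟨t, split_mono hsub h, rfl⟩
    · intro h
      exact mem_split.2 ⟨ht, fun b i hi => (hT i hi).snoc_mem (ht i hi) (h i hi) b⟩

theorem isClubIn_inter {δ : Ordinal.{u}} (hδ : 0 < δ) {o : Ordinal.{u}}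
    {C : Ordinal.{u} → Set Ordinal.{u}} (hC : ∀ i < δ, IsClubIn o (C i))
    (hunb : ∀ α < o, ∃ β, α < β ∧ ∀ i < δ, β ∈ C i) : IsClubIn o {β | ∀ i < δ, β ∈ C i} where
  lt α hα := (hC 0 hδ).lt α (hα 0 hδ)
  unbounded α hα := by
    obtain ⟨β, h1, h2⟩ := hunb α hα
    exact ⟨β, h2, h1⟩
  closed α hα h0 h i hi := (hC i hi).closed α hα h0 fun β hβ => by
    obtain ⟨γ, h1, h2⟩ := h β hβ
    exact ⟨γ, h1 i hi, h2⟩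

theorem isClubTree_inter {δ : Ordinal.{u}} (hδ : 0 < δ) {T : Ordinal.{u} → Set (Node κ)}
    (hT : ∀ i < δ, IsClubTree (T i)) (hdesc : ∀ i < δ, ∀ j < i, T i ⊆ T j)
    (hunb : ∀ α < κ.ord, ∃ β, α < β ∧ ∀ i < δ, β ∈ lev (T i)) :
    IsClubTree {t | ∀ i < δ, t ∈ T i} := by
  obtain ⟨h1, h2⟩ := isPruned_inter hδ hT hdesc
  exact h1.isClubTree (isClubIn_inter hδ (fun i hi => (hT i hi).isClubIn_lev) hunb) h2

theorem lev_inter {δ : Ordinal.{u}} (hδ : 0 < δ) {T : Ordinal.{u} → Set (Node κ)}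
    (hT : ∀ i < δ, IsClubTree (T i)) (hdesc : ∀ i < δ, ∀ j < i, T i ⊆ T j) :
    lev {t | ∀ i < δ, t ∈ T i} = {β | ∀ i < δ, β ∈ lev (T i)} := by
  obtain ⟨h1, h2⟩ := isPruned_inter hδ hT hdesc
  exact h1.lev_eq (fun α hα => (hT 0 hδ).isClubIn_lev.lt α (hα 0 hδ)) h2

theorem cof_Iio_ord : Order.cof (Iio κ.ord) = Cardinal.lift.{u + 1} κ := by
  rw [Ordinal.cof_Iio, ← Ordinal.lift_cof, isRegular_of_fact.cof_ord]

theorem cof_Iio_ord_ne : Order.cof (Iio κ.ord) ≠ Cardinal.aleph0 := by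
  rw [cof_Iio_ord]
  have h : Cardinal.aleph0 < κ := (Fact.out : κ.IsInaccessible).aleph0_lt
  exact (Cardinal.aleph0_lt_lift.2 h).ne'

/-- Fewer than `κ` closed unbounded subsets of `κ` have unbounded intersection. -/
theorem exists_mem_inter {X : Type (u + 1)} (hX : Cardinal.mk X < Cardinal.lift.{u + 1} κ)
    {C : X → Set Ordinal.{u}} (hC : ∀ i, IsClubIn κ.ord (C i)) {α : Ordinal.{u}}
    (hα : α < κ.ord) : ∃ β < κ.ord, α < β ∧ ∀ i, β ∈ C i := by
  have h := IsClub.iInter (cof_Iio_ord_ne (κ := κ)) (f := fun i : X => {x : Iio κ.ord | x.1 ∈ C i})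
    (by rw [cof_Iio_ord]; simpa using hX) (fun i => (hC i).isClub)
  obtain ⟨β, hβ, h1⟩ := h.isCofinal ⟨α + 1, add_one_lt_ord hα⟩
  exact ⟨β.1, β.2, (lt_add_one α).trans_le h1, fun i => mem_iInter.1 hβ i⟩

theorem isClubTree_inter_of_lt {δ : Ordinal.{u}} (hδ : 0 < δ) (hδ' : δ < κ.ord)
    {T : Ordinal.{u} → Set (Node κ)}
    (hT : ∀ i < δ, IsClubTree (T i)) (hdesc : ∀ i < δ, ∀ j < i, T i ⊆ T j) :
    IsClubTree {t | ∀ i < δ, t ∈ T i} := by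
  refine isClubTree_inter hδ hT hdesc fun α hα => ?_
  obtain ⟨β, -, h1, h2⟩ := exists_mem_inter (X := Iio δ) (mk_Iio_lt hδ')
    (fun i => (hT i.1 i.2).isClubIn_lev) hα
  exact ⟨β, h1, fun i hi => h2 ⟨i, hi⟩⟩

/-! ### Thinning out the splitting levels -/

/-- The subtree of `T` that keeps the splitting levels in `K` and follows the direction `x α` at
every other splitting level `α`. -/
def thin (T : Set (Node κ)) (K : Set Ordinal.{u}) (x : Ordinal.{u} → Bool) : Set (Node κ) :=
  {t ∈ T | ∀ α < t.len, α ∈ lev T → α ∉ K → t.val α = x α}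

theorem isPruned_thin {T : Set (Node κ)} (hT : IsClubTree T) {K : Set Ordinal.{u}}
    (hK' : K ⊆ lev T) (x : Ordinal.{u} → Bool) :
    IsPruned (thin T K x) ∧ ∀ t ∈ thin T K x, t ∈ Split (thin T K x) ↔ t.len ∈ K := by
  have step : ∀ t ∈ thin T K x, ∀ b, t.snoc b ∈ T → (t.len ∈ lev T → t.len ∉ K → b = x t.len) →
      t.snoc b ∈ thin T K x := by
    intro t ht b hb h
    refine ⟨hb, fun α hα h1 h2 => ?_⟩
    rcases (Order.lt_add_one_iff.1 hα).lt_or_eq with h3 | rfl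
    · rw [Node.snoc_val h3]
      exact ht.2 α h3 h1 h2
    · rw [Node.snoc_val_self]
      exact h h1 h2
  refine ⟨⟨?_, ?_, ?_, ?_⟩, ?_⟩
  · obtain ⟨t, ht⟩ := hT.nonempty
    refine ⟨t.res 0, hT.isPruned.root_mem t, fun α hα => ?_⟩
    simp [Node.res_len] at hα
  · intro s r hrs hs
    refine ⟨hT.isLowerSet hrs hs.1, fun α hα h1 h2 => ?_⟩
    rw [hrs.2 α hα]
    exact hs.2 α (hα.trans_le hrs.1) h1 h2
  · intro t ht h
    refine ⟨hT.limit_mem t ht fun s hs => (h s hs).1, fun α hα h1 h2 => ?_⟩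
    have h3 : α + 1 < t.len := ht.succ_lt hα
    have h4 := (h _ (Node.res_lt h3)).2 α
      (by rw [Node.res_len_of_le h3.le]; exact lt_add_one α) h1 h2
    rwa [Node.res_val (lt_add_one α)] at h4
  · intro t ht
    by_cases hl : t.len ∈ lev T
    · exact ⟨x t.len, step t ht _ (hT.snoc_mem ht.1 hl _) fun _ _ => rfl⟩
    · obtain ⟨b, hb⟩ := hT.isPruned.exists_snoc t ht.1
      exact ⟨b, step t ht b hb fun h => absurd h hl⟩
  · intro t ht
    constructor
    · intro h
      by_contra hn
      have hl : t.len ∈ lev T := ⟨t, split_mono (fun s hs => hs.1) h, rfl⟩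
      have h1 := ((mem_split.1 h).2 (! x t.len)).2 t.len (lt_add_one t.len) hl hn
      rw [Node.snoc_val_self] at h1
      simp at h1
    · intro h
      exact mem_split.2 ⟨ht, fun b => step t ht b (hT.snoc_mem ht.1 (hK' h) b)
        fun _ h' => absurd h h'⟩

theorem isClubTree_thin {T : Set (Node κ)} (hT : IsClubTree T) {K : Set Ordinal.{u}}
    (hK : IsClubIn κ.ord K) (hK' : K ⊆ lev T) (x : Ordinal.{u} → Bool) :
    IsClubTree (thin T K x) :=
  (isPruned_thin hT hK' x).1.isClubTree hK (isPruned_thin hT hK' x).2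

theorem lev_thin {T : Set (Node κ)} (hT : IsClubTree T) {K : Set Ordinal.{u}}
    (hK : IsClubIn κ.ord K) (hK' : K ⊆ lev T) (x : Ordinal.{u} → Bool) : lev (thin T K x) = K :=
  (isPruned_thin hT hK' x).1.lev_eq hK.lt (isPruned_thin hT hK' x).2

end

/-! ### Copies of a tree inside another one -/

/-- The node of `2^{<κ}` onto which the canonical isomorphism sends `t`. -/
noncomputable def collapse (T : Set (Node κ)) (t : Node κ) : Node κ where
  len := countBelow κ.ord (lev T) t.len
  val ξ := by
    classical
    exact if ξ < countBelow κ.ord (lev T) t.len then t.val (levEnum T ξ) else false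
  len_lt := (countBelow_le _ _ _).trans_lt t.len_lt
  val_eq_false _ hξ := if_neg (not_lt.2 hξ)

theorem collapse_val {T : Set (Node κ)} {t : Node κ} {ξ : Ordinal.{u}}
    (h : ξ < (collapse T t).len) : (collapse T t).val ξ = t.val (levEnum T ξ) := if_pos h

theorem lt_len_collapse {T : Set (Node κ)} {t : Node κ} {ξ : Ordinal.{u}} :
    ξ < (collapse T t).len ↔ levEnum T ξ < t.len := lt_countBelow

theorem collapse_mono (T : Set (Node κ)) {s t : Node κ} (h : s ≤ t) :
    collapse T s ≤ collapse T t :=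
  Node.le_def.2 ⟨countBelow_mono _ _ h.1, fun ξ hξ => by
    rw [collapse_val hξ, collapse_val (hξ.trans_le (countBelow_mono _ _ h.1)),
      h.2 _ (lt_len_collapse.1 hξ)]⟩

variable [Fact κ.IsInaccessible]

theorem IsClubTree.mem_collapsePreimage {T S : Set (Node κ)} (hT : IsClubTree T) {t : Node κ} :
    t ∈ collapsePreimage T S ↔ t ∈ T ∧ collapse T t ∈ S := by
  refine and_congr_right fun ht => ?_
  rw [hT.splitLevelsBelow_eq ht]
  constructor
  · rintro ⟨s, hs, e, he⟩
    have hl : (collapse T t).len = s.len := (nonempty_orderIso_iff t.len_lt.le).1 ⟨e⟩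
    have : collapse T t = s := Node.ext_of_lt hl fun ξ hξ => by
      have h1 := he (countIso t.len_lt.le ⟨ξ, hξ⟩)
      have h2 := Iio_orderIso_apply ((countIso t.len_lt.le).trans e) ⟨ξ, hξ⟩
      rw [collapse_val hξ]
      refine h1.trans ?_
      congr 1
    rwa [this]
  · intro h
    refine ⟨_, h, (countIso t.len_lt.le).symm, fun α => ?_⟩
    refine Eq.trans ?_ (collapse_val ((countIso t.len_lt.le).symm α).2).symm
    congr 1
    exact congrArg Subtype.val ((countIso t.len_lt.le).apply_symm_apply α).symm

theorem IsClubTree.collapse_snoc_of_mem {T : Set (Node κ)} (hT : IsClubTree T) {t : Node κ}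
    (h : t.len ∈ lev T) (b : Bool) : collapse T (t.snoc b) = (collapse T t).snoc b := by
  obtain ⟨β, -, hβ⟩ := hT.exists_levEnum h
  have hl : (collapse T t).len = β := by
    change countBelow _ _ t.len = β
    rw [← hβ]
    exact countBelow_enumBelow _ _ _
  have hl' : (collapse T (t.snoc b)).len = β + 1 := eq_of_forall_lt_iff fun γ => by
    rw [lt_len_collapse, Node.snoc_len, ← hβ, Order.lt_add_one_iff, Order.lt_add_one_iff,
      (levEnum_strictMono T).le_iff_le]
  refine Node.ext_of_lt (by rw [hl', Node.snoc_len, hl]) fun ξ hξ => ?_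
  rw [collapse_val hξ]
  rw [hl', Order.lt_add_one_iff] at hξ
  rcases hξ.lt_or_eq with h1 | rfl
  · have h2 : ξ < (collapse T t).len := by rwa [hl]
    rw [Node.snoc_val (lt_len_collapse.1 h2), Node.snoc_val h2, collapse_val h2]
  · have h2 := Node.snoc_val_self (collapse T t) b
    rw [hl] at h2
    rw [h2, hβ, Node.snoc_val_self]

theorem collapse_snoc_of_notMem {T : Set (Node κ)} {t : Node κ}
    (h : t.len ∉ lev T) (b : Bool) : collapse T (t.snoc b) = collapse T t :=
  (Node.eq_of_le_of_len_le (collapse_mono T (Node.le_snoc t b))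
    (countBelow_succ t.len_lt h).le).symm

theorem isPruned_collapsePreimage {T S : Set (Node κ)} (hT : IsClubTree T) (hS : IsClubTree S) :
    IsPruned (collapsePreimage T S) ∧ ∀ t ∈ collapsePreimage T S,
      t ∈ Split (collapsePreimage T S) ↔ t.len ∈ levEnum T '' lev S := by
  refine ⟨⟨?_, ?_, ?_, ?_⟩, ?_⟩
  · obtain ⟨t, ht⟩ := hT.nonempty
    refine ⟨t.res 0, hT.mem_collapsePreimage.2 ⟨hT.isPruned.root_mem t, ?_⟩⟩
    have : collapse T (t.res 0) = (collapse T (t.res 0)).res 0 :=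
      (Node.res_of_len_le ((countBelow_le _ _ _).trans (min_le_left _ _))).symm
    rw [this]
    exact hS.isPruned.root_mem _
  · intro s r hrs hs
    rw [hT.mem_collapsePreimage] at hs ⊢
    exact ⟨hT.isLowerSet hrs hs.1, hS.isLowerSet (collapse_mono T hrs) hs.2⟩
  · intro t ht h
    simp only [hT.mem_collapsePreimage] at h ⊢
    have htT : t ∈ T := hT.limit_mem t ht fun s hs => (h s hs).1
    refine ⟨htT, ?_⟩
    refine hS.isPruned.mem_of_forall_lt (hS.isPruned.root_mem (collapse T t)) (fun r hr => ?_)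
      (Node.res_le _ _)
    -- `r` is a proper initial segment of the image of `t`; cut `t` just above the splitting level
    -- that corresponds to the length of `r`
    have h1 : levEnum T r.len < t.len := lt_len_collapse.1 (Node.len_lt_of_lt hr)
    have h2 : levEnum T r.len + 1 < t.len := ht.succ_lt h1
    have h3 := collapse_mono T (Node.res_le t (levEnum T r.len + 1))
    have h4 : r.len < (collapse T (t.res (levEnum T r.len + 1))).len := by
      rw [lt_len_collapse, Node.res_len_of_le h2.le]
      exact lt_add_one _
    exact ⟨_, (h _ (Node.res_lt h2)).2,
      Node.lt_of_le_of_len_lt (Node.le_of_le_of_len_le hr.le h3 h4.le) h4, h3⟩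
  · intro t ht
    simp only [hT.mem_collapsePreimage] at ht ⊢
    by_cases hl : t.len ∈ lev T
    · obtain ⟨b, hb⟩ := hS.isPruned.exists_snoc _ ht.2
      exact ⟨b, hT.snoc_mem ht.1 hl b, by rwa [hT.collapse_snoc_of_mem hl]⟩
    · obtain ⟨b, hb⟩ := hT.isPruned.exists_snoc t ht.1
      exact ⟨b, hb, by rw [collapse_snoc_of_notMem hl]; exact ht.2⟩
  · intro t ht
    have ht' := hT.mem_collapsePreimage.1 ht
    have hlen : ∀ β, levEnum T β = t.len → (collapse T t).len = β := fun β hβ => by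
      change countBelow _ _ t.len = β
      rw [← hβ]
      exact countBelow_enumBelow _ _ _
    constructor
    · intro h
      have hl : t.len ∈ lev T := ⟨t, split_mono (fun s hs => hs.1) h, rfl⟩
      obtain ⟨β, -, hβ⟩ := hT.exists_levEnum hl
      refine ⟨β, ?_, hβ⟩
      rw [← hlen β hβ, ← hS.mem_split_iff ht'.2]
      refine mem_split.2 ⟨ht'.2, fun b => ?_⟩
      have := (hT.mem_collapsePreimage.1 ((mem_split.1 h).2 b)).2
      rwa [hT.collapse_snoc_of_mem hl] at this
    · rintro ⟨β, hβ, hβt⟩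
      have hl : t.len ∈ lev T := hβt ▸ hT.levEnum_mem (hS.isClubIn_lev.lt β hβ)
      refine mem_split.2 ⟨ht, fun b => hT.mem_collapsePreimage.2 ⟨hT.snoc_mem ht'.1 hl b, ?_⟩⟩
      rw [hT.collapse_snoc_of_mem hl]
      exact hS.snoc_mem ht'.2 ((hlen β hβt).symm ▸ hβ) b

theorem isClubTree_collapsePreimage {T S : Set (Node κ)} (hT : IsClubTree T) (hS : IsClubTree S) :
    IsClubTree (collapsePreimage T S) := by
  obtain ⟨h1, h2⟩ := isPruned_collapsePreimage hT hS
  refine h1.isClubTree ⟨?_, fun α hα => ?_, fun α hα h0 h => ?_⟩ h2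
  · rintro _ ⟨β, hβ, rfl⟩
    exact hT.levEnum_lt (hS.isClubIn_lev.lt β hβ)
  · obtain ⟨β, hβ, h⟩ := hS.isClubIn_lev.unbounded α hα
    exact ⟨_, ⟨β, hβ, rfl⟩, h.trans_le (levEnum_strictMono T).le_apply⟩
  · have hα' : α ∈ lev T := hT.isClubIn_lev.closed α hα h0 fun β hβ => by
      obtain ⟨_, ⟨γ, hγ, rfl⟩, h'⟩ := h β hβ
      exact ⟨_, hT.levEnum_mem (hS.isClubIn_lev.lt γ hγ), h'⟩
    obtain ⟨ξ, hξ, rfl⟩ := hT.exists_levEnum hα'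
    refine ⟨ξ, hS.isClubIn_lev.closed ξ hξ ?_ fun β hβ => ?_, rfl⟩
    · rintro rfl
      obtain ⟨_, ⟨γ, hγ, rfl⟩, -, h'⟩ := h 0 (pos_iff_ne_zero.2 h0)
      exact absurd ((levEnum_strictMono T).lt_iff_lt.1 h') not_lt_zero
    · obtain ⟨_, ⟨γ, hγ, rfl⟩, h3, h4⟩ := h _ (levEnum_strictMono T hβ)
      exact ⟨γ, hγ, (levEnum_strictMono T).lt_iff_lt.1 h3, (levEnum_strictMono T).lt_iff_lt.1 h4⟩

theorem IsClubTree.comparable_of_collapse {T : Set (Node κ)} (hT : IsClubTree T) {s t : Node κ}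
    (hs : s ∈ T) (ht : t ∈ T) (h : collapse T s ≤ collapse T t ∨ collapse T t ≤ collapse T s) :
    s ≤ t ∨ t ≤ s := by
  rcases Node.comparable_or_branch s t with h' | ⟨ξ, h1, h2, h3, h4⟩
  · exact h'
  · exfalso
    -- the nodes branch at a splitting level, which is recorded by their images
    have hl : ξ ∈ lev T := by
      refine ⟨s.res ξ, mem_split.2 ⟨hT.isLowerSet (Node.res_le _ _) hs, fun b => ?_⟩,
        Node.res_len_of_le h1.le⟩
      have ha := hT.isLowerSet (Node.snoc_res_le h1) hs
      have hb := hT.isLowerSet (Node.snoc_res_le h2) ht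
      rw [← h3] at hb
      revert ha hb h4
      cases s.val ξ <;> cases t.val ξ <;> cases b <;> simp +contextual
    obtain ⟨β, -, rfl⟩ := hT.exists_levEnum hl
    have h1' := lt_len_collapse.2 h1
    have h2' := lt_len_collapse.2 h2
    refine Node.not_comparable_of_branch h1' h2' ?_ h
    rwa [collapse_val h1', collapse_val h2']

theorem cone_collapsePreimage {T S : Set (Node κ)} (hT : IsClubTree T) {t : Node κ}
    (ht : t ∈ collapsePreimage T S) :
    cone (collapsePreimage T S) t = collapsePreimage T (cone S (collapse T t)) := by
  have ht' := hT.mem_collapsePreimage.1 ht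
  ext s
  constructor
  · rintro ⟨h1, h2⟩
    rw [hT.mem_collapsePreimage] at h1 ⊢
    exact ⟨h1.1, h1.2, h2.imp (collapse_mono T) (collapse_mono T)⟩
  · intro h
    rw [hT.mem_collapsePreimage] at h
    exact ⟨hT.mem_collapsePreimage.2 ⟨h.1, h.2.1⟩,
      hT.comparable_of_collapse h.1 ht'.1 h.2.2⟩

end

variable {κ : Cardinal.{u}} [Fact κ.IsInaccessible]

/-! ### Fusion sequences -/

theorem add_lt_ord {α β : Ordinal.{u}} (hα : α < κ.ord) (hβ : β < κ.ord) : α + β < κ.ord :=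
  (Ordinal.isPrincipal_add_ord (Fact.out : κ.IsInaccessible).aleph0_lt.le) hα hβ

theorem LeRank.levEnum_eq {γ : Ordinal.{u}} (hγ : γ < κ.ord) {T T' : Set (Node κ)}
    (hT : IsClubTree T) (hT' : IsClubTree T') (h : LeRank γ T T') :
    levEnum T γ = levEnum T' γ := by
  obtain ⟨w, hw, hl⟩ := hT.isPruned.exists_len (hT.levEnum_lt hγ)
  have : w ∈ SplitRank γ T := (hT.mem_splitRank hγ).2 ⟨hw, hl⟩
  rw [h.2, hT'.mem_splitRank hγ] at this
  rw [← hl, this.2]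

theorem LeRank.mem {γ : Ordinal.{u}} (hγ : γ < κ.ord) {T T' : Set (Node κ)}
    (hT : IsClubTree T) (hT' : IsClubTree T') (h : LeRank γ T T') {t : Node κ} (ht : t ∈ T')
    (hl : t.len ≤ levEnum T' γ + 1) : t ∈ T := by
  have key : ∀ s ∈ T', s.len ≤ levEnum T' γ → s ∈ T := by
    intro s hs hsl
    obtain ⟨w, hw, hsw, hwl⟩ := hT'.isPruned.exists_extend hs (hT'.levEnum_lt hγ) hsl
    have : w ∈ SplitRank γ T' := (hT'.mem_splitRank hγ).2 ⟨hw, hwl⟩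
    rw [← h.2] at this
    exact hT.isLowerSet hsw this.1.1
  rcases hl.lt_or_eq with h1 | h1
  · exact key t ht (Order.lt_add_one_iff.1 h1)
  · have h2 : levEnum T' γ < t.len := h1 ▸ lt_add_one _
    have h3 : (t.res (levEnum T' γ)).len = levEnum T' γ := Node.res_len_of_le h2.le
    have h4 := key _ (hT'.isLowerSet (Node.res_le t _) ht) h3.le
    have h5 := hT.snoc_mem h4
      (by rw [h3, ← h.levEnum_eq hγ hT hT']; exact hT.levEnum_mem hγ) (t.val (levEnum T' γ))
    rwa [Node.eq_of_le_of_len_le (Node.snoc_res_le h2)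
      (by rw [Node.snoc_len, h3, h1])] at h5

theorem leRank_of_agree {γ : Ordinal.{u}} (hγ : γ < κ.ord) {T T' : Set (Node κ)}
    (hT : IsClubTree T) (hT' : IsClubTree T') (hsub : T ⊆ T')
    (h : ∀ t ∈ T', t.len ≤ levEnum T' γ + 1 → t ∈ T) : LeRank γ T T' := by
  have hlev : ∀ α ≤ levEnum T' γ, α ∈ lev T' → α ∈ lev T := by
    intro α hα hα'
    obtain ⟨w, hw, rfl⟩ := hT'.isPruned.exists_len (hT'.isClubIn_lev.lt α hα')
    exact ⟨w, mem_split.2 ⟨h w hw (hα.trans (lt_add_one _).le),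
      fun b => h _ (hT'.snoc_mem hw hα' b) (by
        rw [Node.snoc_len, Order.add_one_le_iff, Order.lt_add_one_iff]; exact hα)⟩, rfl⟩
  have hd : levEnum T γ = levEnum T' γ := by
    obtain ⟨γ', -, hγ'⟩ := hT.exists_levEnum (hlev _ le_rfl (hT'.levEnum_mem hγ))
    have h1 : countBelow κ.ord (lev T) (levEnum T' γ) = γ' := by
      rw [← hγ']
      exact countBelow_enumBelow _ _ _
    have h2 : countBelow κ.ord (lev T') (levEnum T' γ) = γ := countBelow_enumBelow _ _ _
    have h3 : lev T ∩ Iio (levEnum T' γ) = lev T' ∩ Iio (levEnum T' γ) :=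
      subset_antisymm (fun α hα => ⟨lev_mono hsub hα.1, hα.2⟩)
        fun α hα => ⟨hlev α (le_of_lt hα.2) hα.1, hα.2⟩
    have hle := (hT'.levEnum_lt hγ).le
    rw [← nonempty_orderIso_iff hle] at h1 h2
    rw [h3] at h1
    rw [nonempty_orderIso_iff hle] at h1 h2
    rw [← hγ', ← h1, h2]
  refine ⟨hsub, ?_⟩
  ext t
  rw [hT.mem_splitRank hγ, hT'.mem_splitRank hγ, hd]
  exact ⟨fun ht => ⟨hsub ht.1, ht.2⟩, fun ht => ⟨h t ht.1 (ht.2.le.trans (lt_add_one _).le), ht.2⟩⟩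

theorem LeRank.of_le {γ β : Ordinal.{u}} (hγ : γ < κ.ord) (hβ : β ≤ γ) {T T' : Set (Node κ)}
    (hT : IsClubTree T) (hT' : IsClubTree T') (h : LeRank γ T T') : LeRank β T T' :=
  leRank_of_agree (hβ.trans_lt hγ) hT hT' h.1 fun _ ht hl => h.mem hγ hT hT' ht (hl.trans (by
    gcongr
    exact (levEnum_strictMono T').monotone hβ))

/-- A sequence `⟨s i : i < δ⟩` of trees in `𝕊^club` with `s i ≤_{γ + j} s j` for `j < i`. -/
structure IsFusionSeq (δ γ : Ordinal.{u}) (s : Ordinal.{u} → Set (Node κ)) : Prop where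
  isClubTree : ∀ i < δ, IsClubTree (s i)
  leRank : ∀ i < δ, ∀ j < i, LeRank (γ + j) (s i) (s j)

/-- The `(γ + i)`-th splitting level of the `i`-th term of a sequence of trees. -/
noncomputable def fusionLev (γ : Ordinal.{u}) (s : Ordinal.{u} → Set (Node κ)) (i : Ordinal.{u}) :
    Ordinal.{u} := levEnum (s i) (γ + i)

namespace IsFusionSeq
variable {δ γ : Ordinal.{u}} {s : Ordinal.{u} → Set (Node κ)}

theorem desc (hs : IsFusionSeq δ γ s) : ∀ i < δ, ∀ j < i, s i ⊆ s j :=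
  fun i hi j hj => (hs.leRank i hi j hj).1

theorem levEnum_eq (hs : IsFusionSeq δ γ s) (hγ : γ < κ.ord) (hδ : δ ≤ κ.ord) {i j : Ordinal.{u}}
    (hi : i < δ) (hj : j ≤ i) : levEnum (s i) (γ + j) = fusionLev γ s j := by
  rcases hj.lt_or_eq with h | rfl
  · exact (hs.leRank i hi j h).levEnum_eq (add_lt_ord hγ ((h.trans hi).trans_le hδ))
      (hs.1 i hi) (hs.1 j (h.trans hi))
  · rfl

theorem fusionLev_strictMono (hs : IsFusionSeq δ γ s) (hγ : γ < κ.ord) (hδ : δ ≤ κ.ord)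
    {i j : Ordinal.{u}} (hi : i < δ) (hj : j < i) : fusionLev γ s j < fusionLev γ s i := by
  rw [← hs.levEnum_eq hγ hδ hi hj.le]
  exact levEnum_strictMono _ ((add_lt_add_iff_left γ).2 hj)

theorem le_fusionLev (γ : Ordinal.{u}) (s : Ordinal.{u} → Set (Node κ)) (i : Ordinal.{u}) :
    i ≤ fusionLev γ s i :=
  le_add_self.trans (levEnum_strictMono (s i)).le_apply

theorem mem_of_len_le (hs : IsFusionSeq δ γ s) (hγ : γ < κ.ord) (hδ : δ ≤ κ.ord)
    {i j : Ordinal.{u}} (hi : i < δ) (hj : j < δ) {t : Node κ} (ht : t ∈ s j)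
    (hl : t.len ≤ fusionLev γ s j + 1) : t ∈ s i := by
  rcases lt_trichotomy i j with h | rfl | h
  · exact hs.desc j hj i h ht
  · exact ht
  · exact (hs.leRank i hi j h).mem (add_lt_ord hγ (hj.trans_le hδ)) (hs.1 i hi) (hs.1 j hj) ht hl

theorem fusionLev_mem_lev (hs : IsFusionSeq δ γ s) (hγ : γ < κ.ord) (hδ : δ ≤ κ.ord)
    {i j : Ordinal.{u}} (hi : i < δ) (hj : j < δ) : fusionLev γ s j ∈ lev (s i) := by
  have hself : ∀ i < δ, ∀ j ≤ i, fusionLev γ s j ∈ lev (s i) := fun i hi j hj => by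
    rw [← hs.levEnum_eq hγ hδ hi hj]
    exact (hs.1 i hi).levEnum_mem (add_lt_ord hγ ((hj.trans_lt hi).trans_le hδ))
  rcases le_or_gt j i with h | h
  · exact hself i hi j h
  · exact lev_mono (hs.desc j hj i h) (hself j hj j le_rfl)

theorem isClubTree_fusionLimit (hs : IsFusionSeq κ.ord γ s) (hγ : γ < κ.ord) :
    IsClubTree (fusionLimit s) :=
  isClubTree_inter zero_lt_ord hs.1 hs.desc fun α hα =>
    ⟨fusionLev γ s (α + 1), (lt_add_one α).trans_le (le_fusionLev _ _ _),
      fun _ hi => hs.fusionLev_mem_lev hγ le_rfl hi (add_one_lt_ord hα)⟩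

theorem isClubTree_inter (hs : IsFusionSeq δ γ s) (h0 : 0 < δ) (hδ : δ < κ.ord) :
    IsClubTree {t | ∀ i < δ, t ∈ s i} :=
  isClubTree_inter_of_lt h0 hδ hs.1 hs.desc

theorem leRank_inter (hs : IsFusionSeq δ γ s) (hγ : γ < κ.ord) (hδ : δ < κ.ord)
    {j : Ordinal.{u}} (hj : j < δ) : LeRank (γ + j) {t | ∀ i < δ, t ∈ s i} (s j) :=
  leRank_of_agree (add_lt_ord hγ (hj.trans hδ)) (hs.isClubTree_inter (bot_le.trans_lt hj) hδ)
    (hs.1 j hj) (fun _ ht => ht j hj) fun _ ht hl _ hi => hs.mem_of_len_le hγ hδ.le hi hj ht hl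

end IsFusionSeq

/-! ### Gluing trees above a level -/

/-- The union of the trees `R w`, where `w` runs through the nodes of `T` of length `η`. -/
def glue (T : Set (Node κ)) (η : Ordinal.{u}) (R : Node κ → Set (Node κ)) : Set (Node κ) :=
  {t | ∃ w ∈ T, w.len = η ∧ t ∈ R w}

/-- The data for `glue`: below every node `w` of length `d + 1` there is a subtree `R w`, and all
these subtrees have the same splitting levels. -/
structure IsGluing (T : Set (Node κ)) (d : Ordinal.{u}) (R : Node κ → Set (Node κ))
    (C : Set Ordinal.{u}) : Prop where
  isClubTree : IsClubTree T
  lt_ord : d < κ.ord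
  subset : ∀ w ∈ T, w.len = d + 1 → R w ⊆ cone T w
  isClubTree_apply : ∀ w ∈ T, w.len = d + 1 → IsClubTree (R w)
  lev_eq : ∀ w ∈ T, w.len = d + 1 → lev (R w) = C

namespace IsGluing
variable {T : Set (Node κ)} {d : Ordinal.{u}} {R : Node κ → Set (Node κ)} {C : Set Ordinal.{u}}

theorem glue_subset (h : IsGluing T d R C) : glue T (d + 1) R ⊆ T := by
  rintro t ⟨w, hw, hl, ht⟩
  exact (h.subset w hw hl ht).1

theorem mem_self (h : IsGluing T d R C) {w : Node κ} (hw : w ∈ T) (hl : w.len = d + 1) :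
    w ∈ R w := by
  obtain ⟨r, hr, hrl⟩ := (h.isClubTree_apply w hw hl).isPruned.exists_len w.len_lt
  have : r = w := (h.subset w hw hl hr).2.elim (fun h' => Node.eq_of_le_of_len_le h' hrl.ge)
    (fun h' => (Node.eq_of_le_of_len_le h' hrl.le).symm)
  rwa [this] at hr

theorem mem_of_len_le (h : IsGluing T d R C) {t : Node κ} (ht : t ∈ T) (hl : t.len ≤ d + 1) :
    t ∈ glue T (d + 1) R := by
  obtain ⟨w, hw, htw, hwl⟩ :=
    h.isClubTree.isPruned.exists_extend ht (add_one_lt_ord h.lt_ord) hl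
  exact ⟨w, hw, hwl, (h.isClubTree_apply w hw hwl).isLowerSet htw (h.mem_self hw hwl)⟩

theorem mem_res (h : IsGluing T d R C) {t : Node κ} (ht : t ∈ glue T (d + 1) R)
    (hl : d + 1 ≤ t.len) : t ∈ R (t.res (d + 1)) := by
  obtain ⟨w, hw, hwl, htw⟩ := ht
  have hwt : w ≤ t := (h.subset w hw hwl htw).2.elim
    (fun h' => (Node.eq_of_le_of_len_le h' (hwl.trans_le hl)).ge) id
  rwa [← hwl, Node.res_eq_of_le hwt]

theorem isPruned_glue (h : IsGluing T d R C) : IsPruned (glue T (d + 1) R) where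
  nonempty := by
    obtain ⟨t, ht⟩ := h.isClubTree.nonempty
    exact ⟨_, h.mem_of_len_le (h.isClubTree.isPruned.root_mem t) (by simp [Node.res_len])⟩
  isLowerSet t r hrt := by
    rintro ⟨w, hw, hl, ht⟩
    exact ⟨w, hw, hl, (h.isClubTree_apply w hw hl).isLowerSet hrt ht⟩
  limit_mem t ht hlt := by
    rcases le_or_gt t.len (d + 1) with hl | hl
    · exact h.mem_of_len_le
        (h.isClubTree.limit_mem t ht fun s hs => h.glue_subset (hlt s hs)) hl
    · have hw := h.glue_subset (hlt _ (Node.res_lt hl))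
      have hwl : (t.res (d + 1)).len = d + 1 := Node.res_len_of_le hl.le
      refine ⟨_, hw, hwl, (h.isClubTree_apply _ hw hwl).limit_mem t ht fun s hs => ?_⟩
      rcases le_or_gt (d + 1) s.len with h1 | h1
      · have := h.mem_res (hlt s hs) h1
        rwa [Node.res_eq_res_of_le hs.le h1] at this
      · exact (h.isClubTree_apply _ hw hwl).isLowerSet (Node.le_res hs.le h1.le)
          (h.mem_self hw hwl)
  exists_snoc := by
    rintro t ⟨w, hw, hl, ht⟩
    obtain ⟨b, hb⟩ := (h.isClubTree_apply w hw hl).isPruned.exists_snoc t ht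
    exact ⟨b, w, hw, hl, hb⟩

theorem le_of_mem (h : IsGluing T d R C) {α : Ordinal.{u}} (hα : α ∈ C) : d + 1 ≤ α := by
  obtain ⟨w, hw, hl⟩ := h.isClubTree.isPruned.exists_len (add_one_lt_ord h.lt_ord)
  rw [← h.lev_eq w hw hl] at hα
  have := lev_mono (h.subset w hw hl) hα
  rw [h.isClubTree.lev_cone hw] at this
  exact hl ▸ this.2

theorem isClubIn (h : IsGluing T d R C) : IsClubIn κ.ord C := by
  obtain ⟨w, hw, hl⟩ := h.isClubTree.isPruned.exists_len (add_one_lt_ord h.lt_ord)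
  rw [← h.lev_eq w hw hl]
  exact (h.isClubTree_apply w hw hl).isClubIn_lev

theorem split_iff (h : IsGluing T d R C) {t : Node κ} (ht : t ∈ glue T (d + 1) R) :
    t ∈ Split (glue T (d + 1) R) ↔ t.len ∈ lev T ∩ Iio (d + 1) ∪ C := by
  rcases lt_or_ge t.len (d + 1) with hl | hl
  · constructor
    · intro h'
      exact Or.inl ⟨⟨t, split_mono h.glue_subset h', rfl⟩, hl⟩
    · rintro (h' | h')
      · exact mem_split.2 ⟨ht, fun b => h.mem_of_len_le
          (h.isClubTree.snoc_mem (h.glue_subset ht) h'.1 b) (Order.add_one_le_of_lt hl)⟩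
      · exact absurd hl (not_lt.2 (h.le_of_mem h'))
  · have hw : t.res (d + 1) ∈ T := h.isClubTree.isLowerSet (Node.res_le _ _) (h.glue_subset ht)
    have hwl : (t.res (d + 1)).len = d + 1 := Node.res_len_of_le hl
    have ht' := h.mem_res ht hl
    have h1 := (h.isClubTree_apply _ hw hwl).mem_split_iff ht'
    rw [h.lev_eq _ hw hwl] at h1
    constructor
    · intro h'
      refine Or.inr (h1.1 (mem_split.2 ⟨ht', fun b => ?_⟩))
      have := h.mem_res ((mem_split.1 h').2 b) (hl.trans (lt_add_one t.len).le)
      rwa [← Node.res_eq_res_of_le (Node.le_snoc t b) hl] at this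
    · rintro (h' | h')
      · exact absurd h'.2 (not_lt.2 hl)
      · exact mem_split.2 ⟨ht, fun b => ⟨_, hw, hwl, (mem_split.1 (h1.2 h')).2 b⟩⟩

theorem isClubTree_glue (h : IsGluing T d R C) : IsClubTree (glue T (d + 1) R) := by
  refine h.isPruned_glue.isClubTree ⟨?_, fun α hα => ?_, fun α hα h0 hlim => ?_⟩
    fun t ht => h.split_iff ht
  · rintro α (hα | hα)
    · exact h.isClubTree.isClubIn_lev.lt α hα.1
    · exact h.isClubIn.lt α hα
  · obtain ⟨β, hβ, h'⟩ := h.isClubIn.unbounded α hα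
    exact ⟨β, Or.inr hβ, h'⟩
  · rcases lt_or_ge α (d + 1) with h1 | h1
    · refine Or.inl ⟨h.isClubTree.isClubIn_lev.closed α hα h0 fun β hβ => ?_, h1⟩
      obtain ⟨γ, hγ | hγ, h2⟩ := hlim β hβ
      · exact ⟨γ, hγ.1, h2⟩
      · exact absurd (h2.2.trans h1) (not_lt.2 (h.le_of_mem hγ))
    · refine Or.inr (h.isClubIn.closed α hα h0 fun β hβ => ?_)
      obtain ⟨γ, hγ, h2⟩ := hlim (max β d) (max_lt hβ ((lt_add_one d).trans_le h1))
      refine ⟨γ, hγ.resolve_left fun h3 => ?_, (le_max_left _ _).trans_lt h2.1, h2.2⟩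
      exact absurd ((le_max_right _ _).trans_lt h2.1) (not_lt.2 (Order.lt_add_one_iff.1 h3.2))

theorem cone_glue (h : IsGluing T d R C) {t : Node κ} (ht : t ∈ glue T (d + 1) R)
    (hl : d + 1 ≤ t.len) : cone (glue T (d + 1) R) t = cone (R (t.res (d + 1))) t := by
  have hw : t.res (d + 1) ∈ T := h.isClubTree.isLowerSet (Node.res_le _ _) (h.glue_subset ht)
  have hwl : (t.res (d + 1)).len = d + 1 := Node.res_len_of_le hl
  refine subset_antisymm ?_ fun s hs => ⟨⟨_, hw, hwl, hs.1⟩, hs.2⟩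
  rintro s ⟨hs, hst | hts⟩
  · exact ⟨(h.isClubTree_apply _ hw hwl).isLowerSet hst (h.mem_res ht hl), Or.inl hst⟩
  · have := h.mem_res hs (hl.trans hts.1)
    rw [← Node.res_eq_res_of_le hts hl] at this
    exact ⟨this, Or.inr hts⟩

end IsGluing

/-! ### Existence of fusion sequences -/

/-- There are fewer than `κ` nodes of a given length. -/
theorem mk_level_lt {η : Ordinal.{u}} (hη : η < κ.ord) :
    Cardinal.mk {w : Node κ | w.len = η} < Cardinal.lift.{u + 1} κ := by
  have hinj : Function.Injective
      (fun (w : {w : Node κ | w.len = η}) (ξ : Iio η) => w.1.val ξ.1) := by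
    rintro ⟨w, hw⟩ ⟨w', hw'⟩ h
    refine Subtype.ext (Node.ext_of_lt (hw.trans hw'.symm) fun ξ hξ => ?_)
    exact congrFun h ⟨ξ, hw ▸ hξ⟩
  refine (Cardinal.mk_le_of_injective hinj).trans_lt ?_
  have h2 : (2 : Cardinal.{u}) ^ η.card < κ :=
    (Fact.out : κ.IsInaccessible).isStrongPrelimit (Cardinal.lt_ord.1 hη)
  have h3 : Cardinal.mk (Iio η → Bool) = Cardinal.lift.{u + 1} ((2 : Cardinal.{u}) ^ η.card) := by
    rw [Cardinal.mk_arrow, Cardinal.mk_Iio_ordinal]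
    simp
  rw [h3, Cardinal.lift_lt]
  exact h2

/-- Closure of a family under restricting its trees to the nodes compatible with one of them. -/
def ConeClosed (G : Set (Set (Node κ))) : Prop := ∀ T ∈ G, ∀ t ∈ T, cone T t ∈ G

/-- Closure of a family under intersections of descending sequences of length less than `κ`. -/
def DescClosed (G : Set (Set (Node κ))) : Prop :=
  ∀ (δ : Ordinal.{u}) (T : Ordinal.{u} → Set (Node κ)), 0 < δ → δ < κ.ord → (∀ i < δ, T i ∈ G) →
    (∀ i < δ, ∀ j < i, T i ⊆ T j) → {t | ∀ i < δ, t ∈ T i} ∈ G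

/-- Any fewer than `κ` elements of `G` can be shrunk to elements of `G ∩ E` with the same
splitting levels. -/
def SyncDense (G E : Set (Set (Node κ))) : Prop :=
  ∀ (N : Set (Node κ)) (R : Node κ → Set (Node κ)), Cardinal.mk N < Cardinal.lift.{u + 1} κ →
    (∀ w ∈ N, R w ∈ G) → ∃ (R' : Node κ → Set (Node κ)) (C : Set Ordinal.{u}),
      ∀ w ∈ N, R' w ∈ G ∧ R' w ∈ E ∧ R' w ⊆ R w ∧ lev (R' w) = C

namespace IsFusionSeq

variable {γ i : Ordinal.{u}} {s : Ordinal.{u} → Set (Node κ)}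

/-- At limits, the next splitting level of the intersection of a fusion sequence is the supremum of
the levels that have been preserved so far. -/
theorem exists_lt_fusionLev (hs : IsFusionSeq i γ s) (hγ : γ < κ.ord) (hi : i < κ.ord)
    (hlim : IsSuccLimit i) {β : Ordinal.{u}}
    (hβ : β < levEnum {t | ∀ j < i, t ∈ s j} (γ + i)) : ∃ j < i, β < fusionLev γ s j := by
  have hy := hs.isClubTree_inter hlim.bot_lt hi
  by_contra hcon
  push Not at hcon
  have hb : BddAbove (fusionLev γ s '' Iio i) := ⟨β, by rintro _ ⟨j, hj, rfl⟩; exact hcon j hj⟩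
  have hlt : ∀ j < i, fusionLev γ s j < sSup (fusionLev γ s '' Iio i) := fun j hj =>
    (hs.fusionLev_strictMono hγ hi.le (hlim.succ_lt hj) (lt_succ j)).trans_le
      (le_csSup hb ⟨succ j, hlim.succ_lt hj, rfl⟩)
  have hle : sSup (fusionLev γ s '' Iio i) ≤ β :=
    csSup_le' (by rintro _ ⟨j, hj, rfl⟩; exact hcon j hj)
  have hκ := hle.trans_lt (hβ.trans (hy.levEnum_lt (add_lt_ord hγ hi)))
  have hmem : sSup (fusionLev γ s '' Iio i) ∈ lev {t | ∀ j < i, t ∈ s j} := by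
    refine hy.isClubIn_lev.closed _ hκ (bot_le.trans_lt (hlt 0 hlim.bot_lt)).ne' fun β' hβ' => ?_
    have : ∃ j < i, β' < fusionLev γ s j := by
      by_contra hc
      push Not at hc
      exact absurd hβ' (not_lt.2 (csSup_le' (by rintro _ ⟨j, hj, rfl⟩; exact hc j hj)))
    obtain ⟨j, hj, h⟩ := this
    refine ⟨_, ?_, h, hlt j hj⟩
    rw [lev_inter hlim.bot_lt hs.1 hs.desc]
    exact fun k hk => hs.fusionLev_mem_lev hγ hi.le hk hj
  obtain ⟨ξ, -, hξ⟩ := hy.exists_levEnum hmem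
  have h1 : γ + i ≤ ξ := by
    rw [(Ordinal.isNormal_add_right γ).le_iff_forall_le hlim]
    intro j hj
    have h2 := hlt j hj
    have h3 : _ = fusionLev γ s j :=
      (hs.leRank_inter hγ hi hj).levEnum_eq (add_lt_ord hγ (hj.trans hi)) hy (hs.1 j hj)
    rw [← hξ, ← h3] at h2
    exact ((levEnum_strictMono _).lt_iff_lt.1 h2).le
  have h2 := (levEnum_strictMono {t | ∀ j < i, t ∈ s j}).monotone h1
  rw [hξ] at h2
  exact absurd (hβ.trans_le (h2.trans hle)) (lt_irrefl _)

theorem fusionLev_lt_len (hs : IsFusionSeq i γ s) (hγ : γ < κ.ord) (hi : i < κ.ord)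
    {j : Ordinal.{u}} (hj : j < i) : fusionLev γ s j < levEnum {t | ∀ j < i, t ∈ s j} (γ + i) := by
  have h := (hs.leRank_inter hγ hi hj).levEnum_eq (add_lt_ord hγ (hj.trans hi))
    (hs.isClubTree_inter (bot_le.trans_lt hj) hi) (hs.1 j hj)
  refine (h.symm.trans_lt ?_ : levEnum (s j) (γ + j) < _)
  exact levEnum_strictMono _ ((add_lt_add_iff_left γ).2 hj)

/-- At limits, the cones of the intersection above its next splitting level are intersections of
cones that are controlled by the previous terms. -/
theorem cone_inter_eq (hs : IsFusionSeq i γ s) (hγ : γ < κ.ord) (hi : i < κ.ord)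
    (hlim : IsSuccLimit i) {t : Node κ} (hl : t.len = levEnum {t | ∀ j < i, t ∈ s j} (γ + i)) :
    cone {t | ∀ j < i, t ∈ s j} t = {v | ∀ j < i, v ∈ cone (s j) (t.res (fusionLev γ s j))} := by
  ext v
  constructor
  · rintro ⟨h1, h2⟩ j hj
    exact cone_anti _ (Node.res_le t _) ⟨h1 j hj, h2⟩
  · intro h
    refine ⟨fun j hj => (h j hj).1, ?_⟩
    by_cases hv : ∃ j < i, v ≤ t.res (fusionLev γ s j)
    · obtain ⟨j, hj, h1⟩ := hv
      exact Or.inl (h1.trans (Node.res_le _ _))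
    · push Not at hv
      have hge : ∀ j < i, t.res (fusionLev γ s j) ≤ v := fun j hj =>
        (h j hj).2.resolve_left (hv j hj)
      have key : ∀ ξ < t.len, ∃ j < i, ξ < (t.res (fusionLev γ s j)).len := by
        intro ξ hξ
        rw [hl] at hξ
        obtain ⟨j, hj, h1⟩ := hs.exists_lt_fusionLev hγ hi hlim hξ
        refine ⟨j, hj, ?_⟩
        rwa [Node.res_len_of_le (hl.symm ▸ (hs.fusionLev_lt_len hγ hi hj).le)]
      refine Or.inr (Node.le_def.2 ⟨le_of_forall_lt fun ξ hξ => ?_, fun ξ hξ => ?_⟩)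
      · obtain ⟨j, hj, h1⟩ := key ξ hξ
        exact h1.trans_le (hge j hj).1
      · obtain ⟨j, hj, h1⟩ := key ξ hξ
        rw [← (hge j hj).2 ξ h1, (Node.res_le t _).2 ξ h1]

end IsFusionSeq

/-- Fusion sequences exist, if `G ∩ E j` is dense in `G` for the simultaneous shrinking of fewer than
`κ` trees: at successor steps the cones above the last preserved splitting level
are shrunk into `E i` and glued, at limit steps one takes the intersection. -/
theorem exists_fusionSeq {G : Set (Set (Node κ))} (hclub : ∀ T ∈ G, IsClubTree T)
    (hcone : ConeClosed G) (hdesc : DescClosed G) {E : Ordinal.{u} → Set (Set (Node κ))}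
    (hE : ∀ i < κ.ord, ∀ S ∈ E i, ∀ R ∈ G, R ⊆ S → R ∈ E i)
    (hsync : ∀ i < κ.ord, SyncDense G (E i)) {T : Set (Node κ)} (hT : T ∈ G) {γ : Ordinal.{u}}
    (hγ : γ < κ.ord) :
    ∃ s, IsFusionSeq κ.ord γ s ∧ s 0 = T ∧ ∀ i < κ.ord, ∀ t ∈ SplitRank (γ + i) (s i),
      cone (s i) t ∈ G ∧ ∀ j, i = j + 1 → cone (s i) t ∈ E j := by
  let P : Ordinal.{u} → (Ordinal.{u} → Set (Node κ)) → Set (Node κ) → Prop := fun i s y =>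
    (i = 0 → y = T) ∧ IsClubTree y ∧ (∀ j < i, LeRank (γ + j) y (s j)) ∧
      ∀ t ∈ SplitRank (γ + i) y, cone y t ∈ G ∧ ∀ j, i = j + 1 → cone y t ∈ E j
  obtain ⟨s, hs⟩ := exists_rec κ.ord (fun i s => P i s (s i)) ∅ (by
      rintro i - s s' h - ⟨h1, h2, h3, h4⟩
      rw [h i le_rfl] at h1 h2 h3 h4
      exact ⟨h1, h2, fun j hj => h j hj.le ▸ h3 j hj, h4⟩) (by
    intro i hi s hs
    suffices h : ∃ y, P i s y by
      obtain ⟨y, h1, h2, h3, h4⟩ := h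
      refine ⟨y, ?_⟩
      simp only [Function.update_self]
      exact ⟨h1, h2, fun j hj => by rw [Function.update_of_ne hj.ne]; exact h3 j hj, h4⟩
    have hseq : IsFusionSeq i γ s := ⟨fun j hj => (hs j hj).2.1, fun j hj => (hs j hj).2.2.1⟩
    rcases Ordinal.zero_or_succ_or_isSuccLimit i with rfl | ⟨j, hj⟩ | hlim
    · refine ⟨T, fun _ => rfl, hclub T hT, fun j hj => absurd hj not_lt_zero, fun t ht =>
        ⟨hcone T hT t ht.1.1, fun j hj => absurd hj ?_⟩⟩
      exact (Order.succ_ne_bot j ∘ Eq.symm)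
    · rw [Order.succ_eq_add_one] at hj
      subst hj
      have hj : j < j + 1 := lt_add_one j
      have hjκ : j < κ.ord := hj.trans hi
      have hγj := add_lt_ord hγ hjκ
      obtain ⟨-, hcl, hle, hmem⟩ := hs j hj
      have hd : levEnum (s j) (γ + j) < κ.ord := hcl.levEnum_lt hγj
      -- the cones above the immediate successors of the nodes on the last preserved level
      obtain ⟨R, C, hR⟩ := hsync j hjκ {w | w ∈ s j ∧ w.len = levEnum (s j) (γ + j) + 1}
        (fun w => cone (s j) w)
        ((Cardinal.mk_le_mk_of_subset fun w hw => hw.2).trans_lt (mk_level_lt (add_one_lt_ord hd)))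
        (fun w hw => by
          have hlt : levEnum (s j) (γ + j) < w.len := hw.2 ▸ lt_add_one _
          have h1 : w.res (levEnum (s j) (γ + j)) ∈ SplitRank (γ + j) (s j) :=
            (hcl.mem_splitRank hγj).2 ⟨hcl.isLowerSet (Node.res_le _ _) hw.1,
              Node.res_len_of_le hlt.le⟩
          have h2 := hcone _ (hmem _ h1).1 w ⟨hw.1, Or.inr (Node.res_le _ _)⟩
          rwa [cone_cone_of_le _ (Node.res_le _ _)] at h2)
      have hg : IsGluing (s j) (levEnum (s j) (γ + j)) R C :=
        ⟨hcl, hd, fun w hw hl => (hR w ⟨hw, hl⟩).2.2.1,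
          fun w hw hl => hclub _ (hR w ⟨hw, hl⟩).1, fun w hw hl => (hR w ⟨hw, hl⟩).2.2.2⟩
      have hy := hg.isClubTree_glue
      have hlast : LeRank (γ + j) (glue (s j) (levEnum (s j) (γ + j) + 1) R) (s j) :=
        leRank_of_agree hγj hy hcl hg.glue_subset fun t ht hl => hg.mem_of_len_le ht hl
      refine ⟨_, fun h => absurd h (Order.succ_ne_bot j), hy, fun k hk => ?_, fun t ht => ?_⟩
      · rcases (Order.lt_add_one_iff.1 hk).lt_or_eq with h | rfl
        · have h1 := hlast.of_le hγj ((add_le_add_iff_left γ).2 h.le) hy hcl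
          exact ⟨h1.1.trans (hle k h).1, h1.2.trans (hle k h).2⟩
        · exact hlast
      · rw [hy.mem_splitRank (add_lt_ord hγ hi)] at ht
        have hlt : levEnum (s j) (γ + j) + 1 ≤ t.len := by
          rw [Order.add_one_le_iff, ht.2]
          exact (hlast.levEnum_eq hγj hy hcl).symm.trans_lt
            (levEnum_strictMono _ ((add_lt_add_iff_left γ).2 hj))
        have hw : t.res (levEnum (s j) (γ + j) + 1) ∈ s j :=
          hcl.isLowerSet (Node.res_le _ _) (hg.glue_subset ht.1)
        have hR' := hR _ ⟨hw, Node.res_len_of_le hlt⟩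
        rw [hg.cone_glue ht.1 hlt]
        have hG := hcone _ hR'.1 t (hg.mem_res ht.1 hlt)
        refine ⟨hG, fun k hk => ?_⟩
        obtain rfl : j = k := Order.succ_injective hk
        exact hE _ hjκ _ hR'.2.1 _ hG (cone_subset _ _)
    · have hy := hseq.isClubTree_inter hlim.bot_lt hi
      refine ⟨{t | ∀ j < i, t ∈ s j}, fun h => absurd h hlim.bot_lt.ne', hy,
        fun j hj => hseq.leRank_inter hγ hi hj, fun t ht => ⟨?_, fun j hj => ?_⟩⟩
      · rw [hy.mem_splitRank (add_lt_ord hγ hi)] at ht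
        rw [hseq.cone_inter_eq hγ hi hlim ht.2]
        refine hdesc i _ hlim.bot_lt hi (fun j hj => ?_) fun j hj k hk => ?_
        · refine ((hs j hj).2.2.2 _ ((((hs j hj).2.1).mem_splitRank
            (add_lt_ord hγ (hj.trans hi))).2 ⟨(hs j hj).2.1.isLowerSet (Node.res_le _ _)
              (ht.1 j hj), Node.res_len_of_le ?_⟩)).1
          rw [ht.2]
          exact (hseq.fusionLev_lt_len hγ hi hj).le
        · exact (cone_mono (hseq.desc j hj k hk) _).trans (cone_anti _ (Node.res_mono t
            (hseq.fusionLev_strictMono hγ hi.le hj hk).le))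
      · rw [hj] at hlim
        exact absurd hlim (Order.not_isSuccLimit_succ j))
  refine ⟨s, ⟨fun i hi => (hs i hi).2.1, fun i hi => (hs i hi).2.2.1⟩,
    (hs 0 zero_lt_ord).1 rfl, fun i hi => (hs i hi).2.2.2⟩

/-! ### Closing a family under intersections -/

theorem descClosed_interClosure (G : Set (Set (Node κ))) : DescClosed {R | InterClosure G R} :=
  fun δ T h0 hδ hT hdesc => InterClosure.inter δ T h0 hδ hT hdesc

theorem InterClosure.isClubTree {G : Set (Set (Node κ))} (hG : ∀ T ∈ G, IsClubTree T)
    {R : Set (Node κ)} (hR : InterClosure G R) : IsClubTree R := by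
  induction hR with
  | base T hT => exact hG T hT
  | inter δ T h0 hδ _ hdesc ih => exact isClubTree_inter_of_lt h0 hδ ih hdesc

theorem InterClosure.cone {G : Set (Set (Node κ))}
    (hG : ∀ T ∈ G, ∀ t ∈ T, InterClosure G (cone T t)) {R : Set (Node κ)}
    (hR : InterClosure G R) : ∀ t ∈ R, InterClosure G (TreeForcing.cone R t) := by
  induction hR with
  | base T hT => exact hG T hT
  | inter δ T h0 hδ _ hdesc ih =>
    intro t ht
    have : TreeForcing.cone {t | ∀ i < δ, t ∈ T i} t =
        {v | ∀ i < δ, v ∈ TreeForcing.cone (T i) t} :=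
      subset_antisymm (fun v hv i hi => ⟨hv.1 i hi, hv.2⟩)
        fun v hv => ⟨fun i hi => (hv i hi).1, (hv 0 h0).2⟩
    rw [this]
    exact InterClosure.inter δ _ h0 hδ (fun i hi => ih i hi t (ht i hi))
      fun i hi j hj => cone_mono (hdesc i hi j hj) t

/-- A property of trees that is inherited by subtrees, and that holds for all members of `G`
outside the family `G₀`, holds for all members of the closure of `G` outside `G₀`. -/
theorem InterClosure.mem_or {G G₀ : Set (Set (Node κ))} (hG₀ : DescClosed G₀)
    {p : Set (Node κ) → Prop} (hp : ∀ S R, p S → R ⊆ S → p R) (hG : ∀ S ∈ G, S ∈ G₀ ∨ p S)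
    {R : Set (Node κ)} (hR : InterClosure G R) : R ∈ G₀ ∨ p R := by
  induction hR with
  | base T hT => exact hG T hT
  | inter δ T h0 hδ _ hdesc ih =>
    by_cases h : ∀ i < δ, T i ∈ G₀
    · exact Or.inl (hG₀ δ T h0 hδ h hdesc)
    · push Not at h
      obtain ⟨i, hi, hi'⟩ := h
      exact Or.inr (hp _ _ ((ih i hi).resolve_left hi') fun v hv => hv i hi)

instance : Nonempty (Node κ) := ⟨(isPruned_univ (κ := κ)).nonempty.some⟩

theorem mk_node_le : Cardinal.mk (Node κ) ≤ Cardinal.lift.{u + 1} κ := by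
  have hinj : Function.Injective (fun w : Node κ =>
      (⟨⟨w.len, w.len_lt⟩, w, rfl⟩ : Σ α : Iio κ.ord, {w : Node κ | w.len = α.1})) := by
    intro w w' h
    exact congrArg (fun x : Σ α : Iio κ.ord, {w : Node κ | w.len = α.1} => x.2.1) h
  refine (Cardinal.mk_le_of_injective hinj).trans ?_
  rw [Cardinal.mk_sigma]
  refine (Cardinal.sum_le_sum _ (fun _ => Cardinal.lift.{u + 1} κ)
    fun α => (mk_level_lt α.2).le).trans ?_
  rw [Cardinal.sum_const, Cardinal.mk_Iio_ordinal, Cardinal.card_ord]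
  simp only [Cardinal.lift_id]
  exact (Cardinal.mul_eq_self (Cardinal.aleph0_le_lift.2
    (Fact.out : κ.IsInaccessible).aleph0_lt.le)).le

theorem mk_le_of_forall_exists {A B : Type (u + 1)} {X : Set B} (f : A → B)
    (hA : Cardinal.mk A ≤ Cardinal.lift.{u + 1} κ) (h : ∀ R ∈ X, ∃ a, f a = R) :
    Cardinal.mk X ≤ Cardinal.lift.{u + 1} κ :=
  (Cardinal.mk_le_mk_of_subset (show X ⊆ range f from h)).trans (Cardinal.mk_range_le.trans hA)

theorem mk_prod_le {A B : Type (u + 1)} (hA : Cardinal.mk A ≤ Cardinal.lift.{u + 1} κ)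
    (hB : Cardinal.mk B ≤ Cardinal.lift.{u + 1} κ) :
    Cardinal.mk (A × B) ≤ Cardinal.lift.{u + 1} κ := by
  rw [← Cardinal.mul_def]
  exact (mul_le_mul' hA hB).trans (Cardinal.mul_eq_self (Cardinal.aleph0_le_lift.2
    (Fact.out : κ.IsInaccessible).aleph0_lt.le)).le

theorem mk_union_le {B : Type (u + 1)} {X Y : Set B}
    (hX : Cardinal.mk X ≤ Cardinal.lift.{u + 1} κ) (hY : Cardinal.mk Y ≤ Cardinal.lift.{u + 1} κ) :
    Cardinal.mk ↥(X ∪ Y) ≤ Cardinal.lift.{u + 1} κ :=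
  (Cardinal.mk_union_le X Y).trans ((add_le_add hX hY).trans
    (Cardinal.add_eq_self (Cardinal.aleph0_le_lift.2
      (Fact.out : κ.IsInaccessible).aleph0_lt.le)).le)

theorem mk_Iio_ord_le : Cardinal.mk (Iio κ.ord) ≤ Cardinal.lift.{u + 1} κ := by
  rw [Cardinal.mk_Iio_ordinal, Cardinal.card_ord]

/-- A set of size at most `κ` can be indexed by the ordinals below `κ`. -/
theorem exists_index {B : Type (u + 1)} [Nonempty B] {X : Set B}
    (hX : Cardinal.mk X ≤ Cardinal.lift.{u + 1} κ) :
    ∃ e : B → Ordinal.{u}, (∀ x ∈ X, e x < κ.ord) ∧ InjOn e X := by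
  classical
  rw [show Cardinal.lift.{u + 1} κ = Cardinal.mk (Iio κ.ord) by
    rw [Cardinal.mk_Iio_ordinal, Cardinal.card_ord]] at hX
  obtain ⟨f⟩ := hX
  refine ⟨fun x => if h : x ∈ X then (f ⟨x, h⟩).1 else 0, fun x hx => ?_, fun x hx y hy h => ?_⟩
  · simp only [hx, dif_pos]
    exact (f ⟨x, hx⟩).2
  · simp only [hx, hy, dif_pos] at h
    exact congrArg Subtype.val (f.injective (Subtype.ext h))

/-- The closure of a family of size at most `κ` has size at most `κ`: its members are
intersections of subfamilies that are bounded in an enumeration of length `κ`, and these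
subfamilies can be represented by nodes. -/
theorem mk_interClosure_le {G : Set (Set (Node κ))}
    (hG : Cardinal.mk G ≤ Cardinal.lift.{u + 1} κ) :
    Cardinal.mk {R | InterClosure G R} ≤ Cardinal.lift.{u + 1} κ := by
  classical
  obtain ⟨e, he, hinj⟩ := exists_index hG
  let f : Node κ → Set (Node κ) := fun t =>
    {v | ∀ S ∈ G, e S < t.len → t.val (e S) = true → v ∈ S}
  refine mk_le_of_forall_exists f mk_node_le ?_
  rintro R (hR : InterClosure G R)
  induction hR with
  | base T hT =>
    refine ⟨⟨e T + 1, fun ξ => decide (ξ = e T), add_one_lt_ord (he T hT), fun ξ hξ => ?_⟩, ?_⟩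
    · have : e T < ξ := (lt_add_one _).trans_le hξ
      simp [this.ne']
    · ext v
      constructor
      · intro hv
        exact hv T hT (lt_add_one _) (by simp)
      · intro hv S hS _ h
        have h : e S = e T := by simpa using h
        rwa [hinj hS hT h]
  | inter δ T h0 hδ _ _ ih =>
    choose! t ht using ih
    obtain ⟨α, hα, hb⟩ := exists_bound_Iio (Λ := κ.ord) (δ := δ)
      (by rwa [isRegular_of_fact.cof_ord]) (fun i => (t i).len) (fun i _ => (t i).len_lt)
    refine ⟨⟨α, fun ξ => decide (∃ i < δ, ξ < (t i).len ∧ (t i).val ξ = true), hα,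
      fun ξ hξ => ?_⟩, ?_⟩
    · rw [decide_eq_false_iff_not]
      rintro ⟨i, hi, h1, _⟩
      exact absurd (h1.trans_le (hb i hi)) (not_lt.2 hξ)
    · ext v
      constructor
      · intro hv i hi
        rw [← ht i hi]
        intro S hS h1 h2
        exact hv S hS (h1.trans_le (hb i hi)) (by simpa using ⟨i, hi, h1, h2⟩)
      · intro hv S hS _ h
        obtain ⟨i, hi, h1, h2⟩ : ∃ i < δ, e S < (t i).len ∧ (t i).val (e S) = true := by
          simpa using h
        have := hv i hi
        rw [← ht i hi] at this
        exact this S hS h1 h2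

/-! ### The stages of the construction -/

/-- The requirement that the recursion imposes on `F lam`. -/
structure IsStage (D : Ordinal.{u} → Set Ordinal.{u}) (c : Coding κ)
    (F : Ordinal.{u} → Set (Set (Node κ))) (lam : Ordinal.{u}) : Prop where
  base : lam = 0 → F lam = {R | ∃ t : Node κ, R = cone univ t}
  step : ∀ α, lam = α + 1 → IsSuccStage (below F α) (F α) (F lam)
  limit_small : IsSuccLimit lam → lam.cof < κ → F lam = {R | InterClosure (below F lam) R}
  limit_big : lam.cof = κ → IsFusionStage D c F lam

/-- The stages below `Λ` satisfy the requirements of the recursion. -/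
structure IsPartial (D : Ordinal.{u} → Set Ordinal.{u}) (c : Coding κ)
    (F : Ordinal.{u} → Set (Set (Node κ))) (Λ : Ordinal.{u}) : Prop where
  le_ord : Λ ≤ (succ κ).ord
  isStage : ∀ α < Λ, IsStage D c F α

theorem isSuccLimit_of_cof_eq {lam : Ordinal.{u}} (h : lam.cof = κ) : IsSuccLimit lam := by
  rw [← Ordinal.one_lt_cof_iff, h]
  exact Cardinal.one_lt_aleph0.trans (Fact.out : κ.IsInaccessible).aleph0_lt

theorem card_le_of_lt {lam : Ordinal.{u}} (h : lam < (succ κ).ord) : lam.card ≤ κ :=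
  Order.lt_succ_iff.1 (Cardinal.lt_ord.1 h)

theorem stage_cases {lam : Ordinal.{u}} (h : lam < (succ κ).ord) :
    lam = 0 ∨ (∃ α, lam = α + 1) ∨ (IsSuccLimit lam ∧ lam.cof < κ) ∨ lam.cof = κ := by
  rcases Ordinal.zero_or_succ_or_isSuccLimit lam with h0 | ⟨α, hα⟩ | hl
  · exact Or.inl h0
  · exact Or.inr (Or.inl ⟨α, hα.symm⟩)
  · rcases ((Ordinal.cof_le_card lam).trans (card_le_of_lt h)).lt_or_eq with h1 | h1
    · exact Or.inr (Or.inr (Or.inl ⟨hl, h1⟩))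
    · exact Or.inr (Or.inr (Or.inr h1))

theorem below_mono (F : Ordinal.{u} → Set (Set (Node κ))) {α β : Ordinal.{u}} (h : α ≤ β) :
    below F α ⊆ below F β := by
  rintro T ⟨γ, hγ, hT⟩
  exact ⟨γ, hγ.trans_le h, hT⟩

/-- Cones of the full tree along a chain of nodes intersect in the cone of the union of the
chain. -/
theorem descClosed_cones : DescClosed {R : Set (Node κ) | ∃ t : Node κ, R = cone univ t} := by
  intro δ T h0 hδ hT hdesc
  choose! t ht using hT
  have hle : ∀ i < δ, ∀ j < i, t j ≤ t i := by
    intro i hi j hj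
    have hsub := hdesc i hi j hj
    rw [ht i hi, ht j (hj.trans hi)] at hsub
    rcases (hsub (mem_cone_self (mem_univ _))).2 with h | h
    · rcases h.lt_or_eq with h | h
      · exfalso
        have hl := Node.len_lt_of_lt h
        refine Node.not_comparable_of_branch (s := (t i).snoc (! (t j).val (t i).len)) (t := t j)
          (lt_add_one (t i).len) hl ?_ (hsub ⟨mem_univ _, Or.inr (Node.le_snoc _ _)⟩).2
        rw [Node.snoc_val_self]
        simp
      · exact h.ge
    · exact h
  obtain ⟨α, hα, hb⟩ := exists_bound_Iio (Λ := κ.ord) (δ := δ)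
    (by rwa [isRegular_of_fact.cof_ord]) (fun i => (t i).len) (fun i _ => (t i).len_lt)
  obtain ⟨w, hw, hw'⟩ := Node.exists_union (t '' Iio δ) (by
    rintro _ ⟨i, hi, rfl⟩ _ ⟨j, hj, rfl⟩
    rcases lt_trichotomy i j with h | rfl | h
    · exact Or.inl (hle j hj i h)
    · exact Or.inl le_rfl
    · exact Or.inr (hle i hi j h)) hα (by rintro _ ⟨i, hi, rfl⟩; exact hb i hi)
  refine ⟨w, subset_antisymm ?_ ?_⟩
  · intro v hv
    refine ⟨mem_univ _, ?_⟩
    have hv : ∀ i < δ, v ≤ t i ∨ t i ≤ v := fun i hi => by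
      have := hv i hi
      rw [ht i hi] at this
      exact this.2
    by_cases h : ∃ i < δ, v ≤ t i
    · obtain ⟨i, hi, h⟩ := h
      exact Or.inl (h.trans (hw _ ⟨i, hi, rfl⟩))
    · push Not at h
      have h : ∀ i < δ, t i ≤ v := fun i hi => (hv i hi).resolve_left (h i hi)
      refine Or.inr (Node.le_def.2 ⟨le_of_forall_lt fun ξ hξ => ?_, fun ξ hξ => ?_⟩)
      · obtain ⟨_, ⟨i, hi, rfl⟩, h1⟩ := hw' ξ hξ
        exact h1.trans_le (h i hi).1
      · obtain ⟨_, ⟨i, hi, rfl⟩, h1⟩ := hw' ξ hξ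
        rw [← (h i hi).2 ξ h1, (hw _ ⟨i, hi, rfl⟩).2 ξ h1]
  · intro v hv i hi
    rw [ht i hi]
    exact cone_anti _ (hw _ ⟨i, hi, rfl⟩) hv

namespace IsStage
variable {D : Ordinal.{u} → Set Ordinal.{u}} {c : Coding κ}
  {F : Ordinal.{u} → Set (Set (Node κ))} {lam : Ordinal.{u}}

theorem descClosed (h : IsStage D c F lam) (hlam : lam < (succ κ).ord) : DescClosed (F lam) := by
  rcases stage_cases hlam with h0 | ⟨α, hα⟩ | ⟨hl, hc⟩ | hc
  · rw [h.base h0]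
    exact descClosed_cones
  · obtain ⟨pick, -, h1⟩ := h.step α hα
    rw [h1]
    exact descClosed_interClosure _
  · rw [h.limit_small hl hc]
    exact descClosed_interClosure _
  · obtain ⟨ladder, -, s, -, h1⟩ := h.limit_big hc
    rw [h1]
    exact descClosed_interClosure _

end IsStage

namespace IsPartial
variable {D : Ordinal.{u} → Set Ordinal.{u}} {c : Coding κ}
  {F : Ordinal.{u} → Set (Set (Node κ))} {Λ : Ordinal.{u}}

theorem of_le {Λ' : Ordinal.{u}} (h : IsPartial D c F Λ) (h' : Λ' ≤ Λ) : IsPartial D c F Λ' :=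
  ⟨h'.trans h.1, fun α hα => h.2 α (hα.trans_le h')⟩

theorem descClosed (h : IsPartial D c F Λ) {β : Ordinal.{u}} (hβ : β < Λ) : DescClosed (F β) :=
  (h.isStage β hβ).descClosed (hβ.trans_le h.le_ord)

theorem mono (h : IsPartial D c F Λ) {α β : Ordinal.{u}} (hβ : β < Λ) (hαβ : α ≤ β) :
    F α ⊆ F β := by
  induction β using WellFoundedLT.induction with
  | ind β ih =>
    rcases hαβ.lt_or_eq with hlt | rfl
    · have hst := h.isStage β hβ
      rcases stage_cases (hβ.trans_le h.le_ord) with h0 | ⟨β', rfl⟩ | ⟨hl, hc⟩ | hc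
      · rw [h0] at hlt
        exact absurd hlt not_lt_zero
      · have hβ' : β' < β' + 1 := lt_add_one β'
        obtain ⟨pick, -, h1⟩ := hst.step β' rfl
        refine (ih β' hβ' (hβ'.trans hβ) (Order.lt_add_one_iff.1 hlt)).trans ?_
        rw [h1]
        exact fun T hT => InterClosure.base T (Or.inl (Or.inl hT))
      · rw [hst.limit_small hl hc]
        exact fun T hT => InterClosure.base T ⟨α, hlt, hT⟩
      · obtain ⟨ladder, -, s, -, h1⟩ := hst.limit_big hc
        rw [h1]
        exact fun T hT => InterClosure.base T (Or.inl ⟨α, hlt, hT⟩)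
    · exact subset_rfl

theorem descClosed_below (h : IsPartial D c F Λ) {lam : Ordinal.{u}} (hlam : lam ≤ Λ)
    (hc : κ ≤ lam.cof) : DescClosed (below F lam) := by
  intro δ T h0 hδ hT hdesc
  choose! α hα hα' using hT
  obtain ⟨β, hβ, hb⟩ := exists_bound_Iio (Λ := lam) (δ := δ)
    (hδ.trans_le (Cardinal.ord_le_ord.2 hc)) α hα
  exact ⟨β, hβ, h.descClosed (hβ.trans_le hlam) δ T h0 hδ
    (fun i hi => h.mono (hβ.trans_le hlam) (hb i hi) (hα' i hi)) hdesc⟩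

/-- Every tree of the construction is in `𝕊^club`, and every stage is closed under cones; for the
copies, a cone of `σ⁻¹[S]` is `σ⁻¹` of a cone of `S`. -/
theorem isClubTree_and_coneClosed (h : IsPartial D c F Λ) {β : Ordinal.{u}} (hβ : β < Λ) :
    (∀ T ∈ F β, IsClubTree T) ∧ ConeClosed (F β) := by
  induction β using WellFoundedLT.induction with
  | ind β ih =>
    have hst := h.isStage β hβ
    have hbel : (∀ T ∈ below F β, IsClubTree T) ∧ ConeClosed (below F β) := by
      refine ⟨?_, ?_⟩
      · rintro T ⟨α, hα, hT⟩
        exact (ih α hα (hα.trans hβ)).1 T hT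
      · rintro T ⟨α, hα, hT⟩ t ht
        exact ⟨α, hα, (ih α hα (hα.trans hβ)).2 T hT t ht⟩
    rcases stage_cases (hβ.trans_le h.le_ord) with h0 | ⟨β', rfl⟩ | ⟨hl, hc⟩ | hc
    · rw [hst.base h0]
      refine ⟨?_, ?_⟩
      · rintro _ ⟨t, rfl⟩
        exact isClubTree_univ.cone (mem_univ t)
      · rintro _ ⟨t, rfl⟩ s hs
        rcases hs.2 with h1 | h1
        · exact ⟨t, cone_cone_of_ge _ h1⟩
        · exact ⟨s, cone_cone_of_le _ h1⟩
    · have hβ' : β' < β' + 1 := lt_add_one β'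
      obtain ⟨hcl, hco⟩ := ih β' hβ' (hβ'.trans hβ)
      obtain ⟨pick, hpick, h1⟩ := hst.step β' rfl
      rw [h1]
      have hH : (∀ T ∈ succPicks (F β') (below F β') pick, IsClubTree T) ∧
          ConeClosed (succPicks (F β') (below F β') pick) := by
        refine ⟨?_, ?_⟩
        · rintro T (hT | ⟨S, hS, γ, hγ, t, ht, rfl⟩)
          · exact hcl T hT
          · exact (hpick S hS γ hγ).1.cone ht
        · rintro T (hT | ⟨S, hS, γ, hγ, t, ht, rfl⟩) s hs
          · exact Or.inl (hco T hT s hs)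
          · rcases hs.2 with h2 | h2
            · exact Or.inr ⟨S, hS, γ, hγ, t, ht, cone_cone_of_ge _ h2⟩
            · exact Or.inr ⟨S, hS, γ, hγ, s, hs.1, cone_cone_of_le _ h2⟩
      refine ⟨fun T hT => InterClosure.isClubTree ?_ hT, fun T hT => InterClosure.cone ?_ hT⟩
      · rintro T (hT | ⟨T, hT, S, hS, rfl⟩)
        · exact hH.1 T hT
        · exact isClubTree_collapsePreimage (hH.1 T hT.1) (hH.1 S hS)
      · rintro T (hT | ⟨T, hT, S, hS, rfl⟩) t ht
        · exact InterClosure.base _ (Or.inl (hH.2 T hT t ht))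
        · rw [cone_collapsePreimage (hH.1 T hT.1) ht]
          exact InterClosure.base _ (Or.inr ⟨T, hT, _, hH.2 S hS _
            ((hH.1 T hT.1).mem_collapsePreimage.1 ht).2, rfl⟩)
    · rw [hst.limit_small hl hc]
      exact ⟨fun T hT => InterClosure.isClubTree hbel.1 hT, fun T hT =>
        InterClosure.cone (fun T hT t ht => InterClosure.base _ (hbel.2 T hT t ht)) hT⟩
    · obtain ⟨ladder, -, s, hs, h1⟩ := hst.limit_big hc
      rw [h1]
      refine ⟨fun T hT => InterClosure.isClubTree ?_ hT, fun T hT => InterClosure.cone ?_ hT⟩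
      · rintro T (hT | ⟨T, hT, γ, hγ, t, ht, rfl⟩)
        · exact hbel.1 T hT
        · have hf := (hs T hT γ hγ).1
          exact (IsFusionSeq.isClubTree_fusionLimit ⟨hf.isClubTree, hf.leRank⟩ hγ).cone ht
      · rintro T (hT | ⟨T, hT, γ, hγ, t, ht, rfl⟩) r hr
        · exact InterClosure.base _ (Or.inl (hbel.2 T hT r hr))
        · rcases hr.2 with h2 | h2
          · exact InterClosure.base _ (Or.inr ⟨T, hT, γ, hγ, t, ht, cone_cone_of_ge _ h2⟩)
          · exact InterClosure.base _ (Or.inr ⟨T, hT, γ, hγ, r, hr.1, cone_cone_of_le _ h2⟩)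

theorem isClubTree (h : IsPartial D c F Λ) {β : Ordinal.{u}} (hβ : β < Λ) {T : Set (Node κ)}
    (hT : T ∈ F β) : IsClubTree T := (h.isClubTree_and_coneClosed hβ).1 T hT

theorem coneClosed (h : IsPartial D c F Λ) {β : Ordinal.{u}} (hβ : β < Λ) : ConeClosed (F β) :=
  (h.isClubTree_and_coneClosed hβ).2

theorem isClubTree_below (h : IsPartial D c F Λ) {T : Set (Node κ)}
    (hT : T ∈ below F Λ) : IsClubTree T := by
  obtain ⟨α, hα, hT⟩ := hT
  exact h.isClubTree hα hT

theorem coneClosed_below (h : IsPartial D c F Λ) : ConeClosed (below F Λ) := by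
  rintro T ⟨α, hα, hT⟩ t ht
  exact ⟨α, hα, h.coneClosed hα T hT t ht⟩

/-- Having rank at least `ε` means not having appeared at stage `ε`. -/
theorem le_treeRank_iff (h : IsPartial D c F Λ) (hΛ : IsSuccLimit Λ) {T : Set (Node κ)}
    (hT : T ∈ below F Λ) {ε : Ordinal.{u}} : ε ≤ treeRank F T ↔ ∀ α < ε, T ∉ F (α + 1) := by
  constructor
  · intro h1 α hα hT'
    exact absurd (hα.trans_le h1) (not_lt.2 (csInf_le' hT'))
  · intro h1
    obtain ⟨α, hα, hT⟩ := hT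
    by_contra hlt
    exact h1 _ (not_le.1 hlt) (csInf_mem (s := {α | T ∈ F (α + 1)})
      ⟨α, h.mono (hΛ.succ_lt hα) (lt_add_one α).le hT⟩)

/-- The limit of a fusion sequence contains no tree from an earlier stage `α`: below a node on a
preserved splitting level of a late term, such a tree would be contained in a tree of rank above
`α`. -/
theorem not_subset_fusionLimit (h : IsPartial D c F Λ) (hΛ : IsSuccLimit Λ) {α : Ordinal.{u}}
    (hα : α < Λ) (hstar : ∀ S ∈ below F Λ, S ∈ F α ∨ ∀ R ∈ F α, ¬ R ⊆ S)
    {ladder : Ordinal.{u} → Ordinal.{u}} (hlad : IsLadder κ Λ ladder) {T : Set (Node κ)}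
    {γ : Ordinal.{u}} (hγ : γ < κ.ord) {s : Ordinal.{u} → Set (Node κ)}
    (hf : IsFusion F Λ ladder T γ s) {R : Set (Node κ)} (hR : R ∈ F α) :
    ¬ R ⊆ fusionLimit s := by
  intro hsub
  obtain ⟨i, hi, hi'⟩ := hlad.2.2 _ (hΛ.succ_lt hα)
  obtain ⟨r, hr, hrl⟩ := (h.isClubTree hα hR).isPruned.exists_len
    ((hf.isClubTree i hi).levEnum_lt (add_lt_ord hγ hi))
  have hrs : r ∈ s i := hsub hr i hi
  obtain ⟨hmem, hrank⟩ := hf.cone_mem i hi r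
    (((hf.isClubTree i hi).mem_splitRank (add_lt_ord hγ hi)).2 ⟨hrs, hrl⟩)
  rw [h.le_treeRank_iff hΛ hmem] at hrank
  have h2 := (hstar _ hmem).resolve_left fun h3 =>
    hrank α ((lt_succ α).trans_le hi') (h.mono (hΛ.succ_lt hα) (lt_succ α).le h3)
  exact h2 _ (h.coneClosed hα R hR r hr) (cone_mono (fun v hv => hsub hv i hi) r)

/-- A tree that first appears after stage `α` contains no tree from stage `α`. At successor steps this is
demanded of the chosen trees, at fusion steps it is `not_subset_fusionLimit`, and closing the family
preserves it since it passes to subtrees. -/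
theorem mem_or_not_subset (h : IsPartial D c F Λ) {α β : Ordinal.{u}} (hβ : β < Λ) (hαβ : α ≤ β)
    {S : Set (Node κ)} (hS : S ∈ F β) : S ∈ F α ∨ ∀ R ∈ F α, ¬ R ⊆ S := by
  induction β using WellFoundedLT.induction generalizing S with
  | ind β ih =>
    rcases hαβ.lt_or_eq with hlt | rfl
    swap
    · exact Or.inl hS
    have hst := h.isStage β hβ
    have hp : ∀ S R : Set (Node κ), (∀ Q ∈ F α, ¬ Q ⊆ S) → R ⊆ S → ∀ Q ∈ F α, ¬ Q ⊆ R :=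
      fun S R h1 h2 Q hQ h3 => h1 Q hQ (h3.trans h2)
    have hbel : ∀ S ∈ below F β, S ∈ F α ∨ ∀ R ∈ F α, ¬ R ⊆ S := by
      rintro S ⟨γ, hγ, hS⟩
      rcases le_total γ α with h1 | h1
      · exact Or.inl (h.mono (hlt.trans hβ) h1 hS)
      · exact ih γ hγ (hγ.trans hβ) h1 hS
    have hα := h.descClosed (hlt.trans hβ)
    rcases stage_cases (hβ.trans_le h.le_ord) with h0 | ⟨β', rfl⟩ | ⟨hl, hc⟩ | hc
    · rw [h0] at hlt
      exact absurd hlt not_lt_zero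
    · have hβ' : β' < β' + 1 := lt_add_one β'
      have hαβ' := Order.lt_add_one_iff.1 hlt
      obtain ⟨pick, hpick, h1⟩ := hst.step β' rfl
      rw [h1] at hS
      have hnew : ∀ T ∈ succPicks (F β') (below F β') pick, T ∉ F β' → ∀ R ∈ F α, ¬ R ⊆ T := by
        rintro T (hT | ⟨S, hS, γ, hγ, t, ht, rfl⟩) hT' R hR hsub
        · exact hT' hT
        · exact (hpick S hS γ hγ).2.2 R (h.mono (hβ'.trans hβ) hαβ' hR)
            (hsub.trans (cone_subset _ _))
      refine InterClosure.mem_or hα hp ?_ hS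
      rintro T (hT | ⟨T, hT, S, hS, rfl⟩)
      · by_cases hT' : T ∈ F β'
        · exact hbel T ⟨β', hβ', hT'⟩
        · exact Or.inr (hnew T hT hT')
      · exact Or.inr (hp T _ (hnew T hT.1 hT.2) fun v hv => hv.1)
    · rw [hst.limit_small hl hc] at hS
      exact InterClosure.mem_or hα hp hbel hS
    · obtain ⟨ladder, hlad, s, hs, h1⟩ := hst.limit_big hc
      rw [h1] at hS
      refine InterClosure.mem_or hα hp ?_ hS
      rintro S (hS | ⟨T, hT, γ, hγ, t, ht, rfl⟩)
      · exact hbel S hS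
      · right
        intro R hR hsub
        exact (h.of_le hβ.le).not_subset_fusionLimit (isSuccLimit_of_cof_eq hc) hlt hbel hlad hγ
          (hs T hT γ hγ).1 hR (hsub.trans (cone_subset _ _))

/-- Subtrees appear no earlier. -/
theorem notMem_of_subset (h : IsPartial D c F Λ) {α : Ordinal.{u}} (hα : α < Λ)
    {S R : Set (Node κ)} (hS : S ∈ below F Λ) (hS' : S ∉ F α) (hsub : R ⊆ S) : R ∉ F α := by
  obtain ⟨β, hβ, hS⟩ := hS
  rcases le_total α β with h1 | h1
  · exact fun hR => (h.mem_or_not_subset hβ h1 hS).resolve_left hS' R hR hsub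
  · exact absurd (h.mono hα h1 hS) hS'

/-- Every stage has at most `κ` elements. -/
theorem mk_le (h : IsPartial D c F Λ) {β : Ordinal.{u}} (hβ : β < Λ) :
    Cardinal.mk (F β) ≤ Cardinal.lift.{u + 1} κ := by
  induction β using WellFoundedLT.induction with
  | ind β ih =>
    have hst := h.isStage β hβ
    have hbel : Cardinal.mk (below F β) ≤ Cardinal.lift.{u + 1} κ := by
      have : below F β = ⋃ α : Iio β, F α.1 := by
        ext T
        simp [below]
      rw [this]
      refine (Cardinal.mk_iUnion_le_sum_mk).trans ?_
      refine (Cardinal.sum_le_sum _ (fun _ => Cardinal.lift.{u + 1} κ)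
        fun α : Iio β => ih α.1 α.2 (lt_trans α.2 hβ)).trans ?_
      rw [Cardinal.sum_const']
      refine (mul_le_mul' ?_ le_rfl).trans (Cardinal.mul_eq_self (Cardinal.aleph0_le_lift.2
        (Fact.out : κ.IsInaccessible).aleph0_lt.le)).le
      rw [Cardinal.mk_Iio_ordinal, Cardinal.lift_le]
      exact card_le_of_lt (hβ.trans_le h.le_ord)
    rcases stage_cases (hβ.trans_le h.le_ord) with h0 | ⟨β', rfl⟩ | ⟨hl, hc⟩ | hc
    · rw [hst.base h0]
      refine mk_le_of_forall_exists (fun t => cone univ t) mk_node_le ?_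
      rintro _ ⟨t, rfl⟩
      exact ⟨t, rfl⟩
    · have hβ' : β' < β' + 1 := lt_add_one β'
      obtain ⟨pick, -, h1⟩ := hst.step β' rfl
      have hG := ih β' hβ' (hβ'.trans hβ)
      have hH : Cardinal.mk (succPicks (F β') (below F β') pick) ≤ Cardinal.lift.{u + 1} κ := by
        refine mk_union_le hG (mk_le_of_forall_exists
          (fun x : (F β' × Iio κ.ord) × Node κ => cone (pick x.1.1.1 x.1.2.1) x.2)
          (mk_prod_le (mk_prod_le hG mk_Iio_ord_le) mk_node_le) ?_)
        rintro _ ⟨T, hT, γ, hγ, t, _, rfl⟩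
        exact ⟨((⟨T, hT.1⟩, ⟨γ, hγ⟩), t), rfl⟩
      rw [h1]
      refine mk_interClosure_le (mk_union_le hH (mk_le_of_forall_exists
          (fun x : succPicks (F β') (below F β') pick × succPicks (F β') (below F β') pick =>
            collapsePreimage x.1.1 x.2.1) (mk_prod_le hH hH) ?_))
      rintro _ ⟨T, hT, S, hS, rfl⟩
      exact ⟨(⟨T, hT.1⟩, ⟨S, hS⟩), rfl⟩
    · rw [hst.limit_small hl hc]
      exact mk_interClosure_le hbel
    · obtain ⟨ladder, -, s, -, h1⟩ := hst.limit_big hc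
      rw [h1]
      refine mk_interClosure_le (mk_union_le hbel (mk_le_of_forall_exists
          (fun x : (below F β × Iio κ.ord) × Node κ =>
            cone (fusionLimit (s x.1.1.1 x.1.2.1)) x.2)
          (mk_prod_le (mk_prod_le hbel mk_Iio_ord_le) mk_node_le) ?_))
      rintro _ ⟨T, hT, γ, hγ, t, _, rfl⟩
      exact ⟨((⟨T, hT⟩, ⟨γ, hγ⟩), t), rfl⟩

end IsPartial

/-! ### The successor step -/

theorem IsClubTree.exists_cone_eq_self {T : Set (Node κ)} (hT : IsClubTree T) :
    ∃ t ∈ T, TreeForcing.cone T t = T := by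
  obtain ⟨t, ht⟩ := hT.nonempty
  refine ⟨t.res 0, hT.isPruned.root_mem t, cone_eq_self_of_forall fun s hs => Or.inr ?_⟩
  exact Node.le_def.2 ⟨by simp [Node.res_len], fun ξ hξ => by simp [Node.res_len] at hξ⟩

/-- The limit points below `κ` of the splitting levels of `T`. -/
def levLimits (T : Set (Node κ)) : Set Ordinal.{u} :=
  {α | α < κ.ord ∧ α ≠ 0 ∧ ∀ β < α, ∃ γ ∈ lev T, β < γ ∧ γ < α}

theorem IsClubTree.mem_lev_of_mem_levLimits {T : Set (Node κ)} (hT : IsClubTree T)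
    {α : Ordinal.{u}} (h : α ∈ levLimits T) : α ∈ lev T :=
  hT.isClubIn_lev.closed α h.1 h.2.1 h.2.2

theorem IsClubTree.levEnum_succ_notMem_levLimits {T : Set (Node κ)} (hT : IsClubTree T)
    (β : Ordinal.{u}) : levEnum T (β + 1) ∉ levLimits T := by
  intro h
  obtain ⟨γ, hγ, h1, h2⟩ := h.2.2 (levEnum T β) (levEnum_strictMono T (lt_add_one β))
  obtain ⟨ξ, -, rfl⟩ := hT.exists_levEnum hγ
  rw [(levEnum_strictMono T).lt_iff_lt] at h1 h2
  exact absurd h1 (not_lt.2 (Order.lt_add_one_iff.1 h2))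

theorem aleph0_lt_cof_ord : Cardinal.aleph0 < κ.ord.cof := by
  rw [isRegular_of_fact.cof_ord]
  exact (Fact.out : κ.IsInaccessible).aleph0_lt

/-- At most `κ` trees of `𝕊^club` have a common pseudointersection of their splitting levels: a
diagonal intersection of the sets of limits of splitting levels. -/
theorem exists_pseudointersection {G : Set (Set (Node κ))} (hclub : ∀ T ∈ G, IsClubTree T)
    {e : Set (Node κ) → Ordinal.{u}} (hinj : InjOn e G) :
    ∃ E, IsClubIn κ.ord E ∧ ∀ T ∈ G, ∀ α ∈ E, e T < α → α ∈ levLimits T := by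
  refine ⟨{α | α < κ.ord ∧ ∀ T ∈ G, e T < α → α ∈ levLimits T},
    ⟨fun α hα => hα.1, fun α₀ hα₀ => ?_, fun α hα h0 hlim => ⟨hα, fun T hT hlt => ?_⟩⟩,
    fun T hT α hα hlt => hα.2 T hT hlt⟩
  · have step : ∀ a < κ.ord, ∃ b < κ.ord, a < b ∧
        ∀ T ∈ G, e T < a → ∃ γ ∈ lev T, a < γ ∧ γ < b := by
      intro a ha
      have hX : Cardinal.mk {T : Set (Node κ) | T ∈ G ∧ e T < a} <
          Cardinal.lift.{u + 1} κ.ord.cof := by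
        rw [isRegular_of_fact.cof_ord]
        refine lt_of_le_of_lt (Cardinal.mk_le_of_injective
          (f := fun T : {T : Set (Node κ) | T ∈ G ∧ e T < a} => (⟨e T.1, T.2.2⟩ : Iio a)) ?_)
          (mk_Iio_lt ha)
        intro T T' h
        exact Subtype.ext (hinj T.2.1 T'.2.1 (congrArg Subtype.val h))
      choose! g hg hg' using fun (T : Set (Node κ)) (hT : T ∈ G) =>
        (hclub T hT).isClubIn_lev.unbounded a ha
      obtain ⟨b, hb, hb'⟩ := exists_bound hX (fun T => g T.1)
        (fun T => (hclub _ T.2.1).isClubIn_lev.lt _ (hg _ T.2.1))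
      refine ⟨max a b + 1, add_one_lt_ord (max_lt ha hb),
        (le_max_left a b).trans_lt (lt_add_one _), fun T hT hlt => ⟨g T, hg T hT, hg' T hT, ?_⟩⟩
      exact ((hb' ⟨T, hT, hlt⟩).trans (le_max_right a b)).trans_lt (lt_add_one _)
    obtain ⟨a, σ, hmono, rfl, hb', hσ, hle, hex⟩ := exists_iterate_sup aleph0_lt_cof_ord step hα₀
    refine ⟨σ, ⟨hσ, fun T hT heT => ⟨hσ, (bot_le.trans_lt (hle 0)).ne', fun β hβ => ?_⟩⟩, hle 0⟩
    obtain ⟨n, hn⟩ := hex _ heT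
    obtain ⟨m, hm⟩ := hex β hβ
    obtain ⟨γ, hγ, h1, h2⟩ := hb' (max n m) T hT
      (hn.trans_le (hmono.monotone (le_max_left n m)))
    refine ⟨γ, hγ, (hm.trans_le (hmono.monotone (le_max_right n m))).trans h1, h2.trans (hle _)⟩
  · refine ⟨hα, h0, fun β hβ => ?_⟩
    obtain ⟨γ, hγ, h1, h2⟩ := hlim (max β (e T)) (max_lt hβ hlt)
    obtain ⟨γ', hγ', h3, h4⟩ := (hγ.2 T hT ((le_max_right _ _).trans_lt h1)).2.2 β
      ((le_max_left _ _).trans_lt h1)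
    exact ⟨γ', hγ', h3, h4.trans h2⟩

/-- The choice in the successor step: `T` has a subtree `T' ≤_γ T` whose splitting levels
eventually are those in `E`, and that contains no member of `G`. One thins `T` out; at the levels
`levEnum T (γ + e S + 1)`, which are not limits and thus not in `E`, the directions are chosen so
that they disagree with a branch through `S`. -/
theorem exists_pick {G : Set (Set (Node κ))} (hclub : ∀ T ∈ G, IsClubTree T)
    {e : Set (Node κ) → Ordinal.{u}} (he : ∀ T ∈ G, e T < κ.ord) (hinj : InjOn e G)
    {E : Set Ordinal.{u}} (hE : IsClubIn κ.ord E)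
    (hE' : ∀ T ∈ G, ∀ α ∈ E, e T < α → α ∈ levLimits T) {T : Set (Node κ)} (hT : T ∈ G)
    {γ : Ordinal.{u}} (hγ : γ < κ.ord) :
    ∃ T', IsClubTree T' ∧ LeRank γ T' T ∧ (∀ S ∈ G, ¬ S ⊆ T') ∧
      ∃ ε < κ.ord, lev T' ∩ Ioi ε = E ∩ Ioi ε := by
  classical
  have hTc := hclub T hT
  set d := levEnum T γ with hd
  have hdκ : d < κ.ord := hTc.levEnum_lt hγ
  set ε := max (e T) d with hε
  have hεκ : ε < κ.ord := max_lt (he T hT) hdκ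
  -- the splitting levels to be kept
  set K : Set Ordinal.{u} := lev T ∩ Iic d ∪ E ∩ Ioi ε with hK
  have hEL : ∀ α ∈ E, ε < α → α ∈ levLimits T := fun α hα h =>
    hE' T hT α hα ((le_max_left _ _).trans_lt h)
  have hKlev : K ⊆ lev T := by
    rintro α (hα | hα)
    · exact hα.1
    · exact hTc.mem_lev_of_mem_levLimits (hEL α hα.1 hα.2)
  have hKclub : IsClubIn κ.ord K := by
    refine ⟨fun α hα => hTc.isClubIn_lev.lt α (hKlev hα), fun α hα => ?_, fun α hα h0 h => ?_⟩
    · obtain ⟨β, hβ, h⟩ := hE.unbounded (max α ε) (max_lt hα hεκ)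
      exact ⟨β, Or.inr ⟨hβ, (le_max_right _ _).trans_lt h⟩, (le_max_left _ _).trans_lt h⟩
    · rcases le_or_gt α d with h1 | h1
      · refine Or.inl ⟨hTc.isClubIn_lev.closed α hα h0 fun β hβ => ?_, h1⟩
        obtain ⟨δ, hδ, h2⟩ := h β hβ
        exact ⟨δ, hKlev hδ, h2⟩
      · have key : ∀ β < α, ∃ δ ∈ E ∩ Ioi ε, β < δ ∧ δ < α := by
          intro β hβ
          obtain ⟨δ, hδ, h2, h3⟩ := h (max β d) (max_lt hβ h1)
          exact ⟨δ, hδ.resolve_left fun h4 => absurd ((le_max_right _ _).trans_lt h2)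
            (not_lt.2 h4.2), (le_max_left _ _).trans_lt h2, h3⟩
        obtain ⟨δ, hδ, -, h2⟩ := key d h1
        refine Or.inr ⟨hE.closed α hα h0 fun β hβ => ?_, lt_trans hδ.2 h2⟩
        obtain ⟨δ, hδ, h3⟩ := key β hβ
        exact ⟨δ, hδ.1, h3⟩
  let a : Set (Node κ) → Ordinal.{u} := fun S => levEnum T (γ + e S + 1)
  have ha : ∀ S ∈ G, a S < κ.ord := fun S hS =>
    hTc.levEnum_lt (add_one_lt_ord (add_lt_ord hγ (he S hS)))
  have hainj : ∀ S ∈ G, ∀ S' ∈ G, a S = a S' → S = S' := fun S hS S' hS' h => by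
    have h1 : γ + e S + 1 = γ + e S' + 1 := (levEnum_strictMono T).injective h
    exact hinj hS hS' (add_left_cancel (Order.succ_injective h1))
  have haK : ∀ S, a S ∉ K := by
    rintro S (h | h)
    · exact absurd h.2 (not_le.2 (levEnum_strictMono T
        ((le_add_right le_rfl : γ ≤ γ + e S).trans_lt (lt_add_one _))))
    · exact hTc.levEnum_succ_notMem_levLimits _ (hEL _ h.1 h.2)
  choose! w hw hwl using fun (S : Set (Node κ)) (hS : S ∈ G) =>
    (hclub S hS).isPruned.exists_len (add_one_lt_ord (ha S hS))
  -- the directions at the dropped levels, which at level `a S` avoid the branch `w S` of `S`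
  let x : Ordinal.{u} → Bool := fun α =>
    if h : ∃ S ∈ G, a S = α then ! (w h.choose).val α else false
  have hx : ∀ S ∈ G, x (a S) = ! (w S).val (a S) := by
    intro S hS
    have h : ∃ S' ∈ G, a S' = a S := ⟨S, hS, rfl⟩
    have h1 : h.choose = S := hainj _ h.choose_spec.1 _ hS h.choose_spec.2
    change (if h : ∃ S' ∈ G, a S' = a S then ! (w h.choose).val (a S) else false) = _
    rw [dif_pos h, h1]
  have hT' := isClubTree_thin hTc hKclub hKlev x
  refine ⟨thin T K x, hT', leRank_of_agree hγ hT' hTc (fun t ht => ht.1) ?_, ?_, ε, hεκ, ?_⟩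
  · intro t ht hl
    refine ⟨ht, fun α hα h1 h2 => absurd (Or.inl ⟨h1, ?_⟩) h2⟩
    exact Order.lt_add_one_iff.1 (hα.trans_le hl)
  · intro S hS hsub
    have h1 := (hsub (hw S hS)).2 (a S) (by rw [hwl S hS]; exact lt_add_one _)
      (hTc.levEnum_mem (add_one_lt_ord (add_lt_ord hγ (he S hS)))) (haK S)
    rw [hx S hS] at h1
    simp at h1
  · rw [lev_thin hTc hKclub hKlev]
    ext α
    constructor
    · rintro ⟨h1 | h1, h2⟩
      · exact absurd (lt_of_le_of_lt (le_max_right (e T) d) h2) (not_lt.2 h1.2)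
      · exact h1
    · intro h
      exact ⟨Or.inr h, h.2⟩

/-- The trees in `G` but not in `Glt` have subtrees in `G'` that contain no member of `G`, and
whose splitting levels agree from some point on with a set that does not depend on the tree. -/
def SyncStep (Glt G G' : Set (Set (Node κ))) : Prop :=
  ∃ E : Set Ordinal.{u}, ∀ T ∈ G \ Glt, ∃ T' ∈ G', T' ⊆ T ∧ (∀ S ∈ G, ¬ S ⊆ T') ∧
    ∃ ε < κ.ord, lev T' ∩ Ioi ε = E ∩ Ioi ε

theorem exists_succStage {Glt G : Set (Set (Node κ))} (hclub : ∀ T ∈ G, IsClubTree T)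
    (hG : Cardinal.mk G ≤ Cardinal.lift.{u + 1} κ) :
    ∃ G', IsSuccStage Glt G G' ∧ SyncStep Glt G G' := by
  obtain ⟨e, he, hinj⟩ := exists_index hG
  obtain ⟨E, hE, hE'⟩ := exists_pseudointersection hclub hinj
  choose! pick h1 h2 h3 h4 using fun (T : Set (Node κ)) (hT : T ∈ G) (γ : Ordinal.{u})
    (hγ : γ < κ.ord) => exists_pick hclub he hinj hE hE' hT hγ
  refine ⟨_, ⟨pick, fun T hT γ hγ => ⟨h1 T hT.1 γ hγ, h2 T hT.1 γ hγ, h3 T hT.1 γ hγ⟩, rfl⟩,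
    E, fun T hT => ⟨pick T 0, ?_, (h2 T hT.1 0 zero_lt_ord).1, h3 T hT.1 0 zero_lt_ord,
      h4 T hT.1 0 zero_lt_ord⟩⟩
  obtain ⟨t, ht, heq⟩ := (h1 T hT.1 0 zero_lt_ord).exists_cone_eq_self
  exact InterClosure.base _ (Or.inl (Or.inr ⟨T, hT, 0, zero_lt_ord, t, ht, heq.symm⟩))

/-! ### Shrinking trees to later stages -/

/-- An increasing cofinal sequence of length `cf lam`. -/
theorem exists_strictMonoOn_cofinal (lam : Ordinal.{u}) :
    ∃ g : Ordinal.{u} → Ordinal.{u}, StrictMonoOn g (Iio lam.cof.ord) ∧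
      (∀ i < lam.cof.ord, g i < lam) ∧ ∀ β < lam, ∃ i < lam.cof.ord, β ≤ g i := by
  classical
  obtain ⟨f, hf⟩ := Ordinal.exists_isFundamentalSeq (o := lam) rfl
  have hg : ∀ i (hi : i < lam.cof.ord),
      (if h : i < lam.cof.ord then (f ⟨i, h⟩).1 else 0) = (f ⟨i, hi⟩).1 := fun i hi => dif_pos hi
  refine ⟨fun i => if h : i < lam.cof.ord then (f ⟨i, h⟩).1 else 0, fun i hi j hj hij => ?_,
    fun i hi => ?_, fun β hβ => ?_⟩
  · simp only [hg i hi, hg j hj]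
    exact hf.strictMono (show (⟨i, hi⟩ : Iio lam.cof.ord) < ⟨j, hj⟩ from hij)
  · simp only [hg i hi]
    exact (f ⟨i, hi⟩).2
  · obtain ⟨_, ⟨i, rfl⟩, h⟩ := hf.isCofinal_range ⟨β, hβ⟩
    refine ⟨i.1, i.2, ?_⟩
    simp only [hg i.1 i.2]
    exact h

/-- An increasing cofinal sequence that is continuous in the sense that every ordinal below a term is
below a term with successor index. -/
theorem exists_isLadder {lam : Ordinal.{u}} (hc : lam.cof = κ) :
    ∃ ladder, IsLadder κ lam ladder ∧
      ∀ i < κ.ord, ∀ α < ladder i, ∃ j < i, α < ladder (j + 1) := by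
  obtain ⟨g, hmono, hlt, hcof⟩ := exists_strictMonoOn_cofinal lam
  rw [hc] at hmono hlt hcof
  let ladder : Ordinal.{u} → Ordinal.{u} := fun i => sSup ((fun j => g j + 1) '' Iio i)
  have h1 : ∀ i, ∀ j < i, g j + 1 ≤ ladder i := fun i j hj =>
    le_csSup Ordinal.bddAbove_of_small ⟨j, hj, rfl⟩
  have h2 : ∀ i < κ.ord, ladder i ≤ g i := fun i hi => csSup_le' (by
    rintro _ ⟨j, hj, rfl⟩
    exact Order.add_one_le_of_lt (hmono (lt_trans hj hi) hi hj))
  have h3 : ∀ i, ∀ α < ladder i, ∃ j < i, α < g j + 1 := by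
    intro i α hα
    by_contra hcon
    push Not at hcon
    exact absurd hα (not_lt.2 (csSup_le' (by rintro _ ⟨j, hj, rfl⟩; exact hcon j hj)))
  refine ⟨ladder, ⟨fun j hj i hi hji => ?_, fun i hi => (h2 i hi).trans_lt (hlt i hi),
    fun β hβ => ?_⟩, fun i hi α hα => ?_⟩
  · exact ((h2 j hj).trans_lt (lt_add_one _)).trans_le (h1 i j hji)
  · obtain ⟨i, hi, h⟩ := hcof β hβ
    exact ⟨i + 1, add_one_lt_ord hi, (h.trans (lt_add_one _).le).trans (h1 _ i (lt_add_one i))⟩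
  · obtain ⟨j, hj, h⟩ := h3 i α hα
    exact ⟨j, hj, h.trans_le (h1 _ j (lt_add_one j))⟩

namespace IsPartial
variable {D : Ordinal.{u} → Set Ordinal.{u}} {c : Coding κ}
  {F : Ordinal.{u} → Set (Set (Node κ))} {Λ : Ordinal.{u}}

/-- Below every tree of a stage there is a tree that appears exactly at that stage: a chosen tree at
successor steps, the intersection of trees from cofinally many stages at limits of small cofinality,
and the limit of a fusion sequence at limits of cofinality `κ`. -/
theorem exists_subset_notMem_below (h : IsPartial D c F Λ) {β : Ordinal.{u}} (hβ : β < Λ)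
    {T : Set (Node κ)} (hT : T ∈ F β) : ∃ T' ⊆ T, T' ∈ F β ∧ T' ∉ below F β := by
  induction β using WellFoundedLT.induction generalizing T with
  | ind β ih =>
    by_cases hTb : T ∈ below F β
    swap
    · exact ⟨T, subset_rfl, hT, hTb⟩
    obtain ⟨α, hα, hTα⟩ := hTb
    have hst := h.isStage β hβ
    rcases stage_cases (hβ.trans_le h.le_ord) with h0 | ⟨β', rfl⟩ | ⟨hl, hc⟩ | hc
    · rw [h0] at hα
      exact absurd hα not_lt_zero
    · have hβ' : β' < β' + 1 := lt_add_one β'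
      obtain ⟨T', hsub, hT', hT'b⟩ := ih β' hβ' (hβ'.trans hβ)
        (h.mono (hβ'.trans hβ) (Order.lt_add_one_iff.1 hα) hTα)
      obtain ⟨pick, hpick, h1⟩ := hst.step β' rfl
      obtain ⟨hcl, hle, hnot⟩ := hpick T' ⟨hT', hT'b⟩ 0 zero_lt_ord
      obtain ⟨t, ht, heq⟩ := hcl.exists_cone_eq_self
      refine ⟨pick T' 0, hle.1.trans hsub, ?_, ?_⟩
      · rw [h1]
        exact InterClosure.base _ (Or.inl (Or.inr
          ⟨T', ⟨hT', hT'b⟩, 0, zero_lt_ord, t, ht, heq.symm⟩))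
      · rintro ⟨ε, hε, h2⟩
        exact hnot _ (h.mono (hβ'.trans hβ) (Order.lt_add_one_iff.1 hε) h2) subset_rfl
    · obtain ⟨g, hmono, hlt, hcof⟩ := exists_strictMonoOn_cofinal β
      have hδ : β.cof.ord < κ.ord := Cardinal.ord_lt_ord.2 hc
      have hδ0 : 0 < β.cof.ord := by
        obtain ⟨i, hi, -⟩ := hcof α hα
        exact bot_le.trans_lt hi
      let P : Ordinal.{u} → (Ordinal.{u} → Ordinal.{u} × Set (Node κ)) →
          Ordinal.{u} × Set (Node κ) → Prop := fun i s y =>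
        y.2 ⊆ T ∧ y.1 < β ∧ g i < y.1 ∧ y.2 ∈ F y.1 ∧ y.2 ∉ below F y.1 ∧ ∀ j < i, y.2 ⊆ (s j).2
      obtain ⟨s, hs⟩ := exists_rec β.cof.ord (fun i s => P i s (s i)) (0, ∅) (by
          rintro i - s s' heq - ⟨h1, h2, h3, h4, h5, h6⟩
          rw [heq i le_rfl] at h1 h2 h3 h4 h5 h6
          exact ⟨h1, h2, h3, h4, h5, fun j hj => heq j hj.le ▸ h6 j hj⟩) (by
        intro i hi s hs
        have hR : ∃ η < β, ∃ R ∈ F η, R ⊆ T ∧ ∀ j < i, R ⊆ (s j).2 := by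
          rcases eq_or_ne i 0 with rfl | hi0
          · exact ⟨α, hα, T, hTα, subset_rfl, fun j hj => absurd hj not_lt_zero⟩
          · have hi0 : 0 < i := bot_lt_iff_ne_bot.2 hi0
            obtain ⟨η, hη, hb⟩ := exists_bound_Iio (Λ := β) hi (fun j => (s j).1)
              fun j hj => (hs j hj).2.1
            exact ⟨η, hη, {t | ∀ j < i, t ∈ (s j).2}, h.descClosed (hη.trans hβ) i _ hi0
              (hi.trans hδ) (fun j hj => h.mono (hη.trans hβ) (hb j hj) (hs j hj).2.2.2.1)
              (fun j hj k hk => (hs j hj).2.2.2.2.2 k hk),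
              fun t ht => (hs 0 hi0).1 (ht 0 hi0), fun j hj t ht => ht j hj⟩
        obtain ⟨η, hη, R, hR, hRT, hRs⟩ := hR
        have hm : max η (g i + 1) < β := max_lt hη (hl.add_one_lt (hlt i hi))
        obtain ⟨R', hR'R, hR', hR'b⟩ := ih _ hm (hm.trans hβ)
          (h.mono (hm.trans hβ) (le_max_left _ _) hR)
        refine ⟨(max η (g i + 1), R'), ?_⟩
        simp only [Function.update_self]
        refine ⟨hR'R.trans hRT, hm, (lt_add_one _).trans_le (le_max_right _ _), hR', hR'b,
          fun j hj => ?_⟩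
        rw [Function.update_of_ne hj.ne]
        exact hR'R.trans (hRs j hj))
      refine ⟨{t | ∀ i < β.cof.ord, t ∈ (s i).2}, fun t ht => (hs 0 hδ0).1 (ht 0 hδ0), ?_, ?_⟩
      · exact h.descClosed hβ _ _ hδ0 hδ (fun i hi => h.mono hβ (hs i hi).2.1.le
          (hs i hi).2.2.2.1) (fun i hi j hj => (hs i hi).2.2.2.2.2 j hj)
      · -- the intersection is contained in trees that appear arbitrarily late below `β`
        rintro ⟨ε, hε, h1⟩
        obtain ⟨i, hi, h2⟩ := hcof ε hε
        obtain ⟨-, h3, h4, h5, h6, -⟩ := hs i hi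
        refine h.notMem_of_subset (R := {t | ∀ i < β.cof.ord, t ∈ (s i).2}) (hε.trans hβ)
          ⟨_, h3.trans hβ, h5⟩ (fun h7 => h6 ⟨ε, ?_, h7⟩) (fun t ht => ht i hi) h1
        exact h2.trans_lt h4
    · obtain ⟨ladder, hlad, s, hs, h1⟩ := hst.limit_big hc
      have hf := (hs T ⟨α, hα, hTα⟩ 0 zero_lt_ord).1
      have hcl : IsClubTree (fusionLimit (s T 0)) :=
        IsFusionSeq.isClubTree_fusionLimit ⟨hf.isClubTree, hf.leRank⟩ zero_lt_ord
      obtain ⟨t, ht, heq⟩ := hcl.exists_cone_eq_self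
      refine ⟨fusionLimit (s T 0), fun v hv => hf.zero ▸ hv 0 zero_lt_ord, ?_, ?_⟩
      · rw [h1]
        exact InterClosure.base _ (Or.inr ⟨T, ⟨α, hα, hTα⟩, 0, zero_lt_ord, t, ht, heq.symm⟩)
      · rintro ⟨ε, hε, h2⟩
        refine (h.of_le hβ.le).not_subset_fusionLimit (isSuccLimit_of_cof_eq hc) hε ?_ hlad
          zero_lt_ord hf h2 subset_rfl
        rintro S ⟨η, hη, hS⟩
        rcases le_total η ε with h3 | h3
        · exact Or.inl (h.mono (hε.trans hβ) h3 hS)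
        · exact h.mem_or_not_subset (hη.trans hβ) h3 hS

end IsPartial

/-! ### The fusion step -/

/-- The trees in `F_{<lam}` of rank at least `ε` that are contained in members of all the antichains
in `𝒜`. -/
def lateBelow (F : Ordinal.{u} → Set (Set (Node κ))) (lam ε : Ordinal.{u})
    (𝒜 : Set (Set (Set (Node κ)))) : Set (Set (Node κ)) :=
  {S ∈ below F lam | (∀ α < ε, S ∉ F (α + 1)) ∧ ∀ A ∈ 𝒜, ∃ S' ∈ A, S ⊆ S'}

namespace IsPartial
variable {D : Ordinal.{u} → Set Ordinal.{u}} {c : Coding κ}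
  {F : Ordinal.{u} → Set (Set (Node κ))} {lam : Ordinal.{u}}

/-- Fewer than `κ` trees can be shrunk to trees of high rank below a maximal antichain so that the
splitting levels agree: move all of them to the same stage `β`, apply `SyncStep` there, and discard
an initial segment. -/
theorem syncDense (h : IsPartial D c F lam) (hc : lam.cof = κ)
    (hsync : ∀ β, β + 1 < lam → SyncStep (below F β) (F β) (F (β + 1)))
    {ε : Ordinal.{u}} (hε : ε < lam) {𝒜 : Set (Set (Set (Node κ)))} (h𝒜 : 𝒜.Subsingleton)
    (hmax : ∀ A ∈ 𝒜, IsMaxAntichain (below F lam) A) :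
    SyncDense (below F lam) (lateBelow F lam ε 𝒜) := by
  intro N R hN hR
  have hl : IsSuccLimit lam := isSuccLimit_of_cof_eq hc
  have h1 : ∀ w ∈ N, ∃ R₁ ⊆ R w, R₁ ∈ below F lam ∧ ∀ A ∈ 𝒜, ∃ S ∈ A, R₁ ⊆ S := by
    intro w hw
    rcases h𝒜.eq_empty_or_singleton with h0 | ⟨A, h0⟩
    · exact ⟨R w, subset_rfl, hR w hw, fun A hA => by rw [h0] at hA; exact absurd hA (notMem_empty A)⟩
    · obtain ⟨S, hS, R₁, hR₁, h2, h3⟩ := (hmax A (h0 ▸ mem_singleton A)).2.2 _ (hR w hw)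
      refine ⟨R₁, h3, hR₁, fun A' hA' => ?_⟩
      rw [h0, mem_singleton_iff] at hA'
      exact ⟨S, hA' ▸ hS, h2⟩
  choose! R₁ hsub₁ hmem₁ hA using h1
  choose! a ha hmem₁ using hmem₁
  obtain ⟨β₀, hβ₀, hb⟩ := exists_bound (Λ := lam) (X := N) (by rwa [hc]) (fun w => a w.1)
    (fun w => ha w.1 w.2)
  have hβ : max β₀ ε < lam := max_lt hβ₀ hε
  have hβ1 : max β₀ ε + 1 < lam := hl.add_one_lt hβ
  generalize hβeq : max β₀ ε = β at hβ hβ1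
  have hεβ : ε ≤ β := hβeq ▸ le_max_right _ _
  have hβ₀β : β₀ ≤ β := hβeq ▸ le_max_left _ _
  choose! R₂ hsub₂ hmem₂ hnot₂ using fun w (hw : w ∈ N) =>
    h.exists_subset_notMem_below hβ (h.mono hβ ((hb ⟨w, hw⟩).trans hβ₀β) (hmem₁ w hw))
  obtain ⟨E, hE⟩ := hsync β hβ1
  choose! R₃ hmem₃ hsub₃ hnot₃ e he hlev using fun w (hw : w ∈ N) =>
    hE (R₂ w) ⟨hmem₂ w hw, hnot₂ w hw⟩
  obtain ⟨η, hη, hbη⟩ := exists_bound (Λ := κ.ord) (X := N)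
    (by rwa [isRegular_of_fact.cof_ord]) (fun w => e w.1) (fun w => he w.1 w.2)
  choose! t ht htl using fun w (hw : w ∈ N) =>
    (h.isClubTree hβ1 (hmem₃ w hw)).isPruned.exists_len (add_one_lt_ord hη)
  refine ⟨fun w => cone (R₃ w) (t w), E ∩ Ioi η, fun w hw => ?_⟩
  have hsub : cone (R₃ w) (t w) ⊆ R₁ w :=
    (cone_subset _ _).trans ((hsub₃ w hw).trans (hsub₂ w hw))
  have hmem : cone (R₃ w) (t w) ∈ below F lam :=
    ⟨β + 1, hβ1, h.coneClosed hβ1 _ (hmem₃ w hw) _ (ht w hw)⟩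
  refine ⟨hmem, ⟨hmem, fun α hα hmem => ?_, ?_⟩,
    hsub.trans (hsub₁ w hw), ?_⟩
  · exact hnot₃ w hw _ (h.mono hβ ((Order.add_one_le_of_lt hα).trans hεβ) hmem) (cone_subset _ _)
  · intro A hA'
    obtain ⟨S, hS, h2⟩ := hA w hw A hA'
    exact ⟨S, hS, hsub.trans h2⟩
  · rw [(h.isClubTree hβ1 (hmem₃ w hw)).lev_cone (ht w hw), htl w hw]
    ext ξ
    have hξ : e w < ξ → (ξ ∈ lev (R₃ w) ↔ ξ ∈ E) := fun h2 => by
      have h3 := Set.ext_iff.1 (hlev w hw) ξ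
      simpa [h2] using h3
    constructor
    · rintro ⟨h2, h3⟩
      have h3 : η < ξ := (lt_add_one η).trans_le h3
      exact ⟨(hξ ((hbη ⟨w, hw⟩).trans_lt h3)).1 h2, h3⟩
    · rintro ⟨h2, h3⟩
      exact ⟨(hξ ((hbη ⟨w, hw⟩).trans_lt h3)).2 h2, mem_Ici.2 (Order.add_one_le_of_lt h3)⟩

end IsPartial

theorem codeSet_injective (c : Coding κ) : Function.Injective (codeSet c) := by
  have key : ∀ A A', codeSet c A = codeSet c A' → A ⊆ A' := by
    intro A A' h S hS
    have h1 : (c (Sum.inl S)).1 ∈ codeSet c A' := h ▸ ⟨S, hS, rfl⟩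
    obtain ⟨S', hS', h2⟩ := h1
    have h3 : S = S' := by simpa using c.injective (Subtype.ext h2)
    exact h3 ▸ hS'
  exact fun A A' h => (key _ _ h).antisymm (key _ _ h.symm)

theorem codeMatrix_injective (c : Coding κ) : Function.Injective (codeMatrix c) := by
  have key : ∀ A A', codeMatrix c A = codeMatrix c A' → ∀ i j, A i j ⊆ A' i j := by
    intro A A' h i j S hS
    have h1 : (c (Sum.inr (S, i, j))).1 ∈ codeMatrix c A' := h ▸ ⟨i, j, S, hS, rfl⟩
    obtain ⟨i', j', S', hS', h2⟩ := h1
    have h3 := c.injective (Subtype.ext h2)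
    simp only [Sum.inr.injEq, Prod.mk.injEq] at h3
    obtain ⟨rfl, rfl, rfl⟩ := h3
    exact hS'
  exact fun A A' h => funext fun i => funext fun j =>
    (key _ _ h i j).antisymm (key _ _ h.symm i j)

theorem codeSet_ne_codeMatrix (c : Coding κ) {A : Set (Set (Node κ))} (hA : A.Nonempty)
    (M : Iio κ.ord → Iio κ.ord → Set (Set (Node κ))) : codeSet c A ≠ codeMatrix c M := by
  intro h
  obtain ⟨S, hS⟩ := hA
  have h1 : (c (Sum.inl S)).1 ∈ codeMatrix c M := h ▸ ⟨S, hS, rfl⟩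
  obtain ⟨i, j, S', -, h2⟩ := h1
  have h3 := c.injective (Subtype.ext h2)
  simp at h3

theorem IsMaxAntichain.nonempty {G A : Set (Set (Node κ))} (hA : IsMaxAntichain G A)
    (hG : G.Nonempty) : A.Nonempty := by
  obtain ⟨T, hT⟩ := hG
  obtain ⟨S, hS, -⟩ := hA.2.2 T hT
  exact ⟨S, hS⟩

/-- The maximal antichains in `G` that have to be hit in step `i` of a fusion if `X` is guessed. -/
def guessedAntichains (c : Coding κ) (G : Set (Set (Node κ))) (X : Set Ordinal.{u})
    (i : Ordinal.{u}) : Set (Set (Set (Node κ))) :=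
  {A | IsMaxAntichain G A ∧ ((i = 0 ∧ X = codeSet c A) ∨
    ∃ M, X = codeMatrix c M ∧ ∃ i' : Iio κ.ord, i'.1 = i ∧ A = ⋃ j, M i' j)}

/-- The guess `X` codes at most one antichain or matrix, as codings are injective and the code of a
nonempty set is not the code of a matrix. -/
theorem subsingleton_guessedAntichains (c : Coding κ) {G : Set (Set (Node κ))}
    (hG : G.Nonempty) (X : Set Ordinal.{u}) (i : Ordinal.{u}) :
    (guessedAntichains c G X i).Subsingleton := by
  rintro A ⟨hA, ⟨-, h⟩ | ⟨M, h, k, hk, hk'⟩⟩ A' ⟨hA', ⟨-, h'⟩ | ⟨M', h', k', hl, hl'⟩⟩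
  · exact codeSet_injective c (h.symm.trans h')
  · exact absurd (h.symm.trans h') (codeSet_ne_codeMatrix c (hA.nonempty hG) _)
  · exact absurd (h'.symm.trans h) (codeSet_ne_codeMatrix c (hA'.nonempty hG) _)
  · obtain rfl := codeMatrix_injective c (h.symm.trans h')
    obtain rfl : k = k' := Subtype.ext (hk.trans hl.symm)
    rw [hk', hl']

namespace IsPartial
variable {D : Ordinal.{u} → Set Ordinal.{u}} {c : Coding κ}
  {F : Ordinal.{u} → Set (Set (Node κ))} {lam : Ordinal.{u}}

/-- The sequences required at a fusion step exist. At limit terms the lower bound on the ranks is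
inherited from the earlier terms, as `ladder` is continuous. -/
theorem exists_fusion (h : IsPartial D c F lam) (hc : lam.cof = κ)
    (hsync : ∀ β, β + 1 < lam → SyncStep (below F β) (F β) (F (β + 1)))
    {ladder : Ordinal.{u} → Ordinal.{u}} (hlad : IsLadder κ lam ladder)
    (hcont : ∀ i < κ.ord, ∀ α < ladder i, ∃ j < i, α < ladder (j + 1))
    {T : Set (Node κ)} (hT : T ∈ below F lam) {γ : Ordinal.{u}} (hγ : γ < κ.ord) :
    ∃ s, IsFusion F lam ladder T γ s ∧
      (∀ A, IsMaxAntichain (below F lam) A → D lam = codeSet c A → HitsAt A γ s 0) ∧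
      (∀ A, IsAntichainMatrix (below F lam) A → D lam = codeMatrix c A →
        ∀ i : Iio κ.ord, HitsAt (⋃ j, A i j) γ s i.1) := by
  have hl : IsSuccLimit lam := isSuccLimit_of_cof_eq hc
  let 𝒜 := guessedAntichains c (below F lam) (D lam)
  obtain ⟨s, hs, h0, hmem⟩ := exists_fusionSeq (E := fun i => lateBelow F lam (ladder (i + 1)) (𝒜 i))
    (fun T hT => h.isClubTree_below hT) h.coneClosed_below (h.descClosed_below le_rfl hc.ge)
    (fun i hi S hS R hR hRS => by
      obtain ⟨hSm, h1, h2⟩ := hS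
      refine ⟨hR, fun α hα => ?_, fun A hA => ?_⟩
      · exact h.notMem_of_subset (hl.add_one_lt (hα.trans (hlad.2.1 _ (add_one_lt_ord hi))))
          hSm (h1 α hα) hRS
      · obtain ⟨S', hS', h3⟩ := h2 A hA
        exact ⟨S', hS', hRS.trans h3⟩)
    (fun i hi => h.syncDense hc hsync (hlad.2.1 _ (add_one_lt_ord hi))
      (subsingleton_guessedAntichains c ⟨T, hT⟩ _ _) fun A hA => hA.1) hT hγ
  have hhit : ∀ i < κ.ord, ∀ A ∈ 𝒜 i, HitsAt A γ s i := fun i hi A hA t ht =>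
    ((hmem _ (add_one_lt_ord hi) t ht).2 i rfl).2.2 A hA
  refine ⟨s, ⟨hs.isClubTree, h0, hs.leRank, fun i hi t ht => ⟨(hmem i hi t ht).1, ?_⟩⟩,
    fun A hA hD => hhit 0 zero_lt_ord A ⟨hA, Or.inl ⟨rfl, hD⟩⟩,
    fun A hA hD i => hhit i.1 i.2 _ ⟨(hA i).1, Or.inr ⟨A, hD, i, rfl, rfl⟩⟩⟩
  rw [h.le_treeRank_iff hl (hmem i hi t ht).1]
  intro α hα
  obtain ⟨j, hj, hαj⟩ := hcont i hi α hα
  have hj1 : j + 1 ≤ i := Order.add_one_le_of_lt hj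
  have hj1κ := hj1.trans_lt hi
  rw [(hs.isClubTree i hi).mem_splitRank (add_lt_ord hγ hi)] at ht
  have hle : fusionLev γ s (j + 1) ≤ fusionLev γ s i := by
    rcases hj1.lt_or_eq with h1 | h1
    · exact (hs.fusionLev_strictMono hγ le_rfl hi h1).le
    · rw [h1]
  have hsub : s i ⊆ s (j + 1) := by
    rcases hj1.lt_or_eq with h1 | h1
    · exact hs.desc i hi _ h1
    · rw [h1]
  have hmem' := hmem _ hj1κ (t.res (fusionLev γ s (j + 1)))
    (((hs.isClubTree _ hj1κ).mem_splitRank (add_lt_ord hγ hj1κ)).2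
      ⟨(hs.isClubTree _ hj1κ).isLowerSet (Node.res_le _ _) (hsub ht.1),
        Node.res_len_of_le (hle.trans_eq ht.2.symm)⟩)
  exact h.notMem_of_subset (hl.add_one_lt (hα.trans (hlad.2.1 i hi))) hmem'.1
    ((hmem'.2 j rfl).2.1 α hαj) ((cone_mono hsub t).trans (cone_anti _ (Node.res_le _ _)))

end IsPartial

/-! ### Carrying out the recursion -/

theorem below_congr {F F' : Ordinal.{u} → Set (Set (Node κ))} {lam : Ordinal.{u}}
    (h : ∀ β < lam, F β = F' β) : below F lam = below F' lam := by
  ext T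
  constructor
  · rintro ⟨α, hα, hT⟩
    exact ⟨α, hα, h α hα ▸ hT⟩
  · rintro ⟨α, hα, hT⟩
    exact ⟨α, hα, h α hα ▸ hT⟩

section
variable {D : Ordinal.{u} → Set Ordinal.{u}} {c : Coding κ}
  {F F' : Ordinal.{u} → Set (Set (Node κ))} {lam : Ordinal.{u}}

/-- Being a fusion sequence only depends on the stages below `lam`. -/
theorem IsFusion.congr (h' : IsPartial D c F' lam) (hl : IsSuccLimit lam)
    (heq : ∀ β < lam, F β = F' β) {ladder : Ordinal.{u} → Ordinal.{u}} {T : Set (Node κ)}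
    {γ : Ordinal.{u}} {s : Ordinal.{u} → Set (Node κ)} (hf : IsFusion F lam ladder T γ s) :
    IsFusion F' lam ladder T γ s := by
  refine ⟨hf.isClubTree, hf.zero, hf.leRank, fun i hi t ht => ?_⟩
  obtain ⟨h1, h2⟩ := hf.cone_mem i hi t ht
  rw [below_congr heq] at h1
  refine ⟨h1, (h'.le_treeRank_iff hl h1).2 fun α hα hmem => ?_⟩
  obtain ⟨β, hβ, h3⟩ := h1
  -- the two ranks are computed from stages below `lam`
  rcases lt_or_ge (α + 1) lam with h4 | h4
  · exact absurd (hα.trans_le h2) (not_lt.2 (csInf_le' (by rwa [mem_ofPred_eq, heq _ h4])))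
  · have h5 : lam ≤ α := hl.le_iff_forall_le.2 fun b hb =>
      (Order.lt_add_one_iff.1 (hb.trans_le h4))
    refine absurd (hβ.trans_le (h5.trans (hα.le.trans h2))) (not_lt.2 (csInf_le' ?_))
    rw [mem_ofPred_eq, heq _ (hl.add_one_lt hβ)]
    exact h'.mono (hl.add_one_lt hβ) (lt_add_one β).le h3

theorem IsStage.congr (h' : IsPartial D c F' lam) (heq : ∀ β ≤ lam, F β = F' β)
    (hst : IsStage D c F lam) : IsStage D c F' lam := by
  have heq' : ∀ β < lam, F β = F' β := fun β hβ => heq β hβ.le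
  refine ⟨fun h0 => ?_, fun α hα => ?_, fun hl hc => ?_, fun hc => ?_⟩
  · rw [← heq lam le_rfl, hst.base h0]
  · have h1 : α < lam := hα ▸ lt_add_one α
    rw [← heq lam le_rfl, ← heq' α h1, ← below_congr fun β hβ => heq' β (hβ.trans h1)]
    exact hst.step α hα
  · rw [← heq lam le_rfl, ← below_congr heq', hst.limit_small hl hc]
  · obtain ⟨ladder, hlad, s, hs, h1⟩ := hst.limit_big hc
    refine ⟨ladder, hlad, s, ?_, ?_⟩
    · rw [← below_congr heq']
      exact fun T hT γ hγ => ⟨(hs T hT γ hγ).1.congr h' (isSuccLimit_of_cof_eq hc) heq',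
        (hs T hT γ hγ).2⟩
    · rw [← heq lam le_rfl, ← below_congr heq', h1]

theorem IsPartial.congr (heq : ∀ β < lam, F β = F' β) (h : IsPartial D c F lam) :
    IsPartial D c F' lam := by
  refine ⟨h.le_ord, fun α hα => ?_⟩
  induction α using WellFoundedLT.induction with
  | ind α ih =>
    exact (h.isStage α hα).congr ⟨hα.le.trans h.le_ord, fun β hβ => ih β hβ (hβ.trans hα)⟩
      fun β hβ => heq β (hβ.trans_lt hα)

/-- One step of the recursion. The successor stages are chosen such that `SyncStep` holds. -/
theorem exists_isStage (h : IsPartial D c F lam) (hlam : lam < (succ κ).ord)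
    (hsync : ∀ β, β + 1 < lam → SyncStep (below F β) (F β) (F (β + 1))) :
    ∃ G, ∀ F', (∀ β < lam, F' β = F β) → F' lam = G →
      IsStage D c F' lam ∧ ∀ β, lam = β + 1 → SyncStep (below F β) (F β) G := by
  have hκ0 : κ ≠ 0 := (Cardinal.aleph0_pos.trans (Fact.out : κ.IsInaccessible).aleph0_lt).ne'
  have hκ1 : κ ≠ 1 := (Cardinal.one_lt_aleph0.trans (Fact.out : κ.IsInaccessible).aleph0_lt).ne'
  rcases stage_cases hlam with rfl | ⟨β, rfl⟩ | ⟨hl, hc⟩ | hc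
  · refine ⟨{R | ∃ t : Node κ, R = cone univ t}, fun F' _ hG => ⟨⟨fun _ => hG, fun α hα => ?_,
      fun hl => ?_, fun hc => ?_⟩, fun α hα => ?_⟩⟩
    · exact absurd hα.symm (Order.succ_ne_bot α)
    · exact absurd hl.bot_lt (lt_irrefl _)
    · rw [Ordinal.cof_zero] at hc
      exact absurd hc.symm hκ0
    · exact absurd hα.symm (Order.succ_ne_bot α)
  · have hβ := lt_add_one β
    obtain ⟨G, hG, hs⟩ := exists_succStage (Glt := below F β) (fun T hT => h.isClubTree hβ hT)
      (h.mk_le hβ)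
    refine ⟨G, fun F' heq hG' => ⟨⟨fun h0 => ?_, fun α hα => ?_,
      fun hl => ?_, fun hc => ?_⟩, fun α hα => ?_⟩⟩
    · exact absurd h0 (Order.succ_ne_bot β)
    · obtain rfl : β = α := Order.succ_injective hα
      rwa [hG', heq β hβ, below_congr fun α hα => heq α (hα.trans hβ)]
    · exact absurd hl (Order.not_isSuccLimit_succ β)
    · exact absurd (isSuccLimit_of_cof_eq hc) (Order.not_isSuccLimit_succ β)
    · obtain rfl : β = α := Order.succ_injective hα
      exact hs
  · refine ⟨{R | InterClosure (below F lam) R}, fun F' heq hG => ⟨⟨fun h0 => ?_, fun α hα => ?_,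
      fun _ _ => by rw [hG, below_congr heq], fun hc' => absurd hc' hc.ne⟩, fun α hα => ?_⟩⟩
    · exact absurd h0 hl.bot_lt.ne'
    · exact absurd (hα ▸ hl : IsSuccLimit (α + 1)) (Order.not_isSuccLimit_succ α)
    · exact absurd (hα ▸ hl : IsSuccLimit (α + 1)) (Order.not_isSuccLimit_succ α)
  · have hl : IsSuccLimit lam := isSuccLimit_of_cof_eq hc
    obtain ⟨ladder, hlad, hcont⟩ := exists_isLadder hc
    choose! s hs using fun T (hT : T ∈ below F lam) γ (hγ : γ < κ.ord) =>
      h.exists_fusion hc hsync hlad hcont hT hγ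
    refine ⟨{R | InterClosure (below F lam ∪ {R | ∃ T ∈ below F lam, ∃ γ < κ.ord,
      ∃ t ∈ fusionLimit (s T γ), R = cone (fusionLimit (s T γ)) t}) R},
      fun F' heq hG => ⟨⟨fun h0 => ?_, fun α hα => ?_,
      fun _ hc' => absurd hc hc'.ne, fun _ => ⟨ladder, hlad, s, ?_, ?_⟩⟩, fun α hα => ?_⟩⟩
    · exact absurd h0 hl.bot_lt.ne'
    · exact absurd (hα ▸ hl : IsSuccLimit (α + 1)) (Order.not_isSuccLimit_succ α)
    · have heq' : ∀ β < lam, F β = F' β := fun β hβ => (heq β hβ).symm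
      rw [← below_congr heq']
      exact fun T hT γ hγ => ⟨(hs T hT γ hγ).1.congr (h.congr heq') hl heq', (hs T hT γ hγ).2⟩
    · rw [hG, below_congr heq]
    · exact absurd (hα ▸ hl : IsSuccLimit (α + 1)) (Order.not_isSuccLimit_succ α)

end

/-- The recursion can be carried out: the statement kept by induction includes `SyncStep` for the
successor stages, which makes the fusion steps possible. -/
theorem exists_isConstruction (D : Ordinal.{u} → Set Ordinal.{u}) (c : Coding κ) :
    ∃ F, IsConstruction D c F := by
  let Q : Ordinal.{u} → (Ordinal.{u} → Set (Set (Node κ))) → Prop := fun lam F =>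
    IsStage D c F lam ∧ ∀ β, lam = β + 1 → SyncStep (below F β) (F β) (F lam)
  have hpart : ∀ lam ≤ (succ κ).ord, ∀ F, (∀ β < lam, Q β F) → IsPartial D c F lam :=
    fun lam hlam F hF => ⟨hlam, fun β hβ => (hF β hβ).1⟩
  obtain ⟨F, hF⟩ := exists_rec (succ κ).ord Q ∅ (by
      rintro lam hlam F F' heq hF' ⟨h1, h2⟩
      refine ⟨h1.congr (hpart lam hlam.le F' hF') heq, fun β hβ => ?_⟩
      have hβ' : β < lam := hβ ▸ lt_add_one β
      rw [← heq lam le_rfl, ← heq β hβ'.le, ← below_congr fun α hα => heq α (hα.trans hβ').le]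
      exact h2 β hβ) (by
    intro lam hlam F hF
    obtain ⟨G, hG⟩ := exists_isStage (hpart lam hlam.le F hF) hlam
      fun β hβ => (hF _ hβ).2 β rfl
    have heq : ∀ β < lam, Function.update F lam G β = F β := fun β hβ =>
      Function.update_of_ne hβ.ne _ _
    obtain ⟨h1, h2⟩ := hG _ heq (Function.update_self _ _ _)
    refine ⟨G, h1, fun β hβ => ?_⟩
    have hβ' : β < lam := hβ ▸ lt_add_one β
    rw [Function.update_self, heq β hβ', below_congr fun α hα => heq α (hα.trans hβ')]
    exact h2 β hβ)
  have hlim : ∀ lam < (succ κ).ord, lam + 1 < (succ κ).ord := fun lam hlam =>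
    (Cardinal.isSuccLimit_ord ((Fact.out : κ.IsInaccessible).aleph0_lt.le.trans
      (le_succ κ))).add_one_lt hlam
  exact ⟨F, (hF 0 (bot_le.trans_lt (hlim 0 (by
      rw [Cardinal.lt_ord]; simp)))).1.base rfl,
    fun lam hlam => (hF _ (hlim lam hlam)).1.step lam rfl,
    fun lam hlam => (hF lam hlam).1.limit_small, fun lam hlam => (hF lam hlam).1.limit_big⟩

theorem IsConstruction.isPartial {D : Ordinal.{u} → Set Ordinal.{u}} {c : Coding κ}
    {F : Ordinal.{u} → Set (Set (Node κ))} (h : IsConstruction D c F) :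
    IsPartial D c F (succ κ).ord := by
  refine ⟨le_rfl, fun lam hlam => ⟨?_, ?_, h.limit_small lam hlam, h.limit_big lam hlam⟩⟩
  · rintro rfl
    exact h.base
  · rintro α rfl
    exact h.step α ((lt_add_one α).trans hlam)

/-! ### Guessing -/

theorem isRegular_succ_of_fact : (succ κ).IsRegular :=
  Cardinal.isRegular_succ (Fact.out : κ.IsInaccessible).aleph0_lt.le

theorem cof_ord_succ : (succ κ).ord.cof = succ κ := isRegular_succ_of_fact.cof_ord

theorem isSuccLimit_ord_succ : IsSuccLimit (succ κ).ord :=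
  Cardinal.isSuccLimit_ord isRegular_succ_of_fact.aleph0_le

theorem zero_lt_ord_succ : 0 < (succ κ).ord := isSuccLimit_ord_succ.bot_lt

/-- Families of at most `κ` ordinals below `κ⁺` are bounded below `κ⁺`. -/
theorem exists_bound_succ {X : Type (u + 1)} (hX : Cardinal.mk X ≤ Cardinal.lift.{u + 1} κ)
    (f : X → Ordinal.{u}) (hf : ∀ x, f x < (succ κ).ord) : ∃ β < (succ κ).ord, ∀ x, f x ≤ β := by
  refine exists_bound (hX.trans_lt ?_) f hf
  rw [cof_ord_succ, Cardinal.lift_lt]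
  exact lt_succ κ

theorem isClubIn_closed_under {f : Ordinal.{u} → Ordinal.{u}}
    (hf : ∀ α < (succ κ).ord, f α < (succ κ).ord) :
    IsClubIn (succ κ).ord {lam | lam < (succ κ).ord ∧ ∀ α < lam, f α < lam} := by
  refine ⟨fun α hα => hα.1, fun α₀ hα₀ => ?_, fun lam hlam _ h => ⟨hlam, fun α hα => ?_⟩⟩
  · have step : ∀ a < (succ κ).ord, ∃ b < (succ κ).ord, a < b ∧ ∀ α < a, f α < b := by
      intro a ha
      obtain ⟨b, hb, h⟩ := exists_bound_Iio (Λ := (succ κ).ord) (δ := a)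
        (by rwa [cof_ord_succ]) f fun i hi => hf i (hi.trans ha)
      exact ⟨max a b + 1, isSuccLimit_ord_succ.add_one_lt (max_lt ha hb),
        (le_max_left a b).trans_lt (lt_add_one _),
        fun α hα => ((h α hα).trans (le_max_right a b)).trans_lt (lt_add_one _)⟩
    obtain ⟨a, σ, -, rfl, hR, hσ, hlt, hex⟩ := exists_iterate_sup (o := (succ κ).ord)
      (by rw [cof_ord_succ]; exact (Fact.out : κ.IsInaccessible).aleph0_lt.trans (lt_succ κ))
      step hα₀
    refine ⟨σ, ⟨hσ, fun α hα => ?_⟩, hlt 0⟩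
    obtain ⟨n, hn⟩ := hex α hα
    exact (hR n α hn).trans (hlt _)
  · obtain ⟨γ, hγ, h1, h2⟩ := h α hα
    exact (hγ.2 α h1).trans h2

/-- Every `X ⊆ κ⁺` is guessed at a level that is closed under finding, for given `α`, some `β` with
`P α β`. -/
theorem IsDiamondSeq.exists_guess {D : Ordinal.{u} → Set Ordinal.{u}} (hD : IsDiamondSeq κ D)
    {X : Set Ordinal.{u}} (hX : X ⊆ Iio (succ κ).ord) {P : Ordinal.{u} → Ordinal.{u} → Prop}
    (hP : ∀ α < (succ κ).ord, ∃ β < (succ κ).ord, P α β) :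
    ∃ lam < (succ κ).ord, lam.cof = κ ∧ X ∩ Iio lam = D lam ∧ ∀ α < lam, ∃ β < lam, P α β := by
  choose! f hf hf' using hP
  obtain ⟨lam, ⟨hc, hg⟩, hlam⟩ := hD.2 X hX (isClubIn_closed_under hf).isClub
  exact ⟨lam.1, lam.2, hc, hg, fun α hα => ⟨f α, hlam.2 α hα, hf' α (hα.trans lam.2)⟩⟩

/-- Codings exist since diamond implies `2^κ = κ⁺`: a set `X ⊆ κ` can be recovered from a level
`lam ≥ κ` at which it is guessed. -/
theorem IsDiamondSeq.nonempty_coding {D : Ordinal.{u} → Set Ordinal.{u}}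
    (hD : IsDiamondSeq κ D) : Nonempty (Coding κ) := by
  have hκlt : κ.ord < (succ κ).ord := Cardinal.ord_lt_ord.2 (lt_succ κ)
  have h1 : ∀ X : Set (Iio κ.ord), ∃ lam : Iio (succ κ).ord, Subtype.val '' X = D lam.1 := by
    intro X
    have hX : ∀ ξ ∈ Subtype.val '' X, ξ < κ.ord := by
      rintro _ ⟨ξ, -, rfl⟩
      exact ξ.2
    obtain ⟨lam, hlam, hc, hg, h⟩ := hD.exists_guess (X := Subtype.val '' X)
      (fun ξ hξ => (hX ξ hξ).trans hκlt) (P := fun _ β => κ.ord ≤ β) fun _ _ => ⟨_, hκlt, le_rfl⟩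
    obtain ⟨β, hβ, h2⟩ := h 0 (isSuccLimit_of_cof_eq hc).bot_lt
    refine ⟨⟨lam, hlam⟩, ?_⟩
    rw [← hg, inter_eq_left.2]
    exact fun ξ hξ => (hX ξ hξ).trans (h2.trans_lt hβ)
  choose g hg using h1
  have hginj : Function.Injective g := fun X Y h =>
    Subtype.val_injective.image_injective (by rw [hg X, hg Y, h])
  have hμ : Cardinal.mk (Iio (succ κ).ord) = Cardinal.lift.{u + 1} (succ κ) := by
    rw [Cardinal.mk_Iio_ordinal, Cardinal.card_ord]
  have hμ0 : Cardinal.aleph0 ≤ Cardinal.lift.{u + 1} (succ κ) :=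
    Cardinal.aleph0_le_lift.2 isRegular_succ_of_fact.aleph0_le
  have hI : Cardinal.mk (Iio κ.ord) ≤ Cardinal.lift.{u + 1} (succ κ) :=
    mk_Iio_ord_le.trans (Cardinal.lift_le.2 (le_succ κ))
  have hS : Cardinal.mk (Set (Node κ)) ≤ Cardinal.lift.{u + 1} (succ κ) := by
    rw [← hμ]
    refine le_trans ?_ (Cardinal.mk_le_of_injective hginj)
    rw [Cardinal.mk_set, Cardinal.mk_set]
    refine Cardinal.power_le_power_left two_ne_zero (mk_node_le.trans_eq ?_)
    rw [Cardinal.mk_Iio_ordinal, Cardinal.card_ord]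
  have hprod : ∀ {A B : Type (u + 1)}, Cardinal.mk A ≤ Cardinal.lift.{u + 1} (succ κ) →
      Cardinal.mk B ≤ Cardinal.lift.{u + 1} (succ κ) →
      Cardinal.mk (A × B) ≤ Cardinal.lift.{u + 1} (succ κ) := fun hA hB => by
    rw [← Cardinal.mul_def]
    exact (mul_le_mul' hA hB).trans (Cardinal.mul_eq_self hμ0).le
  have := (add_le_add hS (hprod hS (hprod hI hI))).trans (Cardinal.add_eq_self hμ0).le
  rwa [← hμ, Cardinal.add_def] at this

/-! ### Reflecting antichains -/

namespace IsPartial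
variable {D : Ordinal.{u} → Set Ordinal.{u}} {c : Coding κ}
  {F : Ordinal.{u} → Set (Set (Node κ))}

/-- Given at most `κ` maximal antichains and a set `X`, there is a level `lam` at which `X` is
guessed, all the antichains reflect, and the codes below `lam` are those of trees from stages
below `lam`. -/
theorem exists_reflection (h : IsPartial D c F (succ κ).ord) (hD : IsDiamondSeq κ D)
    {B : Iio κ.ord → Set (Set (Node κ))} (hB : ∀ i, IsMaxAntichain (total F) (B i))
    {X : Set Ordinal.{u}} (hX : X ⊆ Iio (succ κ).ord) {α₀ : Ordinal.{u}}
    (hα₀ : α₀ < (succ κ).ord) :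
    ∃ lam < (succ κ).ord, lam.cof = κ ∧ X ∩ Iio lam = D lam ∧ α₀ < lam ∧
      (∀ i, IsMaxAntichain (below F lam) (B i ∩ below F lam)) ∧
      (∀ S ∈ total F, (c (Sum.inl S)).1 < lam ↔ S ∈ below F lam) ∧
      ∀ S ∈ total F, ∀ i j, (c (Sum.inr (S, i, j))).1 < lam ↔ S ∈ below F lam := by
  -- the closure properties of `lam` that are needed
  let P : Ordinal.{u} → Ordinal.{u} → Prop := fun α β =>
    α₀ ≤ β ∧
    (∀ S ∈ F α, (c (Sum.inl S)).1 ≤ β ∧ ∀ i j, (c (Sum.inr (S, i, j))).1 ≤ β) ∧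
    (∀ S ∈ total F, (c (Sum.inl S)).1 = α ∨ (∃ i j, (c (Sum.inr (S, i, j))).1 = α) → S ∈ F β) ∧
    ∀ T ∈ F α, ∀ i, ∃ S ∈ B i, ∃ R ∈ F β, S ∈ F β ∧ R ⊆ S ∧ R ⊆ T
  have hP : ∀ α < (succ κ).ord, ∃ β < (succ κ).ord, P α β := by
    intro α hα
    have hFα := h.mk_le hα
    obtain ⟨β₁, hβ₁, h1⟩ := exists_bound_succ hFα (fun S => (c (Sum.inl S.1)).1)
      (fun S => (c _).2)
    obtain ⟨β₂, hβ₂, h2⟩ := exists_bound_succ (mk_prod_le hFα (mk_prod_le mk_Iio_ord_le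
      mk_Iio_ord_le)) (fun x => (c (Sum.inr (x.1.1, x.2.1, x.2.2))).1) (fun S => (c _).2)
    obtain ⟨β₃, hβ₃, h3⟩ : ∃ β < (succ κ).ord, ∀ S ∈ total F, (c (Sum.inl S)).1 = α ∨
        (∃ i j, (c (Sum.inr (S, i, j))).1 = α) → S ∈ F β := by
      by_cases hex : ∃ S ∈ total F, (c (Sum.inl S)).1 = α ∨ ∃ i j, (c (Sum.inr (S, i, j))).1 = α
      · obtain ⟨S, ⟨β, hβ, hS⟩, hSα⟩ := hex
        refine ⟨β, hβ, fun S' _ hS'α => ?_⟩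
        have heq : S' = S := by
          rcases hSα with h4 | ⟨i, j, h4⟩ <;> rcases hS'α with h5 | ⟨i', j', h5⟩ <;>
          · have h6 := c.injective (Subtype.ext (h5.trans h4.symm))
            simp only [Sum.inl.injEq, Sum.inr.injEq, Prod.mk.injEq, reduceCtorEq] at h6 <;>
              first | exact h6 | exact h6.1
        exact heq ▸ hS
      · push Not at hex
        refine ⟨0, zero_lt_ord_succ, fun S hS hSα => ?_⟩
        rcases hSα with h4 | ⟨i, j, h4⟩
        · exact absurd h4 (hex S hS).1
        · exact absurd h4 ((hex S hS).2 i j)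
    have h4 : ∀ x : F α × Iio κ.ord, ∃ β < (succ κ).ord, ∃ S ∈ B x.2, ∃ R ∈ F β,
        S ∈ F β ∧ R ⊆ S ∧ R ⊆ x.1.1 := by
      rintro ⟨⟨T, hT⟩, i⟩
      obtain ⟨S, hS, R, ⟨β, hβ, hR⟩, h5, h6⟩ := (hB i).2.2 T ⟨α, hα, hT⟩
      obtain ⟨β', hβ', hS'⟩ := (hB i).1 hS
      have hm := max_lt hβ hβ'
      exact ⟨max β β', hm, S, hS, R, h.mono hm (le_max_left _ _) hR,
        h.mono hm (le_max_right _ _) hS', h5, h6⟩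
    choose b hb hb' using h4
    obtain ⟨β₄, hβ₄, h4⟩ := exists_bound_succ (mk_prod_le hFα mk_Iio_ord_le) b hb
    obtain ⟨μ, hm, hle⟩ : ∃ μ < (succ κ).ord, α₀ ≤ μ ∧ (β₁ ≤ μ ∧ β₂ ≤ μ) ∧ β₃ ≤ μ ∧ β₄ ≤ μ := by
      refine ⟨_, max_lt hα₀ (max_lt (max_lt hβ₁ hβ₂) (max_lt hβ₃ hβ₄)), ?_⟩
      simp only [← max_le_iff]
      exact le_rfl
    refine ⟨_, hm, hle.1, fun S hS => ⟨(h1 ⟨S, hS⟩).trans hle.2.1.1,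
      fun i j => (h2 (⟨S, hS⟩, i, j)).trans hle.2.1.2⟩,
      fun S hS hSα => h.mono hm hle.2.2.1 (h3 S hS hSα), fun T hT i => ?_⟩
    obtain ⟨S, hS, R, hR, hS', h5, h6⟩ := hb' (⟨T, hT⟩, i)
    have hle' := (h4 (⟨T, hT⟩, i)).trans hle.2.2.2
    exact ⟨S, hS, R, h.mono hm hle' hR, h.mono hm hle' hS', h5, h6⟩
  obtain ⟨lam, hlam, hc, hg, hcl⟩ := hD.exists_guess hX hP
  have htot : below F lam ⊆ total F := below_mono F hlam.le
  refine ⟨lam, hlam, hc, hg, ?_, fun i => ⟨inter_subset_right, fun S hS T hT hne hcomp => ?_,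
    fun T hT => ?_⟩, fun S hS => ⟨fun hlt => ?_, ?_⟩, fun S hS i j => ⟨fun hlt => ?_, ?_⟩⟩
  · obtain ⟨β, hβ, h1⟩ := hcl 0 (isSuccLimit_of_cof_eq hc).bot_lt
    exact h1.1.trans_lt hβ
  · obtain ⟨R, hR, h1⟩ := hcomp
    exact (hB i).2.1 S hS.1 T hT.1 hne ⟨R, htot hR, h1⟩
  · obtain ⟨α, hα, hT⟩ := hT
    obtain ⟨β, hβ, h1⟩ := hcl α hα
    obtain ⟨S, hS, R, hR, hS', h2⟩ := h1.2.2.2 T hT i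
    exact ⟨S, ⟨hS, β, hβ, hS'⟩, R, ⟨β, hβ, hR⟩, h2⟩
  · obtain ⟨β, hβ, h1⟩ := hcl _ hlt
    exact ⟨β, hβ, h1.2.2.1 S hS (Or.inl rfl)⟩
  · rintro ⟨α, hα, hS⟩
    obtain ⟨β, hβ, h1⟩ := hcl α hα
    exact (h1.2.1 S hS).1.trans_lt hβ
  · obtain ⟨β, hβ, h1⟩ := hcl _ hlt
    exact ⟨β, hβ, h1.2.2.1 S hS (Or.inr ⟨i, j, rfl⟩)⟩
  · rintro ⟨α, hα, hS⟩
    obtain ⟨β, hβ, h1⟩ := hcl α hα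
    exact ((h1.2.1 S hS).2 i j).trans_lt hβ

end IsPartial

/-- Every antichain contained in a dense set can be extended to a maximal antichain contained in
that dense set. -/
theorem exists_isMaxAntichain {G E A : Set (Set (Node κ))}
    (hE : ∀ T ∈ G, ∃ R ∈ G, R ∈ E ∧ R ⊆ T) (hAG : A ⊆ G) (hAE : A ⊆ E)
    (hA : ∀ S ∈ A, ∀ T ∈ A, S ≠ T → ¬ ∃ R ∈ G, R ⊆ S ∧ R ⊆ T) :
    ∃ A', A ⊆ A' ∧ A' ⊆ E ∧ IsMaxAntichain G A' := by
  obtain ⟨M, hAM, hM⟩ := zorn_subset_nonempty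
    {A : Set (Set (Node κ)) | A ⊆ G ∧ A ⊆ E ∧
      ∀ S ∈ A, ∀ T ∈ A, S ≠ T → ¬ ∃ R ∈ G, R ⊆ S ∧ R ⊆ T} (by
    intro C hC hchain _
    refine ⟨⋃₀ C, ⟨sUnion_subset fun A hA => (hC hA).1, sUnion_subset fun A hA => (hC hA).2.1, ?_⟩,
      fun A hA => subset_sUnion_of_mem hA⟩
    rintro S ⟨A₁, hA₁, hS⟩ T ⟨A₂, hA₂, hT⟩
    rcases hchain.total hA₁ hA₂ with h | h
    · exact (hC hA₂).2.2 S (h hS) T hT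
    · exact (hC hA₁).2.2 S hS T (h hT)) A ⟨hAG, hAE, hA⟩
  obtain ⟨hMG, hME, hMa⟩ := hM.prop
  refine ⟨M, hAM, hME, hMG, hMa, fun T hT => ?_⟩
  obtain ⟨R, hR, hRE, hRT⟩ := hE T hT
  by_contra hcon
  push Not at hcon
  have hinc : ∀ S ∈ M, ¬ ∃ Q ∈ G, Q ⊆ S ∧ Q ⊆ R := by
    rintro S hS ⟨Q, hQ, h1, h2⟩
    exact hcon S hS Q hQ h1 (h2.trans hRT)
  have hins : insert R M ∈ {A : Set (Set (Node κ)) | A ⊆ G ∧ A ⊆ E ∧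
      ∀ S ∈ A, ∀ T ∈ A, S ≠ T → ¬ ∃ R ∈ G, R ⊆ S ∧ R ⊆ T} := by
    refine ⟨insert_subset hR hMG, insert_subset hRE hME, ?_⟩
    rintro S (rfl | hS) T (rfl | hT) hne
    · exact absurd rfl hne
    · rintro ⟨Q, hQ, h1, h2⟩
      exact hinc T hT ⟨Q, hQ, h2, h1⟩
    · exact hinc S hS
    · exact hMa S hS T hT hne
  have hRM : R ∈ M := hM.le_of_ge hins (subset_insert R M) (mem_insert R M)
  exact hinc R hRM ⟨R, hR, subset_rfl, subset_rfl⟩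

/-! ### Closure, chain condition, and bounding -/

/-- The cones of `S` at the nodes of some level are contained in members of `A`. -/
def IsCovered (A : Set (Set (Node κ))) (S : Set (Node κ)) : Prop :=
  ∃ δ < κ.ord, ∀ t ∈ S, t.len = δ → ∃ Q ∈ A, cone S t ⊆ Q

theorem IsCovered.mono {A : Set (Set (Node κ))} {S R : Set (Node κ)} (hS : IsCovered A S)
    (hRS : R ⊆ S) : IsCovered A R := by
  obtain ⟨δ, hδ, h⟩ := hS
  refine ⟨δ, hδ, fun t ht htl => ?_⟩
  obtain ⟨Q, hQ, h1⟩ := h t (hRS ht) htl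
  exact ⟨Q, hQ, (cone_mono hRS t).trans h1⟩

namespace IsPartial
variable {D : Ordinal.{u} → Set Ordinal.{u}} {c : Coding κ}
  {F : Ordinal.{u} → Set (Set (Node κ))} {Λ : Ordinal.{u}}

/-- If the antichain `A` is guessed at `lam`, then all trees that appear at `lam` or later are
covered by `A`. At a later fusion step one uses that the cones of a late term of the fusion
sequence have rank at least `lam`. -/
theorem mem_or_isCovered (h : IsPartial D c F Λ) {lam : Ordinal.{u}} (hc : lam.cof = κ)
    {A : Set (Set (Node κ))} (hA : IsMaxAntichain (below F lam) A) (hg : D lam = codeSet c A)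
    {β : Ordinal.{u}} (hβ : β < Λ) (hlam : lam ≤ β) {S : Set (Node κ)} (hS : S ∈ F β) :
    S ∈ below F lam ∨ IsCovered A S := by
  have hl : IsSuccLimit lam := isSuccLimit_of_cof_eq hc
  have hp : ∀ S R : Set (Node κ), IsCovered A S → R ⊆ S → IsCovered A R :=
    fun S R h1 h2 => h1.mono h2
  induction β using WellFoundedLT.induction generalizing S with
  | ind β ih =>
    have hst := h.isStage β hβ
    have hdesc : DescClosed (below F lam) :=
      h.descClosed_below (hlam.trans hβ.le) hc.ge
    rcases hlam.lt_or_eq with hlt | rfl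
    swap
    · obtain ⟨ladder, -, s, hs, h1⟩ := hst.limit_big hc
      rw [h1] at hS
      refine InterClosure.mem_or hdesc hp ?_ hS
      rintro S (hS | ⟨T, hT, γ, hγ, t, ht, rfl⟩)
      · exact Or.inl hS
      · right
        obtain ⟨hf, hhit, -⟩ := hs T hT γ hγ
        have h1κ : (0 : Ordinal.{u}) + 1 < κ.ord := add_one_lt_ord zero_lt_ord
        have hcl := hf.isClubTree _ h1κ
        refine IsCovered.mono (S := s T γ (0 + 1)) ⟨levEnum (s T γ (0 + 1)) (γ + (0 + 1)),
          hcl.levEnum_lt (add_lt_ord hγ h1κ), fun v hv hvl => ?_⟩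
          fun v hv => hv.1 _ h1κ
        exact hhit A hA hg v ((hcl.mem_splitRank (add_lt_ord hγ h1κ)).2 ⟨hv, hvl⟩)
    have hbel : ∀ S ∈ below F β, S ∈ below F lam ∨ IsCovered A S := by
      rintro S ⟨γ, hγ, hS⟩
      rcases lt_or_ge γ lam with h1 | h1
      · exact Or.inl ⟨γ, h1, hS⟩
      · exact ih γ hγ (hγ.trans hβ) h1 hS
    rcases stage_cases (hβ.trans_le h.le_ord) with h0 | ⟨β', rfl⟩ | ⟨hl', hc'⟩ | hc'
    · rw [h0] at hlt
      exact absurd hlt not_lt_zero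
    · have hβ' : β' < β' + 1 := lt_add_one β'
      have hlam' := Order.lt_add_one_iff.1 hlt
      obtain ⟨pick, hpick, h1⟩ := hst.step β' rfl
      rw [h1] at hS
      have hnew : ∀ T ∈ succPicks (F β') (below F β') pick, T ∉ F β' → IsCovered A T := by
        rintro T (hT | ⟨S, hS, γ, hγ, t, ht, rfl⟩) hT'
        · exact absurd hT hT'
        · exact ((hbel S ⟨β', hβ', hS.1⟩).resolve_left
            fun h2 => hS.2 (below_mono F hlam' h2)).mono
            ((cone_subset _ _).trans (hpick S hS γ hγ).2.1.1)
      refine InterClosure.mem_or hdesc hp ?_ hS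
      rintro T (hT | ⟨T, hT, S, hS, rfl⟩)
      · by_cases hT' : T ∈ F β'
        · exact hbel T ⟨β', hβ', hT'⟩
        · exact Or.inr (hnew T hT hT')
      · exact Or.inr ((hnew T hT.1 hT.2).mono fun v hv => hv.1)
    · rw [hst.limit_small hl' hc'] at hS
      exact InterClosure.mem_or hdesc hp hbel hS
    · obtain ⟨ladder, hlad, s, hs, h1⟩ := hst.limit_big hc'
      rw [h1] at hS
      refine InterClosure.mem_or hdesc hp ?_ hS
      rintro S (hS | ⟨T, hT, γ, hγ, t, ht, rfl⟩)
      · exact hbel S hS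
      right
      refine IsCovered.mono ?_ (cone_subset _ _)
      have hf := (hs T hT γ hγ).1
      obtain ⟨i, hi, hi'⟩ := hlad.2.2 lam hlt
      have hcl := hf.isClubTree i hi
      have hη : levEnum (s T γ i) (γ + i) < κ.ord := hcl.levEnum_lt (add_lt_ord hγ hi)
      generalize hηeq : levEnum (s T γ i) (γ + i) = η at hη
      have hcov : ∀ w ∈ s T γ i, w.len = η → IsCovered A (cone (s T γ i) w) := by
        intro w hw hwl
        obtain ⟨hmem, hrank⟩ := hf.cone_mem i hi w
          ((hcl.mem_splitRank (add_lt_ord hγ hi)).2 ⟨hw, hwl.trans hηeq.symm⟩)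
        rw [(h.of_le hβ.le).le_treeRank_iff (isSuccLimit_of_cof_eq hc') hmem] at hrank
        refine (hbel _ hmem).resolve_left ?_
        rintro ⟨α, hα, h2⟩
        have hα1 := hl.add_one_lt hα
        exact hrank α (hα.trans_le hi')
          (h.mono ((hα1.trans hlt).trans hβ) (lt_add_one α).le h2)
      choose! δ hδ hδ' using hcov
      obtain ⟨ε, hε, hb⟩ := exists_bound (Λ := κ.ord) (X := {w | w ∈ s T γ i ∧ w.len = η})
        (by
          rw [isRegular_of_fact.cof_ord]
          exact (Cardinal.mk_le_mk_of_subset fun w hw => hw.2).trans_lt (mk_level_lt hη))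
        (fun w => δ w.1) (fun w => hδ w.1 w.2.1 w.2.2)
      refine ⟨max ε η, max_lt hε hη, fun v hv hvl => ?_⟩
      have hvi : v ∈ s T γ i := hv i hi
      have hw : v.res η ∈ s T γ i := hcl.isLowerSet (Node.res_le _ _) hvi
      have hwl : (v.res η).len = η := Node.res_len_of_le (hvl ▸ le_max_right _ _)
      have hle : δ (v.res η) ≤ v.len :=
        (hb ⟨v.res η, hw, hwl⟩).trans (hvl ▸ le_max_left _ _)
      obtain ⟨Q, hQ, h2⟩ := hδ' _ hw hwl (v.res (δ (v.res η)))
        ⟨hcl.isLowerSet (Node.res_le _ _) hvi, (le_total _ _).imp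
          (fun h3 => Node.res_mono v h3) fun h3 => Node.res_mono v h3⟩ (Node.res_len_of_le hle)
      refine ⟨Q, hQ, fun x hx => h2 ⟨⟨hx.1 i hi, ?_⟩, ?_⟩⟩
      · exact (cone_anti (fusionLimit (s T γ)) (Node.res_le v _) hx).2
      · exact (cone_anti (fusionLimit (s T γ)) (Node.res_le v _) hx).2

theorem isLtClosed (h : IsPartial D c F (succ κ).ord) : IsLtClosed κ (total F) := by
  intro δ hδ f hf
  rcases eq_or_ne δ 0 with rfl | h0
  · have h1 := (h.isStage 0 zero_lt_ord_succ).base rfl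
    obtain ⟨t⟩ := (inferInstance : Nonempty (Node κ))
    exact ⟨⟨cone univ t, 0, zero_lt_ord_succ, by rw [h1]; exact ⟨t, rfl⟩⟩,
      fun i => absurd (mem_Iio.1 i.2) not_lt_zero⟩
  · classical
    let T : Ordinal.{u} → Set (Node κ) := fun i => if hi : i < δ then (f ⟨i, hi⟩).1 else ∅
    have hT : ∀ i (hi : i < δ), T i = (f ⟨i, hi⟩).1 := fun i hi => dif_pos hi
    have hmem : {t | ∀ i < δ, t ∈ T i} ∈ total F := by
      refine h.descClosed_below le_rfl (by rw [cof_ord_succ]; exact le_succ κ) δ T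
        (bot_lt_iff_ne_bot.2 h0) hδ (fun i hi => ?_) fun i hi j hj => ?_
      · rw [hT i hi]
        exact (f ⟨i, hi⟩).2
      · rw [hT i hi, hT j (hj.trans hi)]
        exact hf (show (⟨j, hj.trans hi⟩ : Iio δ) ≤ ⟨i, hi⟩ from hj.le)
    refine ⟨⟨_, hmem⟩, fun i t ht => ?_⟩
    have := ht i.1 i.2
    rwa [hT i.1 i.2] at this

theorem compatible_iff {p q : total F} :
    Compatible p q ↔ ∃ R ∈ total F, R ⊆ p.1 ∧ R ⊆ q.1 :=
  ⟨fun ⟨r, h1, h2⟩ => ⟨r.1, r.2, h1, h2⟩, fun ⟨R, hR, h1, h2⟩ => ⟨⟨R, hR⟩, h1, h2⟩⟩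

/-- The chain condition: a maximal antichain `B` is guessed and reflects at some `lam`, and then
`B ⊆ F lam`, since a later tree in `B` would be covered by `B ∩ F_{<lam}` and thus be compatible with
an element of that set. -/
theorem hasChainCondition (h : IsPartial D c F (succ κ).ord) (hD : IsDiamondSeq κ D) :
    HasChainCondition (succ κ) (total F) := by
  intro A hA
  obtain ⟨B, hAB, -, hB⟩ := exists_isMaxAntichain (G := total F) (E := univ)
    (A := Subtype.val '' A) (fun T hT => ⟨T, hT, mem_univ T, subset_rfl⟩)
    (by rintro _ ⟨p, -, rfl⟩; exact p.2) (subset_univ _) (by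
      rintro _ ⟨p, hp, rfl⟩ _ ⟨q, hq, rfl⟩ hne hcomp
      exact hA hp hq (fun heq => hne (congrArg _ heq)) (compatible_iff.2 hcomp))
  obtain ⟨lam, hlam, hc, hg, -, hrefl, hcode, -⟩ := h.exists_reflection hD (fun _ => hB)
    (X := codeSet c B) (by rintro _ ⟨S, -, rfl⟩; exact (c _).2) zero_lt_ord_succ
  have hmax := hrefl ⟨0, zero_lt_ord⟩
  have hg' : D lam = codeSet c (B ∩ below F lam) := by
    rw [← hg]
    ext ξ
    constructor
    · rintro ⟨⟨S, hS, rfl⟩, hξ⟩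
      exact ⟨S, ⟨hS, (hcode S (hB.1 hS)).1 hξ⟩, rfl⟩
    · rintro ⟨S, hS, rfl⟩
      exact ⟨⟨S, hS.1, rfl⟩, (hcode S (hB.1 hS.1)).2 hS.2⟩
  have hsub : B ⊆ F lam := by
    intro S hS
    have hSt := hB.1 hS
    obtain ⟨β, hβ, hSβ⟩ := hSt
    rcases le_total β lam with h1 | h1
    · exact h.mono hlam h1 hSβ
    rcases h.mem_or_isCovered hc hmax hg' hβ h1 hSβ with ⟨α, hα, h2⟩ | ⟨δ, hδ, h2⟩
    · exact h.mono hlam hα.le h2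
    · obtain ⟨t, ht, htl⟩ := (h.isClubTree hβ hSβ).isPruned.exists_len hδ
      obtain ⟨Q, ⟨hQ, α, hα, hQα⟩, h3⟩ := h2 t ht htl
      have heq : S = Q := by
        by_contra hne
        exact hB.2.1 S hS Q hQ hne ⟨_, h.coneClosed_below S (hB.1 hS) t ht, cone_subset _ _, h3⟩
      exact h.mono hlam hα.le (heq ▸ hQα)
  have hle : Cardinal.mk A ≤ Cardinal.lift.{u + 1} κ :=
    (Cardinal.mk_image_eq Subtype.val_injective).symm.le.trans
      ((Cardinal.mk_le_mk_of_subset (hAB.trans hsub)).trans (h.mk_le hlam))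
  have hlt : Cardinal.mk A < Cardinal.lift.{u + 1} (succ κ) :=
    hle.trans_lt (Cardinal.lift_lt.2 (lt_succ κ))
  rwa [Cardinal.lift_id'.{u, u + 1}]

theorem forcesMem_mono {N : Name κ (total F)} {p q : total F} {i j : Iio κ.ord}
    (h : ForcesMem N p i j) (hq : q ≤ p) : ForcesMem N q i j :=
  fun r hr => h r (hr.trans hq)

/-- Bounding: for each `i < κ` take a maximal antichain of trees that decide the value of the name at
`i` or are incompatible with `p`, split it according to the decided value, and let the resulting
matrix be guessed at `lam`. In the fusion limit below `p` at `lam`, the value at `i` is decided by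
the nodes on one level, of which there are fewer than `κ`. -/
theorem isBounding (h : IsPartial D c F (succ κ).ord) (hD : IsDiamondSeq κ D) :
    IsBounding κ (total F) := by
  intro N p hp
  -- the trees that decide the value of the name at `i` or that are incompatible with `p`
  let E : Iio κ.ord → Set (Set (Node κ)) := fun i =>
    {S | ∃ hS : S ∈ total F, (∃ j, ForcesMem N ⟨S, hS⟩ i j) ∨ ¬ Compatible ⟨S, hS⟩ p}
  have hE : ∀ i, ∀ T ∈ total F, ∃ R ∈ total F, R ∈ E i ∧ R ⊆ T := by
    intro i T hT
    by_cases hcomp : Compatible ⟨T, hT⟩ p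
    · obtain ⟨r, hrT, hrp⟩ := hcomp
      obtain ⟨r', hr', j, hj⟩ := hp.1 i r hrp
      exact ⟨r'.1, r'.2, ⟨r'.2, Or.inl ⟨j, hj⟩⟩, (hr'.trans hrT : r' ≤ ⟨T, hT⟩)⟩
    · exact ⟨T, hT, ⟨hT, Or.inr hcomp⟩, subset_rfl⟩
  choose B _ hBE hB using fun i => exists_isMaxAntichain (A := ∅) (hE i) (empty_subset _)
    (empty_subset _) fun S hS => absurd hS (notMem_empty S)
  have hJ : ∀ i S, ∃ j, ∀ hS : S ∈ total F, (∃ j, ForcesMem N ⟨S, hS⟩ i j) →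
      ForcesMem N ⟨S, hS⟩ i j := by
    intro i S
    by_cases hex : ∃ hS : S ∈ total F, ∃ j, ForcesMem N ⟨S, hS⟩ i j
    · obtain ⟨hS, j, hj⟩ := hex
      exact ⟨j, fun _ _ => hj⟩
    · exact ⟨⟨0, zero_lt_ord⟩, fun hS hj => absurd ⟨hS, hj⟩ hex⟩
  choose J hJ using hJ
  let M : Iio κ.ord → Iio κ.ord → Set (Set (Node κ)) := fun i j => {S ∈ B i | J i S = j}
  obtain ⟨P, α₀, hα₀, hP⟩ := p
  obtain ⟨lam, hlam, hc, hg, hα₀lam, hrefl, -, hcode⟩ := h.exists_reflection hD hB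
    (X := codeMatrix c M) (by rintro _ ⟨i, j, S, -, rfl⟩; exact (c _).2) hα₀
  let M' : Iio κ.ord → Iio κ.ord → Set (Set (Node κ)) := fun i j => M i j ∩ below F lam
  have hg' : D lam = codeMatrix c M' := by
    rw [← hg]
    ext ξ
    constructor
    · rintro ⟨⟨i, j, S, hS, rfl⟩, hξ⟩
      exact ⟨i, j, S, ⟨hS, (hcode S ((hB i).1 hS.1) i j).1 hξ⟩, rfl⟩
    · rintro ⟨i, j, S, hS, rfl⟩
      exact ⟨⟨i, j, S, hS.1, rfl⟩, (hcode S ((hB i).1 hS.1.1) i j).2 hS.2⟩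
  have hunion : ∀ i, ⋃ j, M' i j = B i ∩ below F lam := by
    intro i
    ext S
    simp only [mem_iUnion]
    exact ⟨fun ⟨j, hS⟩ => ⟨hS.1.1, hS.2⟩, fun hS => ⟨J i S, ⟨hS.1, rfl⟩, hS.2⟩⟩
  have hM' : IsAntichainMatrix (below F lam) M' := by
    refine fun i => ⟨hunion i ▸ hrefl i, fun j₀ j₁ hne => ?_⟩
    rw [eq_empty_iff_forall_notMem]
    rintro S ⟨h1, h2⟩
    exact hne (h1.1.2.symm.trans h2.1.2)
  obtain ⟨ladder, -, s, hs, hF⟩ := (h.isStage lam hlam).limit_big hc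
  have hPlam : P ∈ below F lam := ⟨α₀, hα₀lam, hP⟩
  obtain ⟨hf, -, hhit⟩ := hs P hPlam 0 zero_lt_ord
  have hhit := hhit M' hM' hg'
  set f := s P 0
  have hqcl : IsClubTree (fusionLimit f) :=
    IsFusionSeq.isClubTree_fusionLimit ⟨hf.isClubTree, hf.leRank⟩ zero_lt_ord
  obtain ⟨r, hr, hreq⟩ := hqcl.exists_cone_eq_self
  have hq : fusionLimit f ∈ total F := by
    refine ⟨lam, hlam, ?_⟩
    rw [hF]
    exact InterClosure.base _ (Or.inr ⟨P, hPlam, 0, zero_lt_ord, r, hr, hreq.symm⟩)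
  -- the level of `f (i + 1)` at which the value at `i` is decided
  let η : Iio κ.ord → Ordinal.{u} := fun i => levEnum (f (i.1 + 1)) (0 + (i.1 + 1))
  have hiκ : ∀ i : Iio κ.ord, i.1 + 1 < κ.ord := fun i => add_one_lt_ord i.2
  have hη : ∀ i, η i < κ.ord := fun i =>
    (hf.isClubTree _ (hiκ i)).levEnum_lt (add_lt_ord zero_lt_ord (hiκ i))
  have hex : ∀ i, ∀ t ∈ f (i.1 + 1), t.len = η i →
      ∃ S ∈ B i, cone (f (i.1 + 1)) t ⊆ S := by
    intro i t ht htl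
    obtain ⟨S, hS, h1⟩ := hhit i t (((hf.isClubTree _ (hiκ i)).mem_splitRank
      (add_lt_ord zero_lt_ord (hiκ i))).2 ⟨ht, htl⟩)
    rw [hunion i] at hS
    exact ⟨S, hS.1, h1⟩
  choose! S hSB hS using hex
  have hz : ∀ i : Iio κ.ord, ∃ z < κ.ord,
      ∀ t : {t | t ∈ f (i.1 + 1) ∧ t.len = η i}, (J i (S i t.1)).1 ≤ z := by
    intro i
    refine exists_bound ?_ _ fun t => (J i (S i t.1)).2
    rw [isRegular_of_fact.cof_ord]
    exact (Cardinal.mk_le_mk_of_subset fun w hw => hw.2).trans_lt (mk_level_lt (hη i))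
  choose z hz hz' using hz
  have hqp : fusionLimit f ⊆ P := fun v hv => hf.zero ▸ hv 0 zero_lt_ord
  refine ⟨⟨_, hq⟩, hqp, fun i => ⟨z i + 1, add_one_lt_ord (hz i)⟩, ?_⟩
  rintro i ⟨Q, hQ⟩ (hQq : Q ⊆ fusionLimit f)
  obtain ⟨t, ht, htl⟩ := (h.isClubTree_below hQ).isPruned.exists_len (hη i)
  have htf : t ∈ f (i.1 + 1) := hQq ht _ (hiκ i)
  have hR : cone Q t ∈ total F := h.coneClosed_below Q hQ t ht
  have hRS : cone Q t ⊆ S i t :=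
    (cone_mono (fun v hv => hQq hv _ (hiκ i)) t).trans (hS i t htf htl)
  obtain ⟨hSt, hdec⟩ := hBE i (hSB i t htf htl)
  have hdec := hdec.resolve_right fun hinc => hinc (compatible_iff.2
    ⟨_, hR, hRS, (cone_subset _ _).trans (hQq.trans hqp)⟩)
  refine ⟨⟨_, hR⟩, cone_subset _ _, J i (S i t), ?_, forcesMem_mono (hJ i _ hSt hdec) hRS⟩
  exact (hz' i ⟨t, htf, htl⟩).trans_lt (lt_add_one _)

end IsPartial

end TreeForcing

theorem mainTheorem1 (κ : Cardinal.{u}) (hκ : κ.IsInaccessible)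
    (D : Ordinal.{u} → Set Ordinal.{u}) (hD : TreeForcing.IsDiamondSeq κ D) :
    Nonempty (TreeForcing.Coding κ) ∧
    ∀ c : TreeForcing.Coding κ,
      (∃ F, TreeForcing.IsConstruction D c F) ∧
      ∀ F, TreeForcing.IsConstruction D c F →
        TreeForcing.IsLtClosed κ (TreeForcing.total F) ∧
        TreeForcing.HasChainCondition (Order.succ κ) (TreeForcing.total F) ∧
        TreeForcing.IsBounding κ (TreeForcing.total F) := by
  have : Fact κ.IsInaccessible := ⟨hκ⟩
  refine ⟨hD.nonempty_coding, fun c => ⟨TreeForcing.exists_isConstruction D c, fun F hF => ?_⟩⟩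
  have h := hF.isPartial
  exact ⟨h.isLtClosed, h.hasChainCondition hD, h.isBounding hD⟩
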